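/- Setting. Let $F$ be a field with involution $r\mapsto r^*$ (an automorphism with $r^{**}=r$; the identity is allowed) and prime subfield $F_0$, and let $V$ be an $F$-vector space of finite dimension $d\ge 3$ with a non-alternate, non-degenerate $*$-hermitean form $\langle\cdot,\cdot\rangle$. Write $|v|=\langle v,v\rangle$. Let $L$ be the lattice of all subspaces of $V$ with join $U_1+U_2$, bottom $0$ and involution $U\mapsto U^\perp$. A tuple $\bar\alpha=(\alpha_1,\dots,\alpha_d)\in F^d$ is admissible if $\alpha_1=1$, $\alpha_i=\alpha_i^*\neq 0$ for all $i$, and $V$ has an orthogonal basis $\bar v$ with $\alpha_i=|v_1|^{-1}|v_i|$ for all $i$; call such a $\bar v$ an $\bar\alpha$-basis. Fix $n$ and a dimension vector $\underline d=(d_1,\dots,d_n)$, $0\le d_k\le d$, and let $L^{\underline d}=\{\bar u\in L^n\mid \dim u_k=d_k \text{ for all } k\}$. Call $M\subseteq L^{\underline d}$ invariant if it is invariant under the componentwise action of all scaled isometries of $V$, i.e. of all linear automorphisms $g$ with $\langle gx,gy\rangle=r\langle x,y\rangle$ for some $r=r^*\ne0$ in $F$ and all $x,y\in V$. Let $I_k$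 be the set of strictly increasing $k$-tuples in $\{1,\dots,d\}$. For $A\in F^{d\times d}$ of rank $k>0$ let ${\sf P}_k(A)\subseteq F^{I_k}$ be the set of non-zero vectors in the ($1$-dimensional) span of the vectors $(\det A_{\bar i}^{\bar j})_{\bar i\in I_k}$, $\bar j\in I_k$, where $A_{\bar i}^{\bar j}$ is the submatrix of $A$ with rows $\bar i$ and columns $\bar j$; let ${\sf P}_0(0)=\{0\}$. Put $\Gamma_k=\bigcup\{{\sf P}_k(A)\mid \operatorname{rk}A=k\}$ and $\Gamma_{\underline d}=\Gamma_{d_1}\times\dots\times\Gamma_{d_n}$. Call $\Delta\subseteq\Gamma_{\underline d}$ scalar invariant if $(\underline r_1,\dots,\underline r_n)\in\Delta$ implies $(\lambda_1\underline r_1,\dots,\lambda_n\underline r_n)\in\Delta$ for all non-zero $\lambda_k\in F$, and $\bar\alpha$-bi-invariant if in addition $(\underline r_k)_k\in\Delta$ implies $(\underline s_k)_k\in\Delta$ whenever $\underline r_k\in{\sf P}_{d_k}(A_k)$ and $\underline s_k\in{\sf P}_{d_k}(TA_k)$ for all $k$, where $\operatorname{rk}A_k=d_k$ and $T\in F^{d\times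 d}$ is invertible with $D_{\bar\alpha}^{-1}T^*D_{\bar\alpha}=rT^{-1}$ for some $r=r^*\neq0$ in $F$; here $T^*$ is the conjugate transpose and $D_{\bar\alpha}=\operatorname{diag}(\bar\alpha)$. For $M\subseteq L^{\underline d}$ let $\theta(M)$ be the set of all $\bar r\in\Gamma_{\underline d}$ such that there are an $\bar\alpha$-basis $\bar v$ and matrices $A_k$ of rank $d_k$ with $\underline r_k\in{\sf P}_{d_k}(A_k)$ and $({\rm Sp}_{\bar v}(A_1),\dots,{\rm Sp}_{\bar v}(A_n))\in M$, where ${\rm Sp}_{\bar v}(A)$ is the subspace spanned by the vectors $\sum_i a_{ij}v_i$, $j=1,\dots,d$. For $\Delta\subseteq\Gamma_{\underline d}$ let $\theta'(\Delta)$ be the set of all tuples $({\rm Sp}_{\bar v}(A_1),\dots,{\rm Sp}_{\bar v}(A_n))$ with $\bar v$ an $\bar\alpha$-basis, $\operatorname{rk}A_k=d_k$, and $\underline r_k\in{\sf P}_{d_k}(A_k)$ for all $k$, for some $\bar r\in\Delta$. Let $\Lambda_L$ be the first order language of $+,0,{}^\perp$, let $\Lambda_F$ be that of $*$-rings with constants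 $0,1$, and let $\Lambda_F^+$ be $\Lambda_F$ with additional constants $c_1,\dots,c_d$, interpreted as $\alpha_1,\dots,\alpha_d$. A set is defined by a formula within $L^{\underline d}$ (within $\Gamma_{\underline d}$) if it consists of the elements of $L^{\underline d}$ (of $\Gamma_{\underline d}$) that satisfy the formula in $L$ (in $F$); in formulas about $\Gamma_{\underline d}$ the variables are the coordinates $y_{k\bar i}$, $\bar i\in I_{d_k}$. A formula $\chi$ is scalar invariant with respect to $F$ if $F\models\chi(\underline r_1,\dots,\underline r_n)$ iff $F\models\chi(\lambda_1\underline r_1,\dots,\lambda_n\underline r_n)$ for all $\bar r\in\Gamma_{\underline d}$ and all non-zero $\lambda_k\in F$. $\Sigma_1$ consists of the formulas given by a (possibly empty) block of existential quantifiers followed by a quantifier free formula. Theorem. Let $d\ge3$ and a dimension vector $\underline d$ be given. For all $F$, $V$ as above and admissible $\bar\alpha$, $\theta$ is a bijection from the set of invariant subsets $M$ of $L^{\underline d}$ onto the set of $\bar\alpha$-bi-invariant subsets $\Delta$ of $\Gamma_{\underline d}$, with inverse $\theta'$. Moreover: (i) There is a map $\tau$ from $\Lambda_L$-formulas in $x_1,\dots,x_n$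 to $\Lambda_F^+$-formulas, depending only on $d$ and $\underline d$, which maps quantifier free formulas to quantifier free ones and $\Sigma_1$-formulas to $\Sigma_1$-formulas, such that for all $F$, $V$ and admissible $\bar\alpha$: if $M$ is defined by $\phi$ within $L^{\underline d}$, then $\theta(M)$ is $\bar\alpha$-bi-invariant and is defined within $\Gamma_{\underline d}$ by $\tau(\phi)$, which is scalar invariant with respect to $F$. If $\bar\alpha\in F_0^d$, then there is such a translation, depending on $d$, $\underline d$, $F$ and $\bar\alpha$, with values in $\Lambda_F$. (ii) If $\bar\alpha\in F_0^d$, then there is a map $\sigma$ from $\Lambda_F^+$-formulas to $\Lambda_L$-formulas, depending only on $d$, $\underline d$, $F$ and $\bar\alpha$, which maps $\Sigma_1$-formulas to $\Sigma_1$-formulas, such that for all $V$ for which $\bar\alpha$ is admissible: if $\Delta$ is $\bar\alpha$-bi-invariant and defined by $\chi$ within $\Gamma_{\underline d}$, then $\theta'(\Delta)$ is defined by $\sigma(\chi)$ within $L^{\underline d}$. -/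

import Mathlib

universe u v

noncomputable section

/-! ### First order languages -/

/-- Operation symbols of bounded lattices with involution: join, bottom, involution. -/
inductive InvLatticeFunc : ℕ → Type
  | join : InvLatticeFunc 2
  | zero : InvLatticeFunc 0
  | perp : InvLatticeFunc 1

/-- The language `Λ_L` of bounded lattices with involution. -/
def latticeLang : FirstOrder.Language.{0, 0} where
  Functions := InvLatticeFunc
  Relations := fun _ => Empty

/-- Operation symbols of `*`-rings, together with `m` additional constant symbols. -/
inductive StarRingFunc (m : ℕ) : ℕ → Type
  | add : StarRingFunc m 2
  | mul : StarRingFunc m 2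
  | neg : StarRingFunc m 1
  | star : StarRingFunc m 1
  | zero : StarRingFunc m 0
  | one : StarRingFunc m 0
  | const : Fin m → StarRingFunc m 0

/-- The language of `*`-rings with `m` additional constants. The language `Λ_F` is
`starRingLang 0`, and the language `Λ_F⁺` (for dimension `d`) is `starRingLang d`. -/
def starRingLang (m : ℕ) : FirstOrder.Language.{0, 0} where
  Functions := StarRingFunc m
  Relations := fun _ => Empty

/-- A `*`-field as a structure for `starRingLang m`, the additional constants being
interpreted by `c`. -/
@[reducible] def starRingStructure {m : ℕ} (F : Type*) [Field F] [StarRing F] (c : Fin m → F) :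
    (starRingLang m).Structure F where
  funMap := fun {_} f => match f with
    | StarRingFunc.add => fun x => x 0 + x 1
    | StarRingFunc.mul => fun x => x 0 * x 1
    | StarRingFunc.neg => fun x => - x 0
    | StarRingFunc.star => fun x => star (x 0)
    | StarRingFunc.zero => fun _ => 0
    | StarRingFunc.one => fun _ => 1
    | StarRingFunc.const i => fun _ => c i
  RelMap := fun {_} R _ => R.elim

/-- `F ⊨ χ(r)`, the additional constants being interpreted by `c`. -/
def FieldSat {m : ℕ} {F : Type*} [Field F] [StarRing F] (c : Fin m → F) {ι : Type*}
    (χ : (starRingLang m).Formula ι) (r : ι → F) : Prop :=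
  letI := starRingStructure F c
  χ.Realize r

/-! ### Inner product spaces and their subspace lattices -/

section Spaces

variable {F : Type*} [Field F] [StarRing F] {V : Type*} [AddCommGroup V] [Module F V]

/-- `B` is a non-degenerate, non-alternate `*`-hermitean form (conjugate-linear in the first
argument and linear in the second one). -/
structure IsInnerForm (B : V →ₗ⋆[F] V →ₗ[F] F) : Prop where
  herm : ∀ v w, B w v = star (B v w)
  nondeg : ∀ v, (∀ w, B w v = 0) → v = 0
  nonalt : ∃ v, B v v ≠ 0

/-- The lattice `L(V)` of all subspaces, with the involution
`U ↦ U^⊥ = {x | ∀ u ∈ U, ⟨u, x⟩ = 0}`, as a structure (for hermitean forms `⟨u, x⟩ = 0` and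
`⟨x, u⟩ = 0` are equivalent). -/
@[reducible] def latticeStructure (B : V →ₗ⋆[F] V →ₗ[F] F) :
    latticeLang.Structure (Submodule F V) where
  funMap := fun {_} f => match f with
    | InvLatticeFunc.join => fun x => x 0 ⊔ x 1
    | InvLatticeFunc.zero => fun _ => ⊥
    | InvLatticeFunc.perp => fun x => (x 0).orthogonalBilin B
  RelMap := fun {_} R _ => R.elim

/-- `L(V) ⊨ φ(u)`. -/
def LatticeSat (B : V →ₗ⋆[F] V →ₗ[F] F) {ι : Type*} (φ : latticeLang.Formula ι)
    (u : ι → Submodule F V) : Prop :=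
  letI := latticeStructure B
  φ.Realize u

/-- `v` is an orthogonal basis with `|v| = α`, where
`|v| = (1, |v₁|⁻¹|v₂|, …, |v₁|⁻¹|v_d|)` and `|v_i| = ⟨v_i, v_i⟩`. -/
def IsAdaptedBasis {d : ℕ} [NeZero d] (B : V →ₗ⋆[F] V →ₗ[F] F) (α : Fin d → F)
    (v : Module.Basis (Fin d) F V) : Prop :=
  (∀ i j, i ≠ j → B (v i) (v j) = 0) ∧ ∀ i, α i = (B (v 0) (v 0))⁻¹ * B (v i) (v i)

/-- `α` is admissible with respect to `V` (with form `B`). -/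
def Admissible {d : ℕ} [NeZero d] (B : V →ₗ⋆[F] V →ₗ[F] F) (α : Fin d → F) : Prop :=
  α 0 = 1 ∧ (∀ i, star (α i) = α i ∧ α i ≠ 0) ∧
    ∃ v : Module.Basis (Fin d) F V, IsAdaptedBasis B α v

/-- A set of tuples of subspaces is invariant if it is mapped into itself by every scaled isometry
of `V` onto itself. -/
def IsInvariantSet (B : V →ₗ⋆[F] V →ₗ[F] F) {n : ℕ} (M : Set (Fin n → Submodule F V)) : Prop :=
  ∀ (g : V ≃ₗ[F] V) (r : F), r ≠ 0 → star r = r → (∀ x y, B (g x) (g y) = r * B x y) →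
    ∀ u ∈ M, (fun k => (u k).map (g : V →ₗ[F] V)) ∈ M

/-- Tuples of subspaces with dimension vector `dv`. -/
def dimTuples (F : Type*) [Field F] (V : Type*) [AddCommGroup V] [Module F V] {n : ℕ}
    (dv : Fin n → ℕ) : Set (Fin n → Submodule F V) :=
  {u | ∀ k, Module.finrank F (u k) = dv k}

/-- The span of the columns of `A`, with `V` coordinatized by the basis `v`. -/
def colSpan {d : ℕ} (v : Module.Basis (Fin d) F V) (A : Matrix (Fin d) (Fin d) F) :
    Submodule F V :=
  Submodule.span F (Set.range fun j => ∑ i, A i j • v i)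

/-- From tuples of subspaces to tuples of matrices (union over all bases with `|v| = α`). -/
def thetaLF {d n : ℕ} [NeZero d] (B : V →ₗ⋆[F] V →ₗ[F] F) (α : Fin d → F)
    (M : Set (Fin n → Submodule F V)) : Set (Fin n → Matrix (Fin d) (Fin d) F) :=
  {A | ∃ v : Module.Basis (Fin d) F V, IsAdaptedBasis B α v ∧ (fun k => colSpan v (A k)) ∈ M}

/-- From tuples of matrices to tuples of subspaces (union over all bases with `|v| = α`). -/
def thetaFL {d n : ℕ} [NeZero d] (B : V →ₗ⋆[F] V →ₗ[F] F) (α : Fin d → F)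
    (K : Set (Fin n → Matrix (Fin d) (Fin d) F)) : Set (Fin n → Submodule F V) :=
  {u | ∃ v : Module.Basis (Fin d) F V, IsAdaptedBasis B α v ∧
    ∃ A ∈ K, u = fun k => colSpan v (A k)}

end Spaces

/-! ### Grassmann-Plücker coordinates -/

section Pluecker

variable {F : Type*} [Field F]

/-- The coordinate space `F^{I_k}`, where `I_k` is the set of strictly increasing `k`-tuples. -/
abbrev PluckerVec (F : Type*) (d k : ℕ) : Type _ := (Fin k ↪o Fin d) → F

/-- The set of projective Grassmann-Plücker coordinates of the column space of a matrix of
rank `k`: the non-zero vectors in the span of the vectors of `k × k`-minors, each taken from `k`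
fixed columns. By convention it is `{0}` if `k = 0`. -/
def pluckerSet {d : ℕ} (k : ℕ) (A : Matrix (Fin d) (Fin d) F) : Set (PluckerVec F d k) :=
  if k = 0 then {0}
  else {r | r ∈ Submodule.span F (Set.range fun (j : Fin k ↪o Fin d) =>
      (fun i : Fin k ↪o Fin d => (A.submatrix i j).det)) ∧ r ≠ 0}

/-- `Γ_k^d(F)`. -/
def grassmannian (F : Type*) [Field F] (d k : ℕ) : Set (PluckerVec F d k) :=
  {r | ∃ A : Matrix (Fin d) (Fin d) F, A.rank = k ∧ r ∈ pluckerSet k A}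

/-- `Γ_{dv}^d(F)`, the product of the `Γ_{dv k}^d(F)`. -/
def grassmannianProd (F : Type*) [Field F] (d : ℕ) {n : ℕ} (dv : Fin n → ℕ) :
    Set ((k : Fin n) → PluckerVec F d (dv k)) :=
  {r | ∀ k, r k ∈ grassmannian F d (dv k)}

/-- Tuples of `d × d`-matrices with rank vector `dv`. -/
def rankTuples (F : Type*) [Field F] (d : ℕ) {n : ℕ} (dv : Fin n → ℕ) :
    Set (Fin n → Matrix (Fin d) (Fin d) F) :=
  {A | ∀ k, (A k).rank = dv k}

/-- From sets of tuples of matrices to sets of tuples of coordinate vectors. -/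
def thetaFG {d n : ℕ} (dv : Fin n → ℕ) (K : Set (Fin n → Matrix (Fin d) (Fin d) F)) :
    Set ((k : Fin n) → PluckerVec F d (dv k)) :=
  {r | ∃ A ∈ K, A ∈ rankTuples F d dv ∧ ∀ k, r k ∈ pluckerSet (dv k) (A k)}

/-- From sets of tuples of coordinate vectors to sets of tuples of matrices. -/
def thetaGF {d n : ℕ} (dv : Fin n → ℕ) (Δ : Set ((k : Fin n) → PluckerVec F d (dv k))) :
    Set (Fin n → Matrix (Fin d) (Fin d) F) :=
  {A | A ∈ rankTuples F d dv ∧ ∃ r ∈ Δ, ∀ k, r k ∈ pluckerSet (dv k) (A k)}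

/-- Invariance of a set of tuples of coordinate vectors under rescaling each component. -/
def IsScalarInvariant {d n : ℕ} {dv : Fin n → ℕ}
    (Δ : Set ((k : Fin n) → PluckerVec F d (dv k))) : Prop :=
  ∀ r ∈ Δ, ∀ c : Fin n → F, (∀ k, c k ≠ 0) → (fun k => c k • r k) ∈ Δ

variable [StarRing F]

/-- `T ∈ O⁺_α(F, d)`: `T` is invertible and `D_α⁻¹ T^* D_α = r T⁻¹` for some `r = r^* ≠ 0`. -/
def IsScaledOrthogonal {d : ℕ} (α : Fin d → F) (T : Matrix (Fin d) (Fin d) F) : Prop :=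
  IsUnit T ∧ ∃ r : F, r ≠ 0 ∧ star r = r ∧
    (Matrix.diagonal α)⁻¹ * T.conjTranspose * Matrix.diagonal α = r • T⁻¹

/-- `α`-bi-invariant subsets of `Γ_{dv}^d(F)`. -/
def IsBiInvariant {d n : ℕ} (α : Fin d → F) (dv : Fin n → ℕ)
    (Δ : Set ((k : Fin n) → PluckerVec F d (dv k))) : Prop :=
  Δ ⊆ grassmannianProd F d dv ∧ IsScalarInvariant Δ ∧
    ∀ T : Matrix (Fin d) (Fin d) F, IsScaledOrthogonal α T →
      ∀ A ∈ rankTuples F d dv, ∀ r s : (k : Fin n) → PluckerVec F d (dv k),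
        (∀ k, r k ∈ pluckerSet (dv k) (A k)) → (∀ k, s k ∈ pluckerSet (dv k) (T * A k)) →
          r ∈ Δ → s ∈ Δ

/-- Variables for the coordinates of a tuple of coordinate vectors. -/
abbrev PluckerVar (d : ℕ) {n : ℕ} (dv : Fin n → ℕ) : Type :=
  (k : Fin n) × (Fin (dv k) ↪o Fin d)

/-- The subset of `Γ_{dv}^d(F)` defined by `χ` within `Γ_{dv}^d(F)`. -/
def definedInGrassmannian {d n m : ℕ} (dv : Fin n → ℕ) (c : Fin m → F)
    (χ : (starRingLang m).Formula (PluckerVar d dv)) :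
    Set ((k : Fin n) → PluckerVec F d (dv k)) :=
  {r | r ∈ grassmannianProd F d dv ∧ FieldSat c χ fun p => r p.1 p.2}

/-- Scalar invariance of a formula with respect to `F`. -/
def IsScalarInvariantFormula {d n m : ℕ} (dv : Fin n → ℕ) (c : Fin m → F)
    (χ : (starRingLang m).Formula (PluckerVar d dv)) : Prop :=
  ∀ r ∈ grassmannianProd F d dv, ∀ a : Fin n → F, (∀ k, a k ≠ 0) →
    (FieldSat c χ (fun p => r p.1 p.2) ↔ FieldSat c χ (fun p => a p.1 * r p.1 p.2))

variable {V : Type*} [AddCommGroup V] [Module F V]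

/-- From sets of tuples of subspaces with dimension vector `dv` to sets of tuples of
coordinate vectors. -/
def thetaLG {d n : ℕ} [NeZero d] (B : V →ₗ⋆[F] V →ₗ[F] F) (α : Fin d → F) (dv : Fin n → ℕ)
    (M : Set (Fin n → Submodule F V)) : Set ((k : Fin n) → PluckerVec F d (dv k)) :=
  thetaFG dv (thetaLF B α M)

/-- From sets of tuples of coordinate vectors to sets of tuples of subspaces. -/
def thetaGL {d n : ℕ} [NeZero d] (B : V →ₗ⋆[F] V →ₗ[F] F) (α : Fin d → F) (dv : Fin n → ℕ)
    (Δ : Set ((k : Fin n) → PluckerVec F d (dv k))) : Set (Fin n → Submodule F V) :=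
  thetaFL B α (thetaGF dv Δ)

/-- The subset of `L^{dv}` defined by `φ` within `L^{dv}`. -/
def definedInLattice {n : ℕ} (B : V →ₗ⋆[F] V →ₗ[F] F) (dv : Fin n → ℕ)
    (φ : latticeLang.Formula (Fin n)) : Set (Fin n → Submodule F V) :=
  {u | u ∈ dimTuples F V dv ∧ LatticeSat B φ u}

end Pluecker

end

/-! The bijection rests on two facts. Relative to two `α`-bases the form has proportional diagonal
Gram matrices, so the linear map carrying one basis to the other is a scaled isometry, and the
matrix of the base change is scaled orthogonal. Also, Plücker coordinates determine the column space
of a matrix, and are determined by it up to a scalar. For invariant `M` the union over all bases and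
all matrices in `thetaLG` therefore collapses to a test on one basis and one tuple of matrices
(`mem_thetaLG_iff_of_mem_pluckerSet`). Conversely, two descriptions of a tuple of subspaces differ
by a scaled orthogonal matrix, which bi-invariance absorbs (`thetaLG_thetaGL`).

Both translations are interpretations of one structure in another, uniform over a family of models;
`Interpretation` isolates what is needed. Elements are coded by finite tuples, the code condition
and the equality of terms are quantifier free on codes, and a quantifier over elements becomes a
quantifier over codes. Quantifier free and existential formulas then keep their shape.

For (i), subspaces are coded by matrices, via column spans over a fixed `α`-basis. Intersection with
the kernel of a linear form is one division-free elimination step with a finite case distinction on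
the pivot (`colSpan_eliminate`). An orthogonal complement is an intersection of such kernels, and
joins follow by duality. A subspace given by Plücker coordinates is also cut out by linear forms
whose coefficients are these coordinates up to sign (`colSpan_eq_plSpace`). Only the ratios of the
diagonal values of the form matter, so the constants `α` suffice; if they lie in the prime subfield,
clearing denominators turns them into integers.

For (ii), an orthogonal frame (coordinate lines and unit lines) yields a copy of the field on one
axis by von Staudt's constructions; a third axis is needed as auxiliary, whence `d ≥ 3`. The polar
of a point in the plane of its axis yields the involution and the ratios of the norms. The lattice
formula says: there are an orthogonal frame and points coding coordinates, matrices and coefficients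
such that the coordinates come from the minors of the matrices, the norm ratios are the given
integer fractions `α`, the coordinates satisfy `χ`, and the given subspaces are the column spans
(`exists_lattice_formula`). -/

/-! ### Uniform definability in families of structures. -/

section Definability

variable (L : FirstOrder.Language.{0, 0}) {S : Type*} {M : S → Type*} [∀ s, L.Structure (M s)]
  {κ ι β : Type} (p : ∀ s, κ → M s)

/-- `f` is uniformly given by a term, in the parameters `p s` and the variables `ι`. -/
def TermDef (f : ∀ s, (ι → M s) → M s) : Prop :=
  ∃ t : L.Term (κ ⊕ ι), ∀ s x, t.realize (Sum.elim (p s) x) = f s x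

/-- `P` is uniformly defined by a quantifier free formula with parameters `p s`. -/
def QFDef (P : ∀ s, (ι → M s) → Prop) : Prop :=
  ∃ φ : L.Formula (κ ⊕ ι), φ.IsQF ∧ ∀ s x, φ.Realize (Sum.elim (p s) x) ↔ P s x

/-- `P` is uniformly defined by a first order formula with parameters `p s`. -/
def FODef (P : ∀ s, (ι → M s) → Prop) : Prop :=
  ∃ φ : L.Formula (κ ⊕ ι), ∀ s x, φ.Realize (Sum.elim (p s) x) ↔ P s x

/-- `P` is a projection of a predicate uniformly defined by a quantifier free formula. -/
def ExDef (P : ∀ s, (ι → M s) → Prop) : Prop :=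
  ∃ (β : Type) (_ : Finite β) (Q : ∀ s, (ι ⊕ β → M s) → Prop), QFDef L p Q ∧
    ∀ s x, P s x ↔ ∃ y, Q s (Sum.elim x y)

variable {L p}

theorem TermDef.var (i : ι) : TermDef L p fun _ x => x i :=
  ⟨FirstOrder.Language.Term.var (Sum.inr i), fun _ _ => rfl⟩

theorem TermDef.param (k : κ) : TermDef L p (ι := ι) fun s _ => p s k :=
  ⟨FirstOrder.Language.Term.var (Sum.inl k), fun _ _ => rfl⟩

theorem TermDef.subst {f : ∀ s, (β → M s) → M s} (hf : TermDef L p f)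
    {g : β → ∀ s, (ι → M s) → M s} (hg : ∀ b, TermDef L p (g b)) :
    TermDef L p fun s x => f s fun b => g b s x := by
  obtain ⟨t, ht⟩ := hf
  choose r hr using hg
  refine ⟨t.subst (Sum.elim (fun k => FirstOrder.Language.Term.var (Sum.inl k)) r), fun s x => ?_⟩
  rw [FirstOrder.Language.Term.realize_subst]
  refine Eq.trans ?_ (ht s _)
  congr 1
  funext i
  cases i <;> simp [hr]

theorem TermDef.func {k : ℕ} (h : L.Functions k) {g : Fin k → ∀ s, (ι → M s) → M s}
    (hg : ∀ b, TermDef L p (g b)) :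
    TermDef L p fun s x => FirstOrder.Language.Structure.funMap h fun b => g b s x := by
  choose r hr using hg
  exact ⟨FirstOrder.Language.Term.func h r, fun s x => by simp [hr]⟩

theorem BoundedFormula.isQF_subst {α γ : Type} {n : ℕ} {φ : L.BoundedFormula α n} (h : φ.IsQF)
    (f : α → L.Term γ) : (φ.subst f).IsQF := by
  induction h with
  | falsum => exact .falsum
  | of_isAtomic h =>
    cases h with
    | equal => exact .of_isAtomic (.equal _ _)
    | rel => exact .of_isAtomic (.rel _ _)
  | imp _ _ h₁ h₂ => exact h₁.imp h₂

theorem QFDef.congr {P Q : ∀ s, (ι → M s) → Prop} (h : QFDef L p P) (e : ∀ s x, Q s x ↔ P s x) :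
    QFDef L p Q := by
  obtain ⟨φ, h₁, h₂⟩ := h
  exact ⟨φ, h₁, fun s x => (h₂ s x).trans (e s x).symm⟩

theorem QFDef.subst {P : ∀ s, (β → M s) → Prop} (hP : QFDef L p P)
    {g : β → ∀ s, (ι → M s) → M s} (hg : ∀ b, TermDef L p (g b)) :
    QFDef L p fun s x => P s fun b => g b s x := by
  obtain ⟨φ, hφ, h⟩ := hP
  choose r hr using hg
  refine ⟨φ.subst (Sum.elim (fun k => FirstOrder.Language.Term.var (Sum.inl k)) r),
    BoundedFormula.isQF_subst hφ _, fun s x => ?_⟩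
  refine Iff.trans ?_ (h s _)
  rw [FirstOrder.Language.Formula.Realize, FirstOrder.Language.BoundedFormula.realize_subst,
    FirstOrder.Language.Formula.Realize]
  have e : (fun a => (Sum.elim (fun k => FirstOrder.Language.Term.var (L := L) (Sum.inl k)) r a).realize
      (Sum.elim (p s) x)) = Sum.elim (p s) fun b => g b s x := by
    funext i
    cases i <;> simp [hr]
  rw [e]

theorem QFDef.relabel {P : ∀ s, (β → M s) → Prop} (hP : QFDef L p P) (e : β → ι) :
    QFDef L p fun s x => P s (x ∘ e) :=
  hP.subst (g := fun b _ x => x (e b)) fun b => .var (e b)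

theorem QFDef.eq {f g : ∀ s, (ι → M s) → M s} (hf : TermDef L p f) (hg : TermDef L p g) :
    QFDef L p fun s x => f s x = g s x := by
  obtain ⟨t, ht⟩ := hf
  obtain ⟨r, hr⟩ := hg
  exact ⟨t.equal r, .of_isAtomic (.equal _ _), fun s x => by
    rw [FirstOrder.Language.Formula.realize_equal, ht, hr]⟩

theorem QFDef.false : QFDef L p (ι := ι) fun _ _ => False :=
  ⟨⊥, .falsum, fun _ _ => Iff.rfl⟩

theorem QFDef.imp {P Q : ∀ s, (ι → M s) → Prop} (hP : QFDef L p P) (hQ : QFDef L p Q) :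
    QFDef L p fun s x => P s x → Q s x := by
  obtain ⟨φ, h₁, h₂⟩ := hP
  obtain ⟨ψ, h₃, h₄⟩ := hQ
  exact ⟨φ.imp ψ, h₁.imp h₃, fun s x => by rw [FirstOrder.Language.Formula.realize_imp, h₂, h₄]⟩

theorem QFDef.not {P : ∀ s, (ι → M s) → Prop} (hP : QFDef L p P) :
    QFDef L p fun s x => ¬ P s x := hP.imp .false

theorem QFDef.true : QFDef L p (ι := ι) fun _ _ => True :=
  QFDef.false.not.congr fun _ _ => by simp

theorem QFDef.and {P Q : ∀ s, (ι → M s) → Prop} (hP : QFDef L p P) (hQ : QFDef L p Q) :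
    QFDef L p fun s x => P s x ∧ Q s x :=
  (hP.imp hQ.not).not.congr fun _ _ => by tauto

theorem QFDef.or {P Q : ∀ s, (ι → M s) → Prop} (hP : QFDef L p P) (hQ : QFDef L p Q) :
    QFDef L p fun s x => P s x ∨ Q s x :=
  (hP.not.imp hQ).congr fun _ _ => by tauto

theorem QFDef.exists {I : Type*} [Finite I] {P : I → ∀ s, (ι → M s) → Prop}
    (hP : ∀ i, QFDef L p (P i)) : QFDef L p fun s x => ∃ i, P i s x := by
  classical
  cases nonempty_fintype I
  have h (t : Finset I) : QFDef L p fun s x => ∃ i ∈ t, P i s x := by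
    induction t using Finset.induction_on with
    | empty => exact QFDef.false.congr fun _ _ => by simp
    | insert i t _ ih => exact ((hP i).or ih).congr fun _ _ => by simp
  exact (h Finset.univ).congr fun _ _ => by simp

theorem QFDef.forall {I : Type*} [Finite I] {P : I → ∀ s, (ι → M s) → Prop}
    (hP : ∀ i, QFDef L p (P i)) : QFDef L p fun s x => ∀ i, P i s x :=
  (QFDef.exists fun i => (hP i).not).not.congr fun _ _ => by simp

theorem QFDef.exDef {P : ∀ s, (ι → M s) → Prop} (hP : QFDef L p P) : ExDef L p P :=
  ⟨Empty, inferInstance, fun s x => P s (x ∘ Sum.inl), hP.relabel _, fun s x => by simp⟩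

theorem ExDef.relabel {P : ∀ s, (β → M s) → Prop} (hP : ExDef L p P) (e : β → ι) :
    ExDef L p fun s x => P s (x ∘ e) := by
  obtain ⟨γ, hγ, R, h₁, h₂⟩ := hP
  refine ⟨γ, hγ, fun s x => R s (x ∘ Sum.map e id), h₁.relabel _, fun s x => ?_⟩
  refine (h₂ s _).trans (exists_congr fun y => ?_)
  beta_reduce
  rw [Sum.elim_comp_map, Function.comp_id]

/-- Conjunction with a quantifier free condition is the only connective needed for projections,
since quantification over codes is always of the form "a code satisfying ...". -/
theorem ExDef.and_qfDef {P Q : ∀ s, (ι → M s) → Prop} (hP : ExDef L p P) (hQ : QFDef L p Q) :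
    ExDef L p fun s x => P s x ∧ Q s x := by
  obtain ⟨β, hβ, R, h₁, h₂⟩ := hP
  refine ⟨β, hβ, fun s x => R s x ∧ Q s (x ∘ Sum.inl), h₁.and (hQ.relabel _), fun s x => ?_⟩
  simp [h₂]

theorem ExDef.exists [Finite β] {P : ∀ s, (ι ⊕ β → M s) → Prop} (hP : ExDef L p P) :
    ExDef L p fun s x => ∃ y, P s (Sum.elim x y) := by
  obtain ⟨γ, hγ, R, h₁, h₂⟩ := hP
  refine ⟨β ⊕ γ, inferInstance, fun s x => R s (x ∘ Equiv.sumAssoc _ _ _), h₁.relabel _,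
    fun s x => ?_⟩
  constructor
  · rintro ⟨y, hy⟩
    obtain ⟨z, hz⟩ := (h₂ _ _).1 hy
    refine ⟨Sum.elim y z, ?_⟩
    convert hz using 1
    funext i
    rcases i with (i | i) | i <;> rfl
  · rintro ⟨y, hy⟩
    refine ⟨y ∘ Sum.inl, (h₂ _ _).2 ⟨y ∘ Sum.inr, ?_⟩⟩
    convert hy using 1
    funext i
    rcases i with (i | i) | i <;> rfl

theorem BoundedFormula.isExistential_exs {α : Type} {n : ℕ} {φ : L.BoundedFormula α n}
    (h : φ.IsExistential) : φ.exs.IsExistential := by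
  induction n with
  | zero => exact h
  | succ n ih => exact ih h.ex

theorem ExDef.exists_formula {P : ∀ s, (ι → M s) → Prop} (h : ExDef L p P) :
    ∃ φ : L.Formula (κ ⊕ ι), φ.IsExistential ∧ ∀ s x, φ.Realize (Sum.elim (p s) x) ↔ P s x := by
  obtain ⟨β, hβ, Q, ⟨φ, hφ, h₁⟩, h₂⟩ := h
  refine ⟨FirstOrder.Language.Formula.iExs β (FirstOrder.Language.Formula.relabel (Equiv.sumAssoc κ ι β).symm φ),
    BoundedFormula.isExistential_exs
      (FirstOrder.Language.BoundedFormula.IsQF.isExistential (.relabel (.relabel hφ _) _)), fun s x => ?_⟩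
  rw [FirstOrder.Language.Formula.realize_iExs, h₂]
  refine exists_congr fun y => ?_
  rw [FirstOrder.Language.Formula.realize_relabel, ← h₁]
  refine iff_of_eq (congrArg _ ?_)
  funext i
  rcases i with i | i | i <;> rfl

theorem QFDef.foDef {P : ∀ s, (ι → M s) → Prop} (hP : QFDef L p P) : FODef L p P := by
  obtain ⟨φ, _, h⟩ := hP
  exact ⟨φ, h⟩

theorem ExDef.foDef {P : ∀ s, (ι → M s) → Prop} (hP : ExDef L p P) : FODef L p P := by
  obtain ⟨φ, _, h⟩ := hP.exists_formula
  exact ⟨φ, h⟩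

theorem FODef.congr {P Q : ∀ s, (ι → M s) → Prop} (h : FODef L p P) (e : ∀ s x, Q s x ↔ P s x) :
    FODef L p Q := by
  obtain ⟨φ, h₁⟩ := h
  exact ⟨φ, fun s x => (h₁ s x).trans (e s x).symm⟩

theorem FODef.relabel {P : ∀ s, (β → M s) → Prop} (hP : FODef L p P) (e : β → ι) :
    FODef L p fun s x => P s (x ∘ e) := by
  obtain ⟨φ, h⟩ := hP
  refine ⟨FirstOrder.Language.Formula.relabel (Sum.map id e) φ, fun s x => ?_⟩
  rw [FirstOrder.Language.Formula.realize_relabel, Sum.elim_comp_map, Function.comp_id]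
  exact h s _

theorem FODef.imp {P Q : ∀ s, (ι → M s) → Prop} (hP : FODef L p P) (hQ : FODef L p Q) :
    FODef L p fun s x => P s x → Q s x := by
  obtain ⟨φ, h₁⟩ := hP
  obtain ⟨ψ, h₂⟩ := hQ
  exact ⟨φ.imp ψ, fun s x => by rw [FirstOrder.Language.Formula.realize_imp, h₁, h₂]⟩

theorem FODef.not {P : ∀ s, (ι → M s) → Prop} (hP : FODef L p P) :
    FODef L p fun s x => ¬ P s x := hP.imp QFDef.false.foDef

theorem FODef.and {P Q : ∀ s, (ι → M s) → Prop} (hP : FODef L p P) (hQ : FODef L p Q) :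
    FODef L p fun s x => P s x ∧ Q s x :=
  (hP.imp hQ.not).not.congr fun _ _ => by tauto

theorem FODef.exists [Finite β] {P : ∀ s, (ι ⊕ β → M s) → Prop} (hP : FODef L p P) :
    FODef L p fun s x => ∃ y, P s (Sum.elim x y) := by
  obtain ⟨φ, h₁⟩ := hP
  refine ⟨FirstOrder.Language.Formula.iExs β (FirstOrder.Language.Formula.relabel (Equiv.sumAssoc κ ι β).symm φ),
    fun s x => ?_⟩
  rw [FirstOrder.Language.Formula.realize_iExs]
  refine exists_congr fun y => ?_
  rw [FirstOrder.Language.Formula.realize_relabel, ← h₁]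
  refine iff_of_eq (congrArg _ ?_)
  funext i
  rcases i with i | i | i <;> rfl

theorem FODef.forall [Finite β] {P : ∀ s, (ι ⊕ β → M s) → Prop} (hP : FODef L p P) :
    FODef L p fun s x => ∀ y, P s (Sum.elim x y) :=
  hP.not.exists.not.congr fun _ _ => by simp

end Definability

/-! ### Transfer of formulas along interpretations. -/

section Interpretation

/-- Splits off the last one of `m + 1` blocks of variables. -/
def splitLast {m : ℕ} {J : Type} (i : Fin (m + 1) × J) : (Fin m × J) ⊕ J :=
  Fin.lastCases (motive := fun _ => (Fin m × J) ⊕ J) (Sum.inr i.2) (fun k => Sum.inl (k, i.2)) i.1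

/-- Data for interpreting the structures `N s` in the structures `M s`: elements of `N s` are coded
by `J`-tuples satisfying `C s`, and equality of terms is decided on codes by quantifier free
formulas with parameters `p s`. The free variables of formulas are interpreted by `w s`. -/
structure Interpretation (L L' : FirstOrder.Language.{0, 0}) {S : Type*} {M N : S → Type*}
    [∀ s, L.Structure (M s)] [∀ s, L'.Structure (N s)] {κ α J : Type} (p : ∀ s, κ → M s)
    (w : ∀ s, α → N s) (C : ∀ s, (J → M s) → Prop) (π : ∀ s, (J → M s) → N s) : Prop where
  finite : Finite J
  isEmpty : ∀ k, IsEmpty (L'.Relations k)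
  code : QFDef L p C
  surj : ∀ s n, ∃ z, C s z ∧ π s z = n
  eq : ∀ (m : ℕ) (t₁ t₂ : L'.Term (α ⊕ Fin m)), ∃ P : ∀ s, (Fin m × J → M s) → Prop,
    QFDef L p P ∧ ∀ s x, (∀ i, C s fun j => x (i, j)) →
      (P s x ↔ t₁.realize (Sum.elim (w s) fun i => π s fun j => x (i, j)) =
        t₂.realize (Sum.elim (w s) fun i => π s fun j => x (i, j)))

namespace Interpretation

variable {L L' : FirstOrder.Language.{0, 0}} {S : Type*} {M N : S → Type*}
    [∀ s, L.Structure (M s)] [∀ s, L'.Structure (N s)] {κ α J : Type} {p : ∀ s, κ → M s}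
    {w : ∀ s, α → N s} {C : ∀ s, (J → M s) → Prop} {π : ∀ s, (J → M s) → N s}

/-- `P` translates `φ` along the coding. -/
def Translates (w : ∀ s, α → N s) (C : ∀ s, (J → M s) → Prop) (π : ∀ s, (J → M s) → N s)
    {m : ℕ} (P : ∀ s, (Fin m × J → M s) → Prop) (φ : L'.BoundedFormula α m) : Prop :=
  ∀ s x, (∀ i, C s fun j => x (i, j)) →
    (P s x ↔ φ.Realize (w s) fun i => π s fun j => x (i, j))

theorem snoc_code {s : S} {m : ℕ} (x : Fin m × J → M s) (z : J → M s) :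
    (fun i => π s fun j => (Sum.elim x z ∘ splitLast) (i, j)) =
      Fin.snoc (α := fun _ => N s) (fun i => π s fun j => x (i, j)) (π s z) := by
  funext i
  refine Fin.lastCases ?_ (fun i => ?_) i <;> simp [splitLast]

theorem code_snoc {s : S} {m : ℕ} {x : Fin m × J → M s} {z : J → M s}
    (hx : ∀ i, C s fun j => x (i, j)) (hz : C s z) (i : Fin (m + 1)) :
    C s fun j => (Sum.elim x z ∘ splitLast) (i, j) := by
  refine Fin.lastCases ?_ (fun i => ?_) i
  · simpa [splitLast] using hz
  · simpa [splitLast] using hx i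

theorem qfDef_translates (I : Interpretation L L' p w C π) {m : ℕ} {φ : L'.BoundedFormula α m}
    (h : φ.IsQF) : ∃ P, QFDef L p P ∧ Translates w C π P φ := by
  induction h with
  | falsum => exact ⟨_, .false, fun s x _ => Iff.rfl⟩
  | of_isAtomic h =>
    cases h with
    | equal t₁ t₂ =>
      obtain ⟨P, h₁, h₂⟩ := I.eq _ t₁ t₂
      exact ⟨P, h₁, fun s x hx => by rw [h₂ s x hx, FirstOrder.Language.BoundedFormula.realize_bdEqual]⟩
    | rel R => exact ((I.isEmpty _).false R).elim
  | imp _ _ h₁ h₂ =>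
    obtain ⟨P, hP, h₁⟩ := h₁
    obtain ⟨Q, hQ, h₂⟩ := h₂
    exact ⟨_, hP.imp hQ, fun s x hx => by
      rw [h₁ s x hx, h₂ s x hx, FirstOrder.Language.BoundedFormula.realize_imp]⟩

/-- Since every element has a code, "there is an element" may be replaced by "there is a tuple that
is a code". The code condition is quantifier free, so no alternation of quantifiers arises. -/
theorem exDef_translates (I : Interpretation L L' p w C π) {m : ℕ} {φ : L'.BoundedFormula α m}
    (h : φ.IsExistential) : ∃ P, ExDef L p P ∧ Translates w C π P φ := by
  induction h with
  | of_isQF h =>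
    obtain ⟨P, h₁, h₂⟩ := I.qfDef_translates h
    exact ⟨P, h₁.exDef, h₂⟩
  | ex _ ih =>
    obtain ⟨P, h₁, h₂⟩ := ih
    have := I.finite
    refine ⟨_, ((h₁.relabel splitLast).and_qfDef (I.code.relabel Sum.inr)).exists,
      fun s x hx => ?_⟩
    rw [FirstOrder.Language.BoundedFormula.realize_ex]
    constructor
    · rintro ⟨z, h, hz⟩
      rw [Sum.elim_comp_inr] at hz
      exact ⟨π s z, by rwa [h₂ s _ (code_snoc hx hz), snoc_code] at h⟩
    · rintro ⟨n, hn⟩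
      obtain ⟨z, hz, rfl⟩ := I.surj s n
      exact ⟨z, by rwa [h₂ s _ (code_snoc hx hz), snoc_code], hz⟩

theorem foDef_translates (I : Interpretation L L' p w C π) {m : ℕ} (φ : L'.BoundedFormula α m) :
    ∃ P, FODef L p P ∧ Translates w C π P φ := by
  induction φ with
  | falsum => exact ⟨_, QFDef.false.foDef, fun s x _ => Iff.rfl⟩
  | equal t₁ t₂ =>
    obtain ⟨P, h₁, h₂⟩ := I.eq _ t₁ t₂
    exact ⟨P, h₁.foDef, fun s x hx => h₂ s x hx⟩
  | rel R => exact ((I.isEmpty _).false R).elim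
  | imp _ _ h₁ h₂ =>
    obtain ⟨P, hP, h₁⟩ := h₁
    obtain ⟨Q, hQ, h₂⟩ := h₂
    exact ⟨_, hP.imp hQ, fun s x hx => by
      rw [h₁ s x hx, h₂ s x hx, FirstOrder.Language.BoundedFormula.realize_imp]⟩
  | all _ ih =>
    obtain ⟨P, h₁, h₂⟩ := ih
    have := I.finite
    refine ⟨_, ((I.code.foDef.relabel Sum.inr).imp (h₁.relabel splitLast)).forall,
      fun s x hx => ?_⟩
    rw [FirstOrder.Language.BoundedFormula.realize_all]
    constructor
    · intro h n
      obtain ⟨z, hz, rfl⟩ := I.surj s n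
      rw [← snoc_code, ← h₂ s _ (code_snoc hx hz)]
      exact h z hz
    · intro h z hz
      rw [Sum.elim_comp_inr] at hz
      rw [h₂ s _ (code_snoc hx hz), snoc_code]
      exact h _

variable (p) in
/-- Formulas without variables other than parameters. -/
theorem realize_relabel_param {m : ℕ} (hm : m = 0) (ψ : L.Formula (κ ⊕ Fin m × J)) (s : S)
    (x : Fin m × J → M s) :
    (FirstOrder.Language.Formula.relabel (Sum.elim id fun i => (Fin.elim0 (hm ▸ i.1) : κ)) ψ).Realize (p s) ↔
      ψ.Realize (Sum.elim (p s) x) := by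
  subst hm
  rw [FirstOrder.Language.Formula.realize_relabel]
  refine iff_of_eq (congrArg _ ?_)
  funext i
  rcases i with i | i
  · rfl
  · exact Fin.elim0 i.1

theorem exists_qf_formula (I : Interpretation L L' p w C π) {φ : L'.Formula α} (h : φ.IsQF) :
    ∃ ψ : L.Formula κ, ψ.IsQF ∧ ∀ s, ψ.Realize (p s) ↔ φ.Realize (w s) := by
  obtain ⟨P, ⟨ψ, h₁, h₂⟩, h₃⟩ := I.qfDef_translates h
  refine ⟨_, h₁.relabel _, fun s => (realize_relabel_param p rfl ψ s fun i => i.1.elim0).trans ?_⟩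
  rw [h₂, h₃ s _ fun i => i.elim0, FirstOrder.Language.Formula.Realize]
  exact iff_of_eq (congrArg _ (Subsingleton.elim _ _))

/-- The block of quantifiers is left outside `ψ`, so that further conditions and quantifiers can be
added around the quantifier free matrix. -/
theorem exists_existential_formula (I : Interpretation L L' p w C π) {φ : L'.Formula α}
    (h : φ.IsExistential) : ∃ (β : Type) (_ : Finite β) (ψ : L.Formula (κ ⊕ β)), ψ.IsQF ∧
      ∀ s, (∃ y, ψ.Realize (Sum.elim (p s) y)) ↔ φ.Realize (w s) := by
  obtain ⟨P, ⟨β, hβ, Q, ⟨ψ, h₀, h₁⟩, h₂⟩, h₃⟩ := I.exDef_translates h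
  refine ⟨β, hβ, FirstOrder.Language.Formula.relabel
    (Sum.elim Sum.inl (Sum.elim (fun i => i.1.elim0) Sum.inr)) ψ, h₀.relabel _, fun s => ?_⟩
  have h₄ := h₃ s (fun i => i.1.elim0) fun i => i.elim0
  rw [h₂] at h₄
  rw [FirstOrder.Language.Formula.Realize, Subsingleton.elim default _, ← h₄]
  refine exists_congr fun y => ?_
  rw [FirstOrder.Language.Formula.realize_relabel, ← h₁]
  refine iff_of_eq (congrArg _ ?_)
  funext i
  rcases i with i | i | i
  · rfl
  · exact Fin.elim0 i.1
  · rfl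

theorem exists_formula (I : Interpretation L L' p w C π) (φ : L'.Formula α) :
    ∃ ψ : L.Formula κ, ∀ s, ψ.Realize (p s) ↔ φ.Realize (w s) := by
  obtain ⟨P, ⟨ψ, h₂⟩, h₃⟩ := I.foDef_translates φ
  refine ⟨_, fun s => (realize_relabel_param p rfl ψ s fun i => i.1.elim0).trans ?_⟩
  rw [h₂, h₃ s _ fun i => i.elim0, FirstOrder.Language.Formula.Realize]
  exact iff_of_eq (congrArg _ (Subsingleton.elim _ _))

end Interpretation

end Interpretation

/-! ### Column spans relative to a basis. -/

section ColSpan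

variable {F : Type*} [Field F] {V : Type*} [AddCommGroup V] [Module F V] {d : ℕ}
  (v : Module.Basis (Fin d) F V)

/-- The vector with coordinates `a` with respect to the basis `v`. -/
noncomputable def coordVec (v : Module.Basis (Fin d) F V) (a : Fin d → F) : V := ∑ i, a i • v i

theorem coordVec_eq (a : Fin d → F) : coordVec v a = v.equivFun.symm a := by
  rw [coordVec, v.equivFun_symm_apply]

theorem coordVec_repr (x : V) : coordVec v (v.repr x) = x := v.sum_repr x

@[simp] theorem repr_coordVec (a : Fin d → F) (i : Fin d) : v.repr (coordVec v a) i = a i := by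
  rw [coordVec_eq]
  exact congrFun (v.equivFun.apply_symm_apply a) i

theorem colSpan_eq_span (A : Matrix (Fin d) (Fin d) F) :
    colSpan v A = Submodule.span F (Set.range fun j => coordVec v fun i => A i j) := rfl

theorem coordVec_mem_colSpan (A : Matrix (Fin d) (Fin d) F) (j : Fin d) :
    coordVec v (fun i => A i j) ∈ colSpan v A := Submodule.subset_span ⟨j, rfl⟩

theorem colSpan_le_iff {A : Matrix (Fin d) (Fin d) F} {U : Submodule F V} :
    colSpan v A ≤ U ↔ ∀ j, coordVec v (fun i => A i j) ∈ U := by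
  rw [colSpan_eq_span, Submodule.span_le, Set.range_subset_iff]
  rfl

theorem coordVec_mulVec (A : Matrix (Fin d) (Fin d) F) (c : Fin d → F) :
    coordVec v (A.mulVec c) = ∑ j, c j • coordVec v fun i => A i j := by
  simp only [coordVec, Matrix.mulVec, dotProduct, Finset.sum_smul, Finset.smul_sum, smul_smul]
  rw [Finset.sum_comm]
  simp only [mul_comm]

theorem mem_colSpan_iff {A : Matrix (Fin d) (Fin d) F} {x : V} :
    x ∈ colSpan v A ↔ ∃ c, x = coordVec v (A.mulVec c) := by
  rw [colSpan_eq_span, Submodule.mem_span_range_iff_exists_fun]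
  simp only [coordVec_mulVec, eq_comm]

theorem exists_eq_mul_of_colSpan_le {A A' : Matrix (Fin d) (Fin d) F}
    (h : colSpan v A ≤ colSpan v A') : ∃ C, A = A' * C := by
  have h' j := (mem_colSpan_iff v).1 ((colSpan_le_iff v).1 h j)
  choose c hc using h'
  refine ⟨Matrix.of fun i j => c j i, ?_⟩
  ext i j
  have := congrArg (fun x => v.repr x i) (hc j)
  simp only [repr_coordVec] at this
  rw [this]
  rfl

theorem colSpan_eq_map (A : Matrix (Fin d) (Fin d) F) :
    colSpan v A = (LinearMap.range A.mulVecLin).map (v.equivFun.symm : (Fin d → F) →ₗ[F] V) := by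
  ext x
  rw [mem_colSpan_iff, Submodule.mem_map]
  constructor
  · rintro ⟨c, rfl⟩
    exact ⟨_, ⟨c, rfl⟩, (coordVec_eq v _).symm⟩
  · rintro ⟨_, ⟨c, rfl⟩, rfl⟩
    exact ⟨c, (coordVec_eq v _).symm⟩

theorem finrank_colSpan (A : Matrix (Fin d) (Fin d) F) :
    Module.finrank F (colSpan v A) = A.rank := by
  rw [colSpan_eq_map, Matrix.rank]
  exact LinearEquiv.finrank_map_eq _ _

theorem exists_colSpan_eq (U : Submodule F V) : ∃ A, colSpan v A = U := by
  obtain ⟨g, hg⟩ := U.subtype.exists_leftInverse_of_injective U.ker_subtype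
  have hg' (x : U) : g x = x := LinearMap.congr_fun hg x
  -- The columns are the images of the basis vectors under a linear projection onto `U`.
  refine ⟨Matrix.of fun i j => v.repr (g (v j) : V) i, le_antisymm ?_ fun x hx => ?_⟩
  · refine (colSpan_le_iff v).2 fun j => ?_
    simp only [Matrix.of_apply, coordVec_repr]
    exact (g (v j)).2
  · refine (mem_colSpan_iff v).2 ⟨v.repr x, ?_⟩
    rw [coordVec_mulVec]
    simp only [Matrix.of_apply, coordVec_repr]
    have h : ((∑ j, v.repr x j • g (v j) : U) : V) = x := by
      simp only [← map_smul, ← map_sum]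
      rw [v.sum_repr, hg' ⟨x, hx⟩]
    conv_lhs => rw [← h]
    simp

end ColSpan

/-! ### Vectors of maximal minors. -/

section Minors

variable {F : Type*} [Field F] {d k : ℕ}

theorem exists_orderEmbedding_comp_perm {f : Fin k → Fin d} (hf : Function.Injective f) :
    ∃ (j : Fin k ↪o Fin d) (σ : Equiv.Perm (Fin k)), f = j ∘ σ := by
  have hs : StrictMono (f ∘ Tuple.sort f) :=
    (Tuple.monotone_sort f).strictMono_of_injective (hf.comp (Tuple.sort f).injective)
  refine ⟨OrderEmbedding.ofStrictMono _ hs, (Tuple.sort f).symm, ?_⟩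
  funext i
  simp

/-- The vector of maximal minors formed from the columns `j`. -/
noncomputable def minorVec (A : Matrix (Fin d) (Fin d) F) (j : Fin k → Fin d) : PluckerVec F d k :=
  fun i => (A.submatrix i j).det

/-- Columns in arbitrary order differ from increasing ones by a sign, and a repeated column gives
`0`. Thus the expansion of a determinant over all maps stays in the span over increasing tuples. -/
theorem minorVec_mem_span (A : Matrix (Fin d) (Fin d) F) (f : Fin k → Fin d) :
    minorVec A f ∈ Submodule.span F (Set.range fun j : Fin k ↪o Fin d => minorVec A j) := by
  by_cases hf : Function.Injective f
  · obtain ⟨j, σ, rfl⟩ := exists_orderEmbedding_comp_perm hf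
    have : minorVec A (j ∘ σ) = ((Equiv.Perm.sign σ : ℤ) : F) • minorVec A j := by
      funext i
      rw [Pi.smul_apply, smul_eq_mul]
      exact Matrix.det_permute' σ (A.submatrix i j)
    rw [this]
    exact Submodule.smul_mem _ _ (Submodule.subset_span ⟨j, rfl⟩)
  · have : minorVec A f = 0 := by
      simp only [Function.Injective, not_forall] at hf
      obtain ⟨a, b, h, hab⟩ := hf
      funext i
      exact Matrix.det_zero_of_column_eq hab fun l => by simp [h]
    rw [this]
    exact Submodule.zero_mem _

/-- Each column of `A * C` is a combination of columns of `A`; the determinant is expanded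
multilinearly in these columns, after a transposition because the library map is multilinear in
rows. -/
theorem minorVec_mul (A C : Matrix (Fin d) (Fin d) F) (j : Fin k → Fin d) :
    minorVec (A * C) j = ∑ f : Fin k → Fin d, (∏ l, C (f l) (j l)) • minorVec A f := by
  funext i
  rw [Finset.sum_apply]
  simp only [Pi.smul_apply, smul_eq_mul, minorVec]
  rw [← Matrix.det_transpose]
  have h : ((A * C).submatrix i j).transpose =
      fun l => ∑ m, C m (j l) • fun l' => A (i l') m := by
    funext l l'
    simp [Matrix.mul_apply, mul_comm]
  rw [h]
  refine (Matrix.detRowAlternating.toMultilinearMap.map_sum _).trans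
    (Finset.sum_congr rfl fun f _ => ?_)
  refine (MultilinearMap.map_smul_univ _ _ _).trans ?_
  rw [smul_eq_mul]
  congr 1
  exact Matrix.det_transpose (A.submatrix i f)

theorem span_minorVec_mul_le (A C : Matrix (Fin d) (Fin d) F) :
    Submodule.span F (Set.range fun j : Fin k ↪o Fin d => minorVec (A * C) j) ≤
      Submodule.span F (Set.range fun j : Fin k ↪o Fin d => minorVec A j) := by
  rw [Submodule.span_le, Set.range_subset_iff]
  intro j
  rw [minorVec_mul]
  exact Submodule.sum_mem _ fun f _ => Submodule.smul_mem _ _ (minorVec_mem_span A f)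

theorem exists_injective_rank_submatrix {m n : Type*} [Finite m] [Fintype n]
    (A : Matrix m n F) (h : A.rank = k) :
    ∃ f : Fin k → n, Function.Injective f ∧ (A.submatrix id f).rank = k := by
  obtain ⟨κ, a, ha, hs, hl⟩ := exists_linearIndependent' F A.col
  have : Finite κ := Finite.of_injective a ha
  cases nonempty_fintype κ
  have hc : Fintype.card κ = k := by
    rw [← h, Matrix.rank_eq_finrank_span_cols, ← hs, finrank_span_eq_card hl]
  let e := (Fintype.equivFinOfCardEq hc).symm
  refine ⟨a ∘ e, ha.comp e.injective, ?_⟩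
  rw [Matrix.rank_eq_finrank_span_cols]
  have : (A.submatrix id (a ∘ e)).col = (A.col ∘ a) ∘ e := rfl
  rw [this, finrank_span_eq_card (hl.comp e e.injective), Fintype.card_fin]

/-- Choosing `k` independent columns and then `k` independent rows of them leaves an invertible `k ×
k` submatrix; sorting the indices does not change its rank. -/
theorem exists_minorVec_ne_zero {A : Matrix (Fin d) (Fin d) F} (h : A.rank = k) :
    ∃ j : Fin k ↪o Fin d, minorVec A j ≠ 0 := by
  obtain ⟨f, hf, h₁⟩ := exists_injective_rank_submatrix A h
  rw [← Matrix.rank_transpose] at h₁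
  obtain ⟨g, hg, h₂⟩ := exists_injective_rank_submatrix _ h₁
  obtain ⟨j, σ, rfl⟩ := exists_orderEmbedding_comp_perm hf
  obtain ⟨i, τ, rfl⟩ := exists_orderEmbedding_comp_perm hg
  refine ⟨j, fun h₀ => ?_⟩
  set N : Matrix (Fin k) (Fin k) F := A.submatrix i j with hN
  have h₃ : N.rank = k := by
    rw [← Matrix.rank_submatrix N τ σ, ← Matrix.rank_transpose]
    exact h₂
  have h₄ : N.det = 0 := congrFun h₀ i
  have h₅ : LinearIndependent F N.col := by
    rw [linearIndependent_iff_card_eq_finrank_span, Fintype.card_fin, Set.finrank,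
      ← Matrix.rank_eq_finrank_span_cols, h₃]
  have := (Matrix.isUnit_iff_isUnit_det _).1 (Matrix.linearIndependent_cols_iff_isUnit.1 h₅)
  rw [h₄] at this
  exact not_isUnit_zero this

end Minors

/-! ### Recovering a subspace from its Plücker coordinates. -/

section PlueckerSpace

variable {F : Type*} [Field F] {V : Type*} [AddCommGroup V] [Module F V] {d k : ℕ}
  (v : Module.Basis (Fin d) F V)

/-- The linear form with coefficients `a` with respect to the basis `v`. -/
noncomputable def coeffForm (v : Module.Basis (Fin d) F V) (a : Fin d → F) : V →ₗ[F] F :=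
  ∑ m, a m • v.coord m

theorem coeffForm_apply (a : Fin d → F) (x : V) : coeffForm v a x = ∑ m, a m * v.repr x m := by
  simp [coeffForm]

/-- The coefficients of the linear relation satisfied by the vectors in a subspace with
Plücker coordinates `r`, for the choice `i` of `k + 1` rows. -/
noncomputable def plCoeff (r : PluckerVec F d k) (i : Fin (k + 1) ↪o Fin d) (m : Fin d) : F :=
  ∑ l : Fin (k + 1), if i l = m then (-1) ^ (l : ℕ) * r ((Fin.succAboveOrderEmb l).trans i) else 0

/-- The subspace with Plücker coordinates `r`. -/
noncomputable def plSpace (v : Module.Basis (Fin d) F V) (r : PluckerVec F d k) : Submodule F V :=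
  ⨅ i, LinearMap.ker (coeffForm v (plCoeff r i))

theorem coeffForm_plCoeff (r : PluckerVec F d k) (i : Fin (k + 1) ↪o Fin d) (x : V) :
    coeffForm v (plCoeff r i) x =
      ∑ l : Fin (k + 1), (-1) ^ (l : ℕ) * r ((Fin.succAboveOrderEmb l).trans i) *
        v.repr x (i l) := by
  simp only [coeffForm_apply, plCoeff, Finset.sum_mul]
  rw [Finset.sum_comm]
  refine Finset.sum_congr rfl fun l _ => ?_
  rw [Finset.sum_eq_single (i l)] <;> simp +contextual [eq_comm]

theorem mem_plSpace {r : PluckerVec F d k} {x : V} :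
    x ∈ plSpace v r ↔ ∀ i : Fin (k + 1) ↪o Fin d,
      ∑ l : Fin (k + 1), (-1) ^ (l : ℕ) * r ((Fin.succAboveOrderEmb l).trans i) *
        v.repr x (i l) = 0 := by
  simp only [plSpace, Submodule.mem_iInf, LinearMap.mem_ker, coeffForm_plCoeff]

theorem exists_insert_orderEmbedding (i₀ : Fin k ↪o Fin d) {m : Fin d}
    (hm : m ∉ Set.range i₀) :
    ∃ (i : Fin (k + 1) ↪o Fin d) (p : Fin (k + 1)), i p = m ∧
      (Fin.succAboveOrderEmb p).trans i = i₀ := by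
  have hm' : m ∉ Finset.univ.map i₀.toEmbedding := by simpa using hm
  have hc : (insert m (Finset.univ.map i₀.toEmbedding)).card = k + 1 := by
    rw [Finset.card_insert_of_notMem hm']
    simp
  set i := (insert m (Finset.univ.map i₀.toEmbedding)).orderEmbOfFin hc with hi
  have hr : Set.range i = insert m (Set.range i₀) := by
    rw [hi, Finset.range_orderEmbOfFin]
    simp
  obtain ⟨p, hp⟩ : m ∈ Set.range i := by rw [hr]; exact Set.mem_insert _ _
  refine ⟨i, p, hp, ?_⟩
  have hc' : (Finset.univ.map i₀.toEmbedding).card = k := by simp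
  rw [Finset.orderEmbOfFin_unique' hc' (f := (Fin.succAboveOrderEmb p).trans i),
    ← Finset.orderEmbOfFin_unique' hc' (f := i₀)]
  · simp
  · intro l
    have h : i (p.succAbove l) ∈ insert m (Set.range i₀) := hr ▸ Set.mem_range_self _
    rcases h with h | h
    · rw [← hp] at h
      exact (Fin.succAbove_ne p l (i.injective h)).elim
    · simpa using h

/-- If `r i₀ ≠ 0`, the relation for the rows of `i₀` together with one more row `m` determines the
coordinate `m` from those in `i₀`. Hence the projection to the `k` coordinates in `i₀` is injective
on the subspace. -/
theorem finrank_plSpace_le {r : PluckerVec F d k} (hr : r ≠ 0) :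
    Module.finrank F (plSpace v r) ≤ k := by
  obtain ⟨i₀, h₀⟩ := Function.ne_iff.1 hr
  have : Module.Finite F V := .of_basis v
  let f : plSpace v r →ₗ[F] Fin k → F :=
    (LinearMap.pi fun l => v.coord (i₀ l)) ∘ₗ (plSpace v r).subtype
  have hf : Function.Injective f := by
    rw [injective_iff_map_eq_zero]
    rintro ⟨x, hx⟩ h
    have h' (l : Fin k) : v.repr x (i₀ l) = 0 := congrFun h l
    rw [mem_plSpace] at hx
    have hx' : v.repr x = 0 := by
      ext m
      by_cases hm : m ∈ Set.range i₀
      · obtain ⟨l, rfl⟩ := hm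
        exact h' l
      · obtain ⟨i, p, rfl, hi⟩ := exists_insert_orderEmbedding i₀ hm
        have := hx i
        rw [Finset.sum_eq_single p, hi] at this
        · simpa [show r i₀ ≠ 0 from h₀] using this
        · intro l _ hl
          obtain ⟨q, rfl⟩ := Fin.exists_succAbove_eq hl
          have : i (p.succAbove q) = i₀ q := by rw [← hi]; rfl
          rw [this, h', mul_zero]
        · simp
    exact Subtype.ext (v.repr.map_eq_zero_iff.1 hx')
  simpa using LinearMap.finrank_le_finrank_of_injective hf

/-- This is the expansion, along the first column, of the determinant with columns `A.mulVec c` and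
the columns `j` of `A`. It vanishes because all columns lie in a space of dimension at most `k`. -/
theorem sum_minorVec_eq_zero {A : Matrix (Fin d) (Fin d) F} (h : A.rank ≤ k) (c : Fin d → F)
    (j : Fin k → Fin d) (i : Fin (k + 1) → Fin d) :
    ∑ l : Fin (k + 1), (-1) ^ (l : ℕ) * (A.submatrix (i ∘ l.succAbove) j).det *
      A.mulVec c (i l) = 0 := by
  -- Multiplication by `C` puts `A.mulVec c` in front of the columns `j` of `A`; the factor with
  -- rows `i` of the identity then selects rows.
  let C : Matrix (Fin d) (Fin (k + 1)) F :=
    Matrix.of fun m => Fin.cons (c m) fun l => (1 : Matrix (Fin d) (Fin d) F) m (j l)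
  let N : Matrix (Fin (k + 1)) (Fin (k + 1)) F :=
    (1 : Matrix (Fin d) (Fin d) F).submatrix i id * (A * C)
  have hN : N.det = 0 := by
    by_contra hN
    have h₁ := Matrix.rank_of_det_ne_zero hN
    have h₂ : N.rank ≤ k :=
      (Matrix.rank_mul_le_right _ _).trans ((Matrix.rank_mul_le_left _ _).trans h)
    simp at h₁
    omega
  have hN' : N = (A * C).submatrix i id := by
    have := Matrix.submatrix_mul (1 : Matrix (Fin d) (Fin d) F) (A * C) i id id
      Function.bijective_id
    rw [Matrix.one_mul] at this
    exact this.symm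
  rw [← hN, Matrix.det_succ_column_zero]
  refine Finset.sum_congr rfl fun l _ => ?_
  have h₁ : N l 0 = A.mulVec c (i l) := by rw [hN']; rfl
  have h₂ : N.submatrix l.succAbove Fin.succ = A.submatrix (i ∘ l.succAbove) j := by
    rw [hN']
    ext a b
    simp only [Matrix.submatrix_apply, Matrix.mul_apply, C, Matrix.of_apply, id_eq, Fin.cons_succ,
      Function.comp_apply]
    rw [← Matrix.mul_apply, Matrix.mul_one]
  rw [h₁, h₂]
  ring

theorem colSpan_le_plSpace {A : Matrix (Fin d) (Fin d) F} (h : A.rank ≤ k)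
    {r : PluckerVec F d k}
    (hr : r ∈ Submodule.span F (Set.range fun j : Fin k ↪o Fin d => minorVec A j)) :
    colSpan v A ≤ plSpace v r := by
  intro x hx
  obtain ⟨c, rfl⟩ := (mem_colSpan_iff v).1 hx
  rw [mem_plSpace]
  intro i
  simp only [repr_coordVec]
  induction hr using Submodule.span_induction with
  | mem r hr =>
    obtain ⟨j, rfl⟩ := hr
    exact sum_minorVec_eq_zero h c j i
  | zero => simp
  | add r s _ _ hr hs =>
    simp only [Pi.add_apply, mul_add, add_mul, Finset.sum_add_distrib, hr, hs, add_zero]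
  | smul a r _ hr =>
    rw [← mul_zero a, ← hr, Finset.mul_sum]
    refine Finset.sum_congr rfl fun l _ => ?_
    rw [Pi.smul_apply, smul_eq_mul]
    ring

end PlueckerSpace

/-! ### Plücker coordinates and column spaces determine each other. -/

section PlueckerSet

variable {F : Type*} [Field F] {V : Type*} [AddCommGroup V] [Module F V] {d k : ℕ}
  (v : Module.Basis (Fin d) F V)

theorem mem_pluckerSet_iff (hk : k ≠ 0) {A : Matrix (Fin d) (Fin d) F} {r : PluckerVec F d k} :
    r ∈ pluckerSet k A ↔
      r ∈ Submodule.span F (Set.range fun j : Fin k ↪o Fin d => minorVec A j) ∧ r ≠ 0 := by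
  rw [pluckerSet, if_neg hk]
  rfl

theorem mem_pluckerSet_zero {A : Matrix (Fin d) (Fin d) F} {r : PluckerVec F d 0} :
    r ∈ pluckerSet 0 A ↔ r = 0 := by
  rw [pluckerSet, if_pos rfl]
  rfl

theorem pluckerSet_nonempty {A : Matrix (Fin d) (Fin d) F} (h : A.rank = k) :
    (pluckerSet k A).Nonempty := by
  rcases eq_or_ne k 0 with rfl | hk
  · exact ⟨0, mem_pluckerSet_zero.2 rfl⟩
  · obtain ⟨j, hj⟩ := exists_minorVec_ne_zero h
    exact ⟨_, (mem_pluckerSet_iff hk).2 ⟨Submodule.subset_span ⟨j, rfl⟩, hj⟩⟩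

theorem smul_mem_pluckerSet {A : Matrix (Fin d) (Fin d) F} {r : PluckerVec F d k}
    (hr : r ∈ pluckerSet k A) {a : F} (ha : a ≠ 0) : a • r ∈ pluckerSet k A := by
  rcases eq_or_ne k 0 with rfl | hk
  · rw [mem_pluckerSet_zero] at hr ⊢
    rw [hr, smul_zero]
  · rw [mem_pluckerSet_iff hk] at hr ⊢
    exact ⟨Submodule.smul_mem _ _ hr.1, smul_ne_zero ha hr.2⟩

theorem pluckerSet_subset {A A' : Matrix (Fin d) (Fin d) F} (h : colSpan v A ≤ colSpan v A') :
    pluckerSet k A ⊆ pluckerSet k A' := by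
  intro r hr
  rcases eq_or_ne k 0 with rfl | hk
  · rwa [mem_pluckerSet_zero] at hr ⊢
  · rw [mem_pluckerSet_iff hk] at hr ⊢
    obtain ⟨C, rfl⟩ := exists_eq_mul_of_colSpan_le v h
    exact ⟨span_minorVec_mul_le _ _ hr.1, hr.2⟩

/-- One inclusion is the bordered determinant identity; the dimension bound on `plSpace` for
non-zero `r` makes it an equality. -/
theorem colSpan_eq_plSpace (hk : k ≠ 0) {A : Matrix (Fin d) (Fin d) F} (h : A.rank = k)
    {r : PluckerVec F d k} (hr : r ∈ pluckerSet k A) : colSpan v A = plSpace v r := by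
  have : Module.Finite F V := .of_basis v
  rw [mem_pluckerSet_iff hk] at hr
  refine Submodule.eq_of_le_of_finrank_le (colSpan_le_plSpace v h.le hr.1) ?_
  rw [finrank_colSpan, h]
  exact finrank_plSpace_le v hr.2

theorem colSpan_eq_bot_of_rank_eq_zero {A : Matrix (Fin d) (Fin d) F} (h : A.rank = 0) :
    colSpan v A = ⊥ := by
  have : Module.Finite F V := .of_basis v
  rw [← Submodule.finrank_eq_zero (R := F), finrank_colSpan, h]

/-- The case `k = 0` is separate: there the coordinate vector is `0` by convention, and its
relations are void, so `plSpace` would be the whole space instead of `⊥`. -/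
theorem colSpan_eq_of_mem_pluckerSet {A A' : Matrix (Fin d) (Fin d) F} (h : A.rank = k)
    (h' : A'.rank = k) {r : PluckerVec F d k} (hr : r ∈ pluckerSet k A)
    (hr' : r ∈ pluckerSet k A') : colSpan v A = colSpan v A' := by
  rcases eq_or_ne k 0 with rfl | hk
  · rw [colSpan_eq_bot_of_rank_eq_zero v h, colSpan_eq_bot_of_rank_eq_zero v h']
  · rw [colSpan_eq_plSpace v hk h hr, colSpan_eq_plSpace v hk h' hr']

theorem exists_rank_mem_pluckerSet {n : ℕ} {dv : Fin n → ℕ}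
    {r : (k : Fin n) → PluckerVec F d (dv k)}
    (hr : r ∈ grassmannianProd F d dv) : ∃ A : Fin n → Matrix (Fin d) (Fin d) F,
      (∀ k, (A k).rank = dv k) ∧ ∀ k, r k ∈ pluckerSet (dv k) (A k) := by
  choose A h₁ h₂ using hr
  exact ⟨A, h₁, h₂⟩

end PlueckerSet

/-! ### Change of basis, scaled orthogonal matrices and scaled isometries. -/

section BaseChange

variable {F : Type*} [Field F] {V : Type*} [AddCommGroup V] [Module F V] {d : ℕ}
  {v w : Module.Basis (Fin d) F V}

theorem basis_equiv_coordVec (a : Fin d → F) :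
    v.equiv w (Equiv.refl _) (coordVec v a) = coordVec w a := by
  simp [coordVec]

theorem map_equiv_colSpan (A : Matrix (Fin d) (Fin d) F) :
    (colSpan v A).map (v.equiv w (Equiv.refl _) : V →ₗ[F] V) = colSpan w A := by
  rw [colSpan_eq_span, colSpan_eq_span, Submodule.map_span, ← Set.range_comp]
  congr 2
  funext j
  exact basis_equiv_coordVec _

theorem coordVec_toMatrix (a : Fin d → F) :
    coordVec v ((v.toMatrix w).mulVec a) = coordVec w a := by
  rw [coordVec_mulVec]
  simp only [Module.Basis.toMatrix_apply, coordVec_repr]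
  rfl

theorem colSpan_toMatrix_mul (A : Matrix (Fin d) (Fin d) F) :
    colSpan v (v.toMatrix w * A) = colSpan w A := by
  rw [colSpan_eq_span, colSpan_eq_span]
  congr 2
  funext j
  rw [← coordVec_toMatrix (v := v) (w := w)]
  rfl

theorem colSpan_map (g : V ≃ₗ[F] V) (A : Matrix (Fin d) (Fin d) F) :
    colSpan (v.map g) A = (colSpan v A).map (g : V →ₗ[F] V) := by
  rw [colSpan_eq_span, colSpan_eq_span, Submodule.map_span, ← Set.range_comp]
  congr 2
  funext j
  simp [coordVec]

end BaseChange

section ScaledOrthogonal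

variable {F : Type*} [Field F] [StarRing F] {d : ℕ} {α : Fin d → F}

/-- The form `T^* D T = r D` is free of inverses and says directly that `T` preserves the diagonal
form up to the factor `r`. -/
theorem isScaledOrthogonal_iff (hα : ∀ i, α i ≠ 0) {T : Matrix (Fin d) (Fin d) F}
    (hT : IsUnit T) : IsScaledOrthogonal α T ↔ ∃ r : F, r ≠ 0 ∧ star r = r ∧
      T.conjTranspose * Matrix.diagonal α * T = r • Matrix.diagonal α := by
  have hD : IsUnit (Matrix.diagonal α).det := by
    rw [Matrix.det_diagonal]
    exact (Finset.prod_ne_zero_iff.2 fun i _ => hα i).isUnit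
  have hT' := (Matrix.isUnit_iff_isUnit_det T).1 hT
  rw [IsScaledOrthogonal, and_iff_right hT]
  refine exists_congr fun r => and_congr_right fun _ => and_congr_right fun _ => ?_
  constructor
  · intro h
    calc T.conjTranspose * Matrix.diagonal α * T
        = Matrix.diagonal α * ((Matrix.diagonal α)⁻¹ * T.conjTranspose * Matrix.diagonal α) * T := by
          rw [Matrix.mul_assoc _ T.conjTranspose, Matrix.mul_nonsing_inv_cancel_left _ _ hD]
      _ = r • Matrix.diagonal α := by
          rw [h, Matrix.mul_smul, Matrix.smul_mul, Matrix.nonsing_inv_mul_cancel_right _ _ hT']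
  · intro h
    calc (Matrix.diagonal α)⁻¹ * T.conjTranspose * Matrix.diagonal α
        = (Matrix.diagonal α)⁻¹ * (T.conjTranspose * Matrix.diagonal α * T) * T⁻¹ := by
          rw [← Matrix.mul_assoc, ← Matrix.mul_assoc, Matrix.mul_nonsing_inv_cancel_right _ _ hT']
      _ = r • T⁻¹ := by
          rw [h, Matrix.mul_smul, Matrix.smul_mul, Matrix.nonsing_inv_mul _ hD, Matrix.one_mul]

theorem conjTranspose_mul_diagonal_mul_apply (T : Matrix (Fin d) (Fin d) F) (i j : Fin d) :
    (T.conjTranspose * Matrix.diagonal α * T) i j = ∑ m, star (T m i) * α m * T m j := by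
  rw [Matrix.mul_apply]
  simp [Matrix.mul_diagonal]

end ScaledOrthogonal

/-! ### Hermitean forms with an orthogonal basis. -/

section Forms

variable {F : Type*} [Field F] [StarRing F] {V : Type*} [AddCommGroup V] [Module F V] {d : ℕ}
  {B : V →ₗ⋆[F] V →ₗ[F] F} {v w : Module.Basis (Fin d) F V}

/-- The basis `v` is orthogonal. -/
def IsOrthoBasis (B : V →ₗ⋆[F] V →ₗ[F] F) (v : Module.Basis (Fin d) F V) : Prop :=
  ∀ i j, i ≠ j → B (v i) (v j) = 0

theorem IsOrthoBasis.apply_coordVec (hv : IsOrthoBasis B v) (a b : Fin d → F) :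
    B (coordVec v a) (coordVec v b) = ∑ i, star (a i) * B (v i) (v i) * b i := by
  simp only [coordVec, map_sum, LinearMap.sum_apply, map_smul, LinearMap.map_smulₛₗ,
    LinearMap.smul_apply, smul_eq_mul, starRingEnd_apply]
  refine Finset.sum_congr rfl fun i _ => ?_
  rw [Finset.sum_eq_single i (fun j _ hj => by simp [hv j i hj]) (by simp)]
  ring

theorem IsOrthoBasis.apply_eq (hv : IsOrthoBasis B v) (x y : V) :
    B x y = ∑ i, star (v.repr x i) * B (v i) (v i) * v.repr y i := by
  rw [← hv.apply_coordVec, coordVec_repr, coordVec_repr]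

theorem IsOrthoBasis.ne_zero (hv : IsOrthoBasis B v) (hB : IsInnerForm B) (i : Fin d) :
    B (v i) (v i) ≠ 0 := by
  intro h
  refine v.ne_zero i (hB.nondeg _ fun x => ?_)
  rw [hv.apply_eq]
  refine Finset.sum_eq_zero fun j _ => ?_
  rcases eq_or_ne j i with rfl | hj
  · simp [h]
  · simp [Finsupp.single_eq_of_ne hj]

theorem IsOrthoBasis.exists_eq_coeffForm (hv : IsOrthoBasis B v) (hB : IsInnerForm B)
    (f : V →ₗ[F] F) : ∃ x, B x = f := by
  refine ⟨coordVec v fun i => star (f (v i) * (B (v i) (v i))⁻¹), v.ext fun j => ?_⟩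
  rw [hv.apply_eq, Finset.sum_eq_single j]
  · have := hv.ne_zero hB j
    simp only [repr_coordVec, star_star, Module.Basis.repr_self, Finsupp.single_eq_same]
    field_simp
  · intro i _ hi
    simp [Finsupp.single_eq_of_ne hi]
  · simp

/-- A vector outside `U` is separated from `U` by a linear form, and every linear form is `B y` for
some `y`, which then lies in the orthogonal of `U`. -/
theorem IsOrthoBasis.orthogonal_orthogonal (hv : IsOrthoBasis B v) (hB : IsInnerForm B)
    (U : Submodule F V) : (U.orthogonalBilin B).orthogonalBilin B = U := by
  refine le_antisymm (fun x hx => ?_) fun x hx y hy => ?_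
  · by_contra h
    obtain ⟨f, hf, hU⟩ := Submodule.exists_le_ker_of_notMem h
    obtain ⟨y, rfl⟩ := hv.exists_eq_coeffForm hB f
    refine hf (hx y fun z hz => ?_)
    rw [hB.herm y z, show B y z = 0 from hU hz, star_zero]
  · rw [hB.herm x y, hy x hx, star_zero]

theorem orthogonal_sup (U W : Submodule F V) :
    (U ⊔ W).orthogonalBilin B = U.orthogonalBilin B ⊓ W.orthogonalBilin B := by
  refine le_antisymm (le_inf (Submodule.orthogonalBilin_le le_sup_left)
    (Submodule.orthogonalBilin_le le_sup_right)) fun x hx y hy => ?_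
  obtain ⟨a, ha, b, hb, rfl⟩ := Submodule.mem_sup.1 hy
  rw [map_add, LinearMap.add_apply, hx.1 a ha, hx.2 b hb, add_zero]

/-- Meet is not a symbol of the lattice language; this expresses it by join and involution. -/
theorem IsOrthoBasis.inf_eq (hv : IsOrthoBasis B v) (hB : IsInnerForm B) (U W : Submodule F V) :
    U ⊓ W = (U.orthogonalBilin B ⊔ W.orthogonalBilin B).orthogonalBilin B := by
  rw [orthogonal_sup, hv.orthogonal_orthogonal hB, hv.orthogonal_orthogonal hB]

theorem orthogonalBilin_map {g : V ≃ₗ[F] V} {r : F} (hr : r ≠ 0)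
    (hg : ∀ x y, B (g x) (g y) = r * B x y) (U : Submodule F V) :
    (U.map (g : V →ₗ[F] V)).orthogonalBilin B = (U.orthogonalBilin B).map (g : V →ₗ[F] V) := by
  ext x
  obtain ⟨x, rfl⟩ := g.surjective x
  constructor
  · intro h
    refine ⟨x, fun y hy => ?_, rfl⟩
    have := h (g y) ⟨y, hy, rfl⟩
    rw [hg] at this
    exact (mul_eq_zero.1 this).resolve_left hr
  · rintro ⟨y, hy, e⟩ _ ⟨z, hz, rfl⟩
    rw [← e]
    change B (g z) (g y) = 0
    rw [hg, hy z hz, mul_zero]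

variable [NeZero d] {α : Fin d → F}

theorem IsAdaptedBasis.apply_self (hB : IsInnerForm B) (hv : IsAdaptedBasis B α v) (i : Fin d) :
    B (v i) (v i) = B (v 0) (v 0) * α i := by
  rw [hv.2, mul_inv_cancel_left₀ (IsOrthoBasis.ne_zero hv.1 hB 0)]

theorem IsAdaptedBasis.apply_coordVec_eq_dotProduct (hB : IsInnerForm B)
    (hv : IsAdaptedBasis B α v) (a b : Fin d → F) : B (coordVec v a) (coordVec v b) =
      B (v 0) (v 0) * (star a ⬝ᵥ (Matrix.diagonal α).mulVec b) := by
  rw [IsOrthoBasis.apply_coordVec hv.1, dotProduct, Finset.mul_sum]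
  refine Finset.sum_congr rfl fun i _ => ?_
  rw [hv.apply_self hB, Matrix.mulVec_diagonal, Pi.star_apply]
  ring

/-- Both bases have diagonal Gram matrices proportional to `α`; the factor is the quotient of the
norms of the first vectors. -/
theorem IsAdaptedBasis.isScaledIsometry (hB : IsInnerForm B) (hv : IsAdaptedBasis B α v)
    (hw : IsAdaptedBasis B α w) (x y : V) :
    B (v.equiv w (Equiv.refl _) x) (v.equiv w (Equiv.refl _) y) =
      B (w 0) (w 0) * (B (v 0) (v 0))⁻¹ * B x y := by
  rw [← coordVec_repr v x, ← coordVec_repr v y, basis_equiv_coordVec, basis_equiv_coordVec,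
    IsOrthoBasis.apply_coordVec hv.1, IsOrthoBasis.apply_coordVec hw.1, Finset.mul_sum]
  refine Finset.sum_congr rfl fun i _ => ?_
  rw [hv.apply_self hB i, hw.apply_self hB i]
  have := IsOrthoBasis.ne_zero hv.1 hB 0
  field_simp

theorem IsAdaptedBasis.ratio (hB : IsInnerForm B) (hv : IsAdaptedBasis B α v)
    (hw : IsAdaptedBasis B α w) :
    B (w 0) (w 0) * (B (v 0) (v 0))⁻¹ ≠ 0 ∧
      star (B (w 0) (w 0) * (B (v 0) (v 0))⁻¹) = B (w 0) (w 0) * (B (v 0) (v 0))⁻¹ := by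
  refine ⟨mul_ne_zero (IsOrthoBasis.ne_zero hw.1 hB 0)
    (inv_ne_zero (IsOrthoBasis.ne_zero hv.1 hB 0)), ?_⟩
  rw [star_mul', star_inv₀, ← hB.herm, ← hB.herm]

/-- Independence of the chosen basis: the scaled isometry from `v` to `w` carries column spans over
`v` to those over `w`. -/
theorem colSpan_mem_of_isInvariantSet (hB : IsInnerForm B) {n : ℕ}
    {M : Set (Fin n → Submodule F V)} (hM : IsInvariantSet B M) (hv : IsAdaptedBasis B α v)
    (hw : IsAdaptedBasis B α w) {A : Fin n → Matrix (Fin d) (Fin d) F}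
    (h : (fun k => colSpan v (A k)) ∈ M) : (fun k => colSpan w (A k)) ∈ M := by
  have := hM (v.equiv w (Equiv.refl _)) _ (hv.ratio hB hw).1 (hv.ratio hB hw).2
    (hv.isScaledIsometry hB hw) _ h
  simpa only [map_equiv_colSpan] using this

theorem IsAdaptedBasis.isScaledOrthogonal_toMatrix (hB : IsInnerForm B) (hα : ∀ i, α i ≠ 0)
    (hv : IsAdaptedBasis B α v) (hw : IsAdaptedBasis B α w) :
    IsScaledOrthogonal α (v.toMatrix w) := by
  have hT : IsUnit (v.toMatrix w) :=
    (Matrix.isUnit_iff_isUnit_det _).2 (Matrix.isUnit_det_of_left_inverse (w.toMatrix_mul_toMatrix_flip v))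
  refine (isScaledOrthogonal_iff hα hT).2 ⟨_, (hv.ratio hB hw).1, (hv.ratio hB hw).2, ?_⟩
  ext i j
  have h₀ := IsOrthoBasis.ne_zero hv.1 hB 0
  have h : B (w i) (w j) =
      B (v 0) (v 0) * ∑ m, star (v.toMatrix w m i) * α m * v.toMatrix w m j := by
    rw [IsOrthoBasis.apply_eq hv.1, Finset.mul_sum]
    refine Finset.sum_congr rfl fun m _ => ?_
    rw [hv.apply_self hB m]
    simp only [Module.Basis.toMatrix_apply]
    ring
  rw [conjTranspose_mul_diagonal_mul_apply]
  rcases eq_or_ne i j with rfl | hij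
  · rw [hw.apply_self hB] at h
    simp only [Matrix.smul_apply, Matrix.diagonal_apply_eq, smul_eq_mul]
    field_simp
    rw [h, mul_comm]
  · rw [hw.1 i j hij] at h
    simp only [Matrix.smul_apply, Matrix.diagonal_apply_ne _ hij, smul_zero]
    exact (mul_eq_zero.1 h.symm).resolve_left h₀

/-- Over an adapted basis, the map with matrix `T` multiplies the form by the scalar `r` of `T`.
This turns left multiplication of matrices into the action on subspaces. -/
theorem IsAdaptedBasis.exists_scaledIsometry (hB : IsInnerForm B) (hα : ∀ i, α i ≠ 0)
    (hv : IsAdaptedBasis B α v) {T : Matrix (Fin d) (Fin d) F} (hT : IsScaledOrthogonal α T) :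
    ∃ (g : V ≃ₗ[F] V) (r : F), r ≠ 0 ∧ star r = r ∧ (∀ x y, B (g x) (g y) = r * B x y) ∧
      ∀ A, (colSpan v A).map (g : V →ₗ[F] V) = colSpan v (T * A) := by
  have hT' := (Matrix.isUnit_iff_isUnit_det T).1 hT.1
  obtain ⟨r, hr, hs, h⟩ := (isScaledOrthogonal_iff hα hT.1).1 hT
  have hg (a : Fin d → F) : Matrix.toLinearEquiv v T hT' (coordVec v a) =
      coordVec v (T.mulVec a) := by
    rw [coordVec_mulVec]
    simp only [coordVec, map_sum, map_smul]
    refine Finset.sum_congr rfl fun i _ => ?_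
    congr 1
    exact Matrix.toLin_self v v T i
  refine ⟨Matrix.toLinearEquiv v T hT', r, hr, hs, fun x y => ?_, fun A => ?_⟩
  · rw [← coordVec_repr v x, ← coordVec_repr v y, hg, hg]
    generalize (v.repr x : Fin d → F) = a
    generalize (v.repr y : Fin d → F) = b
    rw [hv.apply_coordVec_eq_dotProduct hB, hv.apply_coordVec_eq_dotProduct hB,
      Matrix.star_mulVec, ← Matrix.dotProduct_mulVec, Matrix.mulVec_mulVec, Matrix.mulVec_mulVec,
      h, Matrix.smul_mulVec, dotProduct_smul, smul_eq_mul, mul_left_comm]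
  · rw [colSpan_eq_span, colSpan_eq_span, Submodule.map_span, ← Set.range_comp]
    congr 2
    funext j
    exact hg _

end Forms

/-! ### The bijection between invariant and bi-invariant sets. -/

section Correspondence

variable {F : Type*} [Field F] [StarRing F] {V : Type*} [AddCommGroup V] [Module F V] {d n : ℕ}
  [NeZero d] {B : V →ₗ⋆[F] V →ₗ[F] F} {v : Module.Basis (Fin d) F V} {α : Fin d → F}
  {dv : Fin n → ℕ}

theorem mem_thetaGL_iff {Δ : Set ((k : Fin n) → PluckerVec F d (dv k))}
    {u : Fin n → Submodule F V} :
    u ∈ thetaGL B α dv Δ ↔ ∃ (v : Module.Basis (Fin d) F V)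
      (A : Fin n → Matrix (Fin d) (Fin d) F) (r : (k : Fin n) → PluckerVec F d (dv k)),
      IsAdaptedBasis B α v ∧ (∀ k, (A k).rank = dv k) ∧ r ∈ Δ ∧
        (∀ k, r k ∈ pluckerSet (dv k) (A k)) ∧ u = fun k => colSpan v (A k) := by
  constructor
  · rintro ⟨v, hv, A, ⟨hA, r, hr, h⟩, rfl⟩
    exact ⟨v, A, r, hv, hA, hr, h, rfl⟩
  · rintro ⟨v, A, r, hv, hA, hr, h, rfl⟩
    exact ⟨v, hv, A, ⟨hA, r, hr, h⟩, rfl⟩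

/-- Invariance allows any witnessing basis to be replaced by `v`, and equal Plücker coordinates
allow any witnessing matrices to be replaced by `A`. -/
theorem mem_thetaLG_iff_of_mem_pluckerSet (hB : IsInnerForm B)
    {M : Set (Fin n → Submodule F V)} (hM : IsInvariantSet B M) (hv : IsAdaptedBasis B α v)
    {A : Fin n → Matrix (Fin d) (Fin d) F} (hA : ∀ k, (A k).rank = dv k)
    {r : (k : Fin n) → PluckerVec F d (dv k)} (hr : ∀ k, r k ∈ pluckerSet (dv k) (A k)) :
    r ∈ thetaLG B α dv M ↔ (fun k => colSpan v (A k)) ∈ M := by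
  constructor
  · rintro ⟨A', ⟨w, hw, hM'⟩, hA', hr'⟩
    have := colSpan_mem_of_isInvariantSet hB hM hw hv hM'
    have e k : colSpan v (A k) = colSpan v (A' k) :=
      colSpan_eq_of_mem_pluckerSet v (hA k) (hA' k) (hr k) (hr' k)
    simpa only [e] using this
  · exact fun h => ⟨A, ⟨v, hv, h⟩, hA, hr⟩

theorem thetaLG_subset {M : Set (Fin n → Submodule F V)} :
    thetaLG B α dv M ⊆ grassmannianProd F d dv := by
  rintro r ⟨A, _, hA, hr⟩ k
  exact ⟨A k, hA k, hr k⟩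

theorem isBiInvariant_thetaLG (hB : IsInnerForm B) (hα : Admissible B α)
    {M : Set (Fin n → Submodule F V)} (hM : IsInvariantSet B M) :
    IsBiInvariant α dv (thetaLG B α dv M) := by
  obtain ⟨_, hα', v, hv⟩ := hα
  refine ⟨thetaLG_subset, ?_, ?_⟩
  · rintro r ⟨A, h, hA, hr⟩ c hc
    exact ⟨A, h, hA, fun k => smul_mem_pluckerSet (hr k) (hc k)⟩
  · intro T hT A hA r s hr hs h
    obtain ⟨g, c, hc, hc', hg, hgA⟩ := hv.exists_scaledIsometry hB (fun i => (hα' i).2) hT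
    have hTA k : (T * A k).rank = dv k := by
      rw [Matrix.rank_mul_eq_right_of_isUnit_det _ _ ((Matrix.isUnit_iff_isUnit_det T).1 hT.1),
        hA k]
    rw [mem_thetaLG_iff_of_mem_pluckerSet hB hM hv hTA hs]
    rw [mem_thetaLG_iff_of_mem_pluckerSet hB hM hv hA hr] at h
    simpa only [hgA] using hM g c hc hc' hg _ h

theorem IsAdaptedBasis.map (hv : IsAdaptedBasis B α v) {g : V ≃ₗ[F] V} {r : F} (hr : r ≠ 0)
    (hg : ∀ x y, B (g x) (g y) = r * B x y) : IsAdaptedBasis B α (v.map g) := by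
  constructor
  · intro i j hij
    simp only [Module.Basis.map_apply, hg, hv.1 i j hij, mul_zero]
  · intro i
    simp only [Module.Basis.map_apply, hg]
    rw [mul_inv, mul_mul_mul_comm, inv_mul_cancel₀ hr, one_mul, hv.2]

theorem isInvariantSet_thetaGL (Δ : Set ((k : Fin n) → PluckerVec F d (dv k))) :
    IsInvariantSet B (thetaGL B α dv Δ) := by
  intro g r hr _ hg u hu
  obtain ⟨v, A, s, hv, hA, hs, h, rfl⟩ := mem_thetaGL_iff.1 hu
  exact mem_thetaGL_iff.2 ⟨v.map g, A, s, hv.map hr hg, hA, hs, h, by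
    simp only [colSpan_map]⟩

theorem thetaGL_subset (Δ : Set ((k : Fin n) → PluckerVec F d (dv k))) :
    thetaGL B α dv Δ ⊆ dimTuples F V dv := by
  intro u hu k
  obtain ⟨v, A, s, hv, hA, hs, h, rfl⟩ := mem_thetaGL_iff.1 hu
  rw [finrank_colSpan, hA]

theorem thetaGL_thetaLG (hB : IsInnerForm B) (hα : Admissible B α)
    {M : Set (Fin n → Submodule F V)} (hM : IsInvariantSet B M) (hM' : M ⊆ dimTuples F V dv) :
    thetaGL B α dv (thetaLG B α dv M) = M := by
  ext u
  constructor
  · intro hu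
    obtain ⟨v, A, r, hv, hA, hr, h, rfl⟩ := mem_thetaGL_iff.1 hu
    rwa [mem_thetaLG_iff_of_mem_pluckerSet hB hM hv hA h] at hr
  · intro hu
    obtain ⟨_, _, v, hv⟩ := hα
    choose A hA using fun k => exists_colSpan_eq v (u k)
    have hA' k : (A k).rank = dv k := by rw [← finrank_colSpan v, hA, hM' hu k]
    choose r hr using fun k => pluckerSet_nonempty (hA' k)
    refine mem_thetaGL_iff.2 ⟨v, A, r, hv, hA', ?_, hr, by simp only [hA]⟩
    rw [mem_thetaLG_iff_of_mem_pluckerSet hB hM hv hA' hr]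
    simpa only [hA] using hu

/-- If column spans over `v` and over `v'` agree, the coordinates over `v` arise from those over
`v'` by the base change matrix. It is scaled orthogonal, so bi-invariance applies. -/
theorem thetaLG_thetaGL (hB : IsInnerForm B) (hα : Admissible B α)
    {Δ : Set ((k : Fin n) → PluckerVec F d (dv k))} (hΔ : IsBiInvariant α dv Δ) :
    thetaLG B α dv (thetaGL B α dv Δ) = Δ := by
  obtain ⟨_, hα', w, hw⟩ := hα
  ext r
  constructor
  · rintro ⟨A, ⟨v, hv, h⟩, hA, hr⟩
    obtain ⟨v', A', r', hv', hA', hr', h', e⟩ := mem_thetaGL_iff.1 h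
    refine hΔ.2.2 (v.toMatrix v') (hv.isScaledOrthogonal_toMatrix hB (fun i => (hα' i).2) hv')
      A' hA' r' r h' (fun k => ?_) hr'
    refine pluckerSet_subset v (le_of_eq ?_) (hr k)
    rw [colSpan_toMatrix_mul]
    exact congrFun e k
  · intro hr
    obtain ⟨A, hA, h⟩ := exists_rank_mem_pluckerSet (hΔ.1 hr)
    exact ⟨A, ⟨w, hw, mem_thetaGL_iff.2 ⟨w, A, r, hw, hA, hr, h, rfl⟩⟩, hA, h⟩

theorem thetaLG_bijOn_invOn (hB : IsInnerForm B) (hα : Admissible B α) :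
    Set.BijOn (thetaLG B α dv)
      {M : Set (Fin n → Submodule F V) | M ⊆ dimTuples F V dv ∧ IsInvariantSet B M}
      {Δ | IsBiInvariant α dv Δ} ∧
    Set.InvOn (thetaGL B α dv) (thetaLG B α dv)
      {M : Set (Fin n → Submodule F V) | M ⊆ dimTuples F V dv ∧ IsInvariantSet B M}
      {Δ | IsBiInvariant α dv Δ} := by
  have h : Set.InvOn (thetaGL B α dv) (thetaLG B α dv)
      {M : Set (Fin n → Submodule F V) | M ⊆ dimTuples F V dv ∧ IsInvariantSet B M}
      {Δ | IsBiInvariant α dv Δ} :=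
    ⟨fun M hM => thetaGL_thetaLG hB hα hM.2 hM.1, fun Δ hΔ => thetaLG_thetaGL hB hα hΔ⟩
  exact ⟨h.bijOn (fun M hM => isBiInvariant_thetaLG hB hα hM.2)
    fun Δ _ => ⟨thetaGL_subset Δ, isInvariantSet_thetaGL Δ⟩, h⟩

/-- A scaled isometry induces an automorphism of the lattice of subspaces. -/
theorem latticeSat_map {g : V ≃ₗ[F] V} {r : F} (hr : r ≠ 0)
    (hg : ∀ x y, B (g x) (g y) = r * B x y) {ι : Type*} (φ : latticeLang.Formula ι)
    (u : ι → Submodule F V) :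
    LatticeSat B φ (fun i => (u i).map (g : V →ₗ[F] V)) ↔ LatticeSat B φ u := by
  let _ := latticeStructure B
  let e : FirstOrder.Language.Equiv latticeLang (Submodule F V) (Submodule F V) :=
    { (Submodule.orderIsoMapComap g).toEquiv with
      map_fun' := fun {k} f x => by
        cases f with
        | join => exact Submodule.map_sup _ _ _
        | zero => exact Submodule.map_bot _
        | perp => exact (orthogonalBilin_map hr hg (x 0)).symm
      map_rel' := fun R => R.elim }
  exact FirstOrder.Language.StrongHomClass.realize_formula e φ

theorem isInvariantSet_definedInLattice (φ : latticeLang.Formula (Fin n)) :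
    IsInvariantSet B (definedInLattice B dv φ) := by
  intro g r hr _ hg u hu
  refine ⟨fun k => ?_, (latticeSat_map hr hg φ u).2 hu.2⟩
  rw [← hu.1 k]
  exact LinearEquiv.finrank_map_eq g (u k)

end Correspondence

/-! ### Terms over fields with involution. -/

section FieldModels

/-- A `*`-field with `m` distinguished elements. -/
structure StarFieldModel (m : ℕ) where
  F : Type u
  [field : Field F]
  [starRing : StarRing F]
  c : Fin m → F

attribute [instance] StarFieldModel.field StarFieldModel.starRing

instance {m : ℕ} (A : StarFieldModel.{u} m) : (starRingLang m).Structure A.F :=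
  starRingStructure A.F A.c

/-- The value of a closed term. -/
def closedVal {m : ℕ} {F : Type*} [Field F] [StarRing F] (c : Fin m → F)
    (t : (starRingLang m).Term Empty) : F :=
  let _ := starRingStructure F c
  t.realize Empty.elim

variable {m : ℕ} {S : Type*} {A : S → StarFieldModel.{u} m} {κ ι : Type}
  {p : ∀ s, κ → (A s).F} {f g : ∀ s, (ι → (A s).F) → (A s).F}

theorem TermDef.add (hf : TermDef (starRingLang m) p f) (hg : TermDef (starRingLang m) p g) :
    TermDef (starRingLang m) p fun s x => f s x + g s x :=
  TermDef.func (L := starRingLang m) StarRingFunc.add (g := ![f, g])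
    fun b => by fin_cases b <;> assumption

theorem TermDef.mul (hf : TermDef (starRingLang m) p f) (hg : TermDef (starRingLang m) p g) :
    TermDef (starRingLang m) p fun s x => f s x * g s x :=
  TermDef.func (L := starRingLang m) StarRingFunc.mul (g := ![f, g])
    fun b => by fin_cases b <;> assumption

theorem TermDef.neg (hf : TermDef (starRingLang m) p f) :
    TermDef (starRingLang m) p fun s x => - f s x :=
  TermDef.func (L := starRingLang m) StarRingFunc.neg (g := fun _ => f) fun _ => hf

theorem TermDef.star (hf : TermDef (starRingLang m) p f) :
    TermDef (starRingLang m) p fun s x => star (f s x) :=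
  TermDef.func (L := starRingLang m) StarRingFunc.star (g := fun _ => f) fun _ => hf

theorem TermDef.zero : TermDef (starRingLang m) p fun s (_ : ι → (A s).F) => 0 :=
  TermDef.func (L := starRingLang m) StarRingFunc.zero (g := Fin.elim0) fun b => b.elim0

theorem TermDef.one : TermDef (starRingLang m) p fun s (_ : ι → (A s).F) => 1 :=
  TermDef.func (L := starRingLang m) StarRingFunc.one (g := Fin.elim0) fun b => b.elim0

theorem TermDef.const (i : Fin m) :
    TermDef (starRingLang m) p fun s (_ : ι → (A s).F) => (A s).c i :=
  TermDef.func (L := starRingLang m) (StarRingFunc.const i) (g := Fin.elim0) fun b => b.elim0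

theorem TermDef.sub (hf : TermDef (starRingLang m) p f) (hg : TermDef (starRingLang m) p g) :
    TermDef (starRingLang m) p fun s x => f s x - g s x := by
  simpa only [sub_eq_add_neg] using hf.add hg.neg

theorem TermDef.pow (hf : TermDef (starRingLang m) p f) (k : ℕ) :
    TermDef (starRingLang m) p fun s x => f s x ^ k := by
  induction k with
  | zero => simpa only [pow_zero] using TermDef.one
  | succ k ih => simpa only [pow_succ] using ih.mul hf

theorem TermDef.sum {I : Type*} (t : Finset I) {h : I → ∀ s, (ι → (A s).F) → (A s).F}
    (hh : ∀ i, TermDef (starRingLang m) p (h i)) :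
    TermDef (starRingLang m) p fun s x => ∑ i ∈ t, h i s x := by
  classical
  induction t using Finset.induction_on with
  | empty => simpa only [Finset.sum_empty] using TermDef.zero
  | insert i t hi ih => simpa only [Finset.sum_insert hi] using (hh i).add ih

theorem TermDef.prod {I : Type*} (t : Finset I) {h : I → ∀ s, (ι → (A s).F) → (A s).F}
    (hh : ∀ i, TermDef (starRingLang m) p (h i)) :
    TermDef (starRingLang m) p fun s x => ∏ i ∈ t, h i s x := by
  classical
  induction t using Finset.induction_on with
  | empty => simpa only [Finset.prod_empty] using TermDef.one
  | insert i t hi ih => simpa only [Finset.prod_insert hi] using (hh i).mul ih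

theorem TermDef.closed (t : (starRingLang m).Term Empty) :
    TermDef (starRingLang m) p fun s (_ : ι → (A s).F) => closedVal (A s).c t :=
  ⟨t.relabel Empty.elim, fun s x => by
    rw [FirstOrder.Language.Term.realize_relabel]
    exact congrArg (fun e => t.realize e) (Subsingleton.elim _ _)⟩

theorem TermDef.det {k : ℕ} {N : Fin k → Fin k → ∀ s, (ι → (A s).F) → (A s).F}
    (hN : ∀ i j, TermDef (starRingLang m) p (N i j)) :
    TermDef (starRingLang m) p fun s x => (Matrix.of fun i j => N i j s x).det := by
  simp only [Matrix.det_apply', Matrix.of_apply]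
  refine TermDef.sum _ fun σ => TermDef.mul ?_ (TermDef.prod _ fun i => hN _ _)
  rcases Int.units_eq_one_or (Equiv.Perm.sign σ) with h | h
  · simpa only [h, Units.val_one, Int.cast_one] using TermDef.one
  · simpa only [h, Units.val_neg, Units.val_one, Int.cast_neg, Int.cast_one] using TermDef.one.neg

end FieldModels

/-! ### Computing subspaces by terms and case distinctions. -/

section SpanDef

/-- An inner product space with an orthogonal basis `v`, such that the ratios of the `⟨v i, v i⟩`
are those of the closed terms `t i`, and coordinate vectors `r`. -/
structure SpaceModel {d n : ℕ} (dv : Fin n → ℕ) {m : ℕ}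
    (t : Fin d → (starRingLang m).Term Empty) extends StarFieldModel.{u} m where
  V : Type v
  [addCommGroup : AddCommGroup V]
  [module : Module F V]
  B : V →ₗ⋆[F] V →ₗ[F] F
  v : Module.Basis (Fin d) F V
  r : (k : Fin n) → PluckerVec F d (dv k)
  isInnerForm : IsInnerForm B
  isOrthoBasis : IsOrthoBasis B v
  exists_scale : ∃ b : F, b ≠ 0 ∧ ∀ i, B (v i) (v i) = b * closedVal c (t i)

attribute [instance] SpaceModel.addCommGroup SpaceModel.module

variable {d n : ℕ} {dv : Fin n → ℕ} {m : ℕ} {t : Fin d → (starRingLang m).Term Empty}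

namespace SpaceModel

/-- The coordinates as parameters. -/
def param (s : SpaceModel.{u, v} dv t) (q : PluckerVar d dv) : s.F := s.r q.1 q.2

variable {ι β : Type}

/-- Quantifier free definability, uniformly in all models. -/
abbrev QF (P : ∀ s : SpaceModel.{u, v} dv t, (ι → s.F) → Prop) : Prop :=
  QFDef (starRingLang m) param P

/-- Definability by a term, uniformly in all models. -/
abbrev Tm (f : ∀ s : SpaceModel.{u, v} dv t, (ι → s.F) → s.F) : Prop :=
  TermDef (starRingLang m) param f

/-- The subspace `W s x` is the column span of one of finitely many matrices of terms, selected
by quantifier free conditions. -/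
def SpanDef (W : ∀ s : SpaceModel.{u, v} dv t, (ι → s.F) → Submodule s.F s.V) : Prop :=
  ∃ (I : Type) (_ : Finite I) (P : I → ∀ s : SpaceModel.{u, v} dv t, (ι → s.F) → Prop)
    (g : I → Fin d → Fin d → ∀ s : SpaceModel.{u, v} dv t, (ι → s.F) → s.F),
    (∀ i, QF (P i)) ∧ (∀ i a b, Tm (g i a b)) ∧ (∀ s x, ∃ i, P i s x) ∧
      ∀ i s x, P i s x → colSpan s.v (Matrix.of fun a b => g i a b s x) = W s x

variable {W W' : ∀ s : SpaceModel.{u, v} dv t, (ι → s.F) → Submodule s.F s.V}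

theorem SpanDef.congr (h : SpanDef W) (e : ∀ s x, W' s x = W s x) : SpanDef W' := by
  have : W' = W := by
    funext s x
    exact e s x
  rwa [this]

theorem SpanDef.of_terms {g : Fin d → Fin d → ∀ s : SpaceModel.{u, v} dv t, (ι → s.F) → s.F}
    (hg : ∀ a b, Tm (g a b)) :
    SpanDef fun s x => colSpan s.v (Matrix.of fun a b => g a b s x) :=
  ⟨Unit, inferInstance, fun _ _ _ => True, fun _ => g, fun _ => .true, fun _ => hg,
    fun _ _ => ⟨(), trivial⟩, fun _ _ _ _ => rfl⟩

theorem SpanDef.subst {W : ∀ s : SpaceModel.{u, v} dv t, (β → s.F) → Submodule s.F s.V}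
    (hW : SpanDef W) {f : β → ∀ s : SpaceModel.{u, v} dv t, (ι → s.F) → s.F}
    (hf : ∀ b, Tm (f b)) : SpanDef fun s x => W s fun b => f b s x := by
  obtain ⟨I, _, P, g, hP, hg, h₁, h₂⟩ := hW
  exact ⟨I, inferInstance, _, _, fun i => (hP i).subst hf, fun i a b => (hg i a b).subst hf,
    fun s x => h₁ s _, fun i s x h => h₂ i s _ h⟩

/-- Substitution of a matrix spanning `W s x` for some of the variables. -/
theorem SpanDef.bind (hW : SpanDef W)
    {Z : ∀ s : SpaceModel.{u, v} dv t, (ι ⊕ Fin d × Fin d → s.F) → Submodule s.F s.V}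
    (hZ : SpanDef Z) (e : ∀ s x (A : Matrix (Fin d) (Fin d) s.F), colSpan s.v A = W s x →
      Z s (Sum.elim x fun i => A i.1 i.2) = W' s x) : SpanDef W' := by
  obtain ⟨I, _, P, g, hP, hg, h₁, h₂⟩ := hW
  have hf (i : I) : SpanDef fun s x => Z s fun b =>
      Sum.elim (fun (k : ι) (s : SpaceModel.{u, v} dv t) (x : ι → s.F) => x k) (fun k s x => g i k.1 k.2 s x) b s x :=
    hZ.subst fun b => by
      cases b with
      | inl k => exact .var k
      | inr k => exact hg _ _ _
  choose J _ Q h hQ hh h₃ h₄ using hf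
  refine ⟨(i : I) × J i, inferInstance, fun j s x => P j.1 s x ∧ Q j.1 j.2 s x,
    fun j => h j.1 j.2, fun j => (hP _).and (hQ _ _), fun j => hh _ _, fun s x => ?_, ?_⟩
  · obtain ⟨i, hi⟩ := h₁ s x
    obtain ⟨j, hj⟩ := h₃ i s x
    exact ⟨⟨i, j⟩, hi, hj⟩
  · rintro ⟨i, j⟩ s x ⟨hi, hj⟩
    rw [h₄ i j s x hj, ← e s x _ (h₂ i s x hi)]
    beta_reduce
    congr 1
    funext b
    cases b <;> rfl

end SpaceModel

/-- One elimination step without division: with the pivot column `j`, where `f` does not vanish,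
every column is corrected to lie in the kernel of `f`. A vector of the intersection, multiplied by
the pivot value, is a combination of the corrected columns. -/
theorem colSpan_eliminate {F V : Type*} [Field F] [AddCommGroup V] [Module F V]
    (v : Module.Basis (Fin d) F V) (A : Matrix (Fin d) (Fin d) F) (f : V →ₗ[F] F) (j : Fin d)
    (hj : f (coordVec v fun i => A i j) ≠ 0) :
    colSpan v (Matrix.of fun a b => f (coordVec v fun i => A i j) * A a b -
      f (coordVec v fun i => A i b) * A a j) = colSpan v A ⊓ LinearMap.ker f := by
  have e (b : Fin d) : (coordVec v fun a => f (coordVec v fun i => A i j) * A a b -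
      f (coordVec v fun i => A i b) * A a j) = f (coordVec v fun i => A i j) •
        (coordVec v fun i => A i b) - f (coordVec v fun i => A i b) • coordVec v fun i => A i j := by
    simp only [coordVec, sub_smul, Finset.sum_sub_distrib, Finset.smul_sum, smul_smul]
  refine le_antisymm ((colSpan_le_iff v).2 fun b => ?_) fun x hx => ?_
  · simp only [Matrix.of_apply, e]
    refine ⟨Submodule.sub_mem _ (Submodule.smul_mem _ _ (coordVec_mem_colSpan v A b))
      (Submodule.smul_mem _ _ (coordVec_mem_colSpan v A j)), ?_⟩
    change f _ = 0
    rw [map_sub, map_smul, map_smul, smul_eq_mul, smul_eq_mul, mul_comm,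
      sub_self]
  · obtain ⟨hx, hf⟩ := hx
    obtain ⟨c, rfl⟩ := (mem_colSpan_iff v).1 hx
    rw [← Submodule.smul_mem_iff _ hj]
    replace hf : f _ = 0 := hf
    rw [coordVec_mulVec] at hf
    simp only [map_sum, map_smul, smul_eq_mul] at hf
    have : f (coordVec v fun i => A i j) • coordVec v (A.mulVec c) =
        ∑ b, c b • coordVec v fun a => f (coordVec v fun i => A i j) * A a b -
          f (coordVec v fun i => A i b) * A a j := by
      simp only [e, smul_sub, Finset.sum_sub_distrib, smul_smul]
      rw [← Finset.sum_smul, hf, zero_smul, sub_zero, coordVec_mulVec, Finset.smul_sum]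
      simp only [smul_smul, mul_comm]
    rw [this]
    exact Submodule.sum_mem _ fun b _ => Submodule.smul_mem _ _ (coordVec_mem_colSpan v (Matrix.of
      fun a b => f (coordVec v fun i => A i j) * A a b - f (coordVec v fun i => A i b) * A a j) b)

namespace SpaceModel

variable {ι β : Type} {W W' : ∀ s : SpaceModel.{u, v} dv t, (ι → s.F) → Submodule s.F s.V}

theorem SpanDef.inf_ker (hW : SpanDef W)
    {a : Fin d → ∀ s : SpaceModel.{u, v} dv t, (ι → s.F) → s.F} (ha : ∀ i, Tm (a i)) :
    SpanDef fun s x => W s x ⊓ LinearMap.ker (coeffForm s.v fun i => a i s x) := by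
  obtain ⟨I, _, P, g, hP, hg, h₁, h₂⟩ := hW
  have hc (i : I) (j : Fin d) : Tm fun s x => ∑ l, a l s x * g i l j s x :=
    TermDef.sum _ fun l => (ha l).mul (hg _ _ _)
  -- The case `none` means that all columns already lie in the kernel; `some j` means that the
  -- column `j` serves as pivot.
  refine ⟨I × Option (Fin d), inferInstance,
    fun i => i.2.elim (fun s x => P i.1 s x ∧ ∀ j, ∑ l, a l s x * g i.1 l j s x = 0)
      fun j s x => P i.1 s x ∧ ∑ l, a l s x * g i.1 l j s x ≠ 0,
    fun i => i.2.elim (g i.1) fun j k b s x => (∑ l, a l s x * g i.1 l j s x) * g i.1 k b s x -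
      (∑ l, a l s x * g i.1 l b s x) * g i.1 k j s x, ?_, ?_, fun s x => ?_, ?_⟩
  · rintro ⟨i, _ | j⟩
    · exact (hP i).and (.forall fun j => .eq (hc i j) .zero)
    · exact (hP i).and (.not (.eq (hc i j) .zero))
  · rintro ⟨i, _ | j⟩ k b
    · exact hg i k b
    · exact ((hc i j).mul (hg i k b)).sub ((hc i b).mul (hg i k j))
  · obtain ⟨i, hi⟩ := h₁ s x
    by_cases h : ∀ j, ∑ l, a l s x * g i l j s x = 0
    · exact ⟨(i, none), hi, h⟩
    · obtain ⟨j, hj⟩ := not_forall.1 h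
      exact ⟨(i, some j), hi, hj⟩
  · have e (i : I) (j : Fin d) s x : (coeffForm s.v fun i => a i s x)
        (coordVec s.v fun l => g i l j s x) = ∑ l, a l s x * g i l j s x := by
      simp only [coeffForm_apply, repr_coordVec]
    rintro ⟨i, _ | j⟩ s x ⟨hi, hj⟩
    · refine Eq.trans (h₂ i s x hi) (Eq.symm ?_)
      beta_reduce
      rw [← h₂ i s x hi, inf_eq_left, colSpan_le_iff]
      intro j
      rw [LinearMap.mem_ker]
      exact (e i j s x).trans (hj j)
    · beta_reduce
      rw [← h₂ i s x hi, ← colSpan_eliminate s.v _ _ j (by rwa [← e] at hj)]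
      simp only [Matrix.of_apply, e]
      rfl

theorem SpanDef.inf_iInf_ker (hW : SpanDef W) {K : Type*} [Finite K]
    {a : K → Fin d → ∀ s : SpaceModel.{u, v} dv t, (ι → s.F) → s.F}
    (ha : ∀ k i, Tm (a k i)) :
    SpanDef fun s x => W s x ⊓ ⨅ k, LinearMap.ker (coeffForm s.v fun i => a k i s x) := by
  classical
  cases nonempty_fintype K
  have h (T : Finset K) : SpanDef fun s x =>
      W s x ⊓ ⨅ k ∈ T, LinearMap.ker (coeffForm s.v fun i => a k i s x) := by
    induction T using Finset.induction_on with
    | empty => exact hW.congr fun s x => by simp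
    | insert k T _ ih =>
      exact (ih.inf_ker (ha k)).congr fun s x => by
        rw [Finset.iInf_insert, inf_assoc, inf_comm (LinearMap.ker _)]
  exact (h Finset.univ).congr fun s x => by simp

theorem SpanDef.top : SpanDef fun (s : SpaceModel.{u, v} dv t) (_ : ι → s.F) => ⊤ := by
  have h : SpanDef (ι := ι) fun s x => colSpan s.v
      (Matrix.of fun a b => if a = b then (1 : s.F) else 0) :=
    SpanDef.of_terms (dv := dv) (t := t) fun a b => by
      by_cases h : a = b
      · simpa only [if_pos h] using TermDef.one
      · simpa only [if_neg h] using TermDef.zero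
  refine h.congr fun s x => ?_
  rw [eq_comm, eq_top_iff, ← s.v.span_eq, Submodule.span_le]
  rintro _ ⟨j, rfl⟩
  have := coordVec_mem_colSpan s.v (Matrix.of fun a b => if a = b then (1 : s.F) else 0) j
  simpa [coordVec] using this

theorem SpanDef.bot : SpanDef fun (s : SpaceModel.{u, v} dv t) (_ : ι → s.F) => ⊥ := by
  refine (SpanDef.of_terms (dv := dv) (t := t) (g := fun _ _ _ _ => 0)
    fun a b => TermDef.zero).congr fun s x => ?_
  rw [eq_comm, eq_bot_iff, colSpan_le_iff]
  intro j
  simp [coordVec]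

/-- Orthogonality to a span is orthogonality to each column, and the scale factor common to all
diagonal values of the form cancels. Hence the values of the closed terms `t i` are sufficient
information on the form. -/
theorem orthogonal_colSpan (s : SpaceModel.{u, v} dv t) (A : Matrix (Fin d) (Fin d) s.F) :
    (colSpan s.v A).orthogonalBilin s.B = ⨅ j, LinearMap.ker
      (coeffForm s.v fun i => star (A i j) * closedVal s.c (t i)) := by
  obtain ⟨b, hb, h⟩ := s.exists_scale
  have e (j : Fin d) : s.B (coordVec s.v fun i => A i j) =
      b • coeffForm s.v fun i => star (A i j) * closedVal s.c (t i) := by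
    refine LinearMap.ext fun x => ?_
    rw [s.isOrthoBasis.apply_eq, LinearMap.smul_apply, coeffForm_apply, smul_eq_mul,
      Finset.mul_sum]
    refine Finset.sum_congr rfl fun i _ => ?_
    rw [repr_coordVec, h]
    ring
  ext x
  simp only [Submodule.mem_iInf]
  constructor
  · intro hx j
    have := hx _ (coordVec_mem_colSpan s.v A j)
    rw [e, LinearMap.smul_apply, smul_eq_mul] at this
    exact (mul_eq_zero.1 this).resolve_left hb
  · intro hx y hy
    rw [s.isInnerForm.herm x y]
    suffices colSpan s.v A ≤ LinearMap.ker (s.B x) by rw [show s.B x y = 0 from this hy, star_zero]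
    rw [colSpan_le_iff]
    intro j
    rw [LinearMap.mem_ker, s.isInnerForm.herm _ x, e, LinearMap.smul_apply, hx j, smul_zero,
      star_zero]

/-- The entries of a matrix spanning `W'` are first treated as new variables, over which the
complement is an intersection of kernels; `SpanDef.bind` then substitutes the actual terms. -/
theorem SpanDef.inf_orthogonal (hW : SpanDef W) (hW' : SpanDef W') :
    SpanDef fun s x => W s x ⊓ (W' s x).orthogonalBilin s.B := by
  have h : SpanDef fun s (x : ι ⊕ Fin d × Fin d → s.F) => W s (fun i => x (Sum.inl i)) ⊓
      ⨅ j, LinearMap.ker (coeffForm s.v fun i =>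
        star (x (Sum.inr (i, j))) * closedVal s.c (t i)) :=
    (hW.subst fun i => .var (Sum.inl i)).inf_iInf_ker fun j i =>
      (TermDef.star (.var (Sum.inr (i, j)))).mul (.closed _)
  refine hW'.bind h fun s x A hA => ?_
  rw [← hA, orthogonal_colSpan]
  rfl

theorem SpanDef.orthogonal (hW : SpanDef W) :
    SpanDef fun s x => (W s x).orthogonalBilin s.B :=
  (SpanDef.top.inf_orthogonal hW).congr fun _ _ => (top_inf_eq _).symm

theorem SpanDef.sup (hW : SpanDef W) (hW' : SpanDef W') : SpanDef fun s x => W s x ⊔ W' s x :=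
  (hW.orthogonal.inf_orthogonal hW').orthogonal.congr fun s _ => by
    rw [← orthogonal_sup, s.isOrthoBasis.orthogonal_orthogonal s.isInnerForm]

/-- Since `W'` is its own double orthogonal, inclusion means that each column spanning `W` is
orthogonal to each column spanning the complement of `W'`: finitely many equations between terms. -/
theorem SpanDef.qf_le (hW : SpanDef W) (hW' : SpanDef W') : QF fun s x => W s x ≤ W' s x := by
  obtain ⟨I, _, P, g, hP, hg, h₁, h₂⟩ := hW
  obtain ⟨J, _, Q, h, hQ, hh, h₃, h₄⟩ := hW'.orthogonal
  have key : QF fun s x => ∀ i j, P i s x → Q j s x → ∀ a b,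
      ∑ l, star (h j l a s x) * closedVal s.c (t l) * g i l b s x = 0 :=
    .forall fun i => .forall fun j => (hP i).imp ((hQ j).imp (.forall fun a => .forall fun b =>
      .eq (.sum _ fun l => ((hh j l a).star.mul (.closed _)).mul (hg i l b)) .zero))
  refine key.congr fun s x => ?_
  have e (i j) (hi : P i s x) (hj : Q j s x) : W s x ≤ W' s x ↔ ∀ a b,
      ∑ l, star (h j l a s x) * closedVal s.c (t l) * g i l b s x = 0 := by
    have h' := h₄ j s x hj
    beta_reduce at h'
    rw [← s.isOrthoBasis.orthogonal_orthogonal s.isInnerForm (W' s x), ← h',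
      ← h₂ i s x hi, orthogonal_colSpan, le_iInf_iff]
    refine forall_congr' fun a => ?_
    rw [colSpan_le_iff]
    simp only [LinearMap.mem_ker, coeffForm_apply, repr_coordVec, Matrix.of_apply]
  constructor
  · exact fun H i j hi hj => (e i j hi hj).1 H
  · intro H
    obtain ⟨i, hi⟩ := h₁ s x
    obtain ⟨j, hj⟩ := h₃ s x
    exact (e i j hi hj).2 (H i j hi hj)

theorem SpanDef.qf_eq (hW : SpanDef W) (hW' : SpanDef W') : QF fun s x => W s x = W' s x :=
  ((hW.qf_le hW').and (hW'.qf_le hW)).congr fun _ _ => le_antisymm_iff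

theorem spanDef_plSpace (k : Fin n) :
    SpanDef fun (s : SpaceModel.{u, v} dv t) (_ : ι → s.F) => plSpace s.v (s.r k) := by
  refine (SpanDef.top.inf_iInf_ker (dv := dv) (t := t) (K := Fin (dv k + 1) ↪o Fin d)
    (a := fun i m s _ => plCoeff (s.r k) i m) fun i m => ?_).congr fun _ _ => (top_inf_eq _).symm
  refine TermDef.sum _ fun l => ?_
  by_cases h : i l = m
  · simp only [if_pos h]
    exact (TermDef.one.neg.pow _).mul
      (TermDef.param (p := param) (⟨k, (Fin.succAboveOrderEmb l).trans i⟩ : PluckerVar d dv))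
  · simpa only [if_neg h] using TermDef.zero

/-- The tuple of subspaces with coordinates `s.r`. -/
noncomputable def subspaces (s : SpaceModel.{u, v} dv t) (k : Fin n) : Submodule s.F s.V :=
  if dv k = 0 then ⊥ else plSpace s.v (s.r k)

theorem spanDef_subspaces (k : Fin n) :
    SpanDef fun (s : SpaceModel.{u, v} dv t) (_ : ι → s.F) => s.subspaces k := by
  by_cases h : dv k = 0
  · simpa only [subspaces, if_pos h] using SpanDef.bot
  · simpa only [subspaces, if_neg h] using spanDef_plSpace k

instance (s : SpaceModel.{u, v} dv t) : latticeLang.Structure (Submodule s.F s.V) :=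
  latticeStructure s.B

theorem SpanDef.realize {α : Type} {w : ∀ s : SpaceModel.{u, v} dv t, (ι → s.F) →
    α → Submodule s.F s.V} (hw : ∀ a, SpanDef fun s x => w s x a) (T : latticeLang.Term α) :
    SpanDef fun s x => T.realize (w s x) := by
  induction T with
  | var a => exact hw a
  | func f ts ih =>
    cases f with
    | join => exact (ih 0).sup (ih 1)
    | zero => exact .bot
    | perp => exact (ih 0).orthogonal

/-- Every matrix codes a subspace, so the code condition is void; equations between lattice terms
are compared through their computed column spans. -/
theorem interpretation (dv : Fin n → ℕ) (t : Fin d → (starRingLang m).Term Empty) :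
    Interpretation (starRingLang m) latticeLang (J := Fin d × Fin d) (param (dv := dv) (t := t))
      (subspaces (dv := dv) (t := t)) (fun _ _ => True)
      (fun s z => colSpan s.v (Matrix.of fun a b => z (a, b))) where
  finite := inferInstance
  isEmpty _ := inferInstanceAs (IsEmpty Empty)
  code := .true
  surj s U := by
    obtain ⟨A, hA⟩ := exists_colSpan_eq s.v U
    exact ⟨fun i => A i.1 i.2, trivial, hA⟩
  eq k t₁ t₂ := by
    have h (T : latticeLang.Term (Fin n ⊕ Fin k)) :
        SpanDef fun s (x : Fin k × Fin d × Fin d → s.F) =>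
          T.realize (Sum.elim (subspaces (dv := dv) (t := t) s)
            fun i => colSpan s.v (Matrix.of fun a b => x (i, (a, b)))) := by
      refine .realize (fun a => ?_) T
      cases a with
      | inl a => exact spanDef_subspaces a
      | inr a => exact .of_terms fun i j => .var (a, (i, j))
    exact ⟨_, (h t₁).qf_eq (h t₂), fun s x _ => Iff.rfl⟩

end SpaceModel

end SpanDef

/-! ### Elements of the prime subfield as integer fractions. -/

section PrimeField

variable {F : Type*} [Field F] {m : ℕ}

theorem exists_int_div {x : F} (hx : x ∈ (⊥ : Subfield F)) :
    ∃ a b : ℤ, (b : F) ≠ 0 ∧ x * b = a := by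
  rw [← Subfield.closure_empty] at hx
  induction hx using Subfield.closure_induction with
  | mem x hx => exact hx.elim
  | one => exact ⟨1, 1, by simp, by simp⟩
  | add x y _ _ hx hy =>
    obtain ⟨a, b, h₀, h⟩ := hx
    obtain ⟨a', b', h₀', h'⟩ := hy
    refine ⟨a * b' + a' * b, b * b', by simpa using ⟨h₀, h₀'⟩, ?_⟩
    push_cast
    rw [← h, ← h']
    ring
  | neg x _ hx =>
    obtain ⟨a, b, h₀, h⟩ := hx
    exact ⟨-a, b, h₀, by push_cast; rw [← h]; ring⟩
  | inv x _ hx =>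
    obtain ⟨a, b, h₀, h⟩ := hx
    rcases eq_or_ne x 0 with rfl | hx
    · exact ⟨0, 1, by simp, by simp⟩
    · refine ⟨b, a, ?_, ?_⟩
      · rw [← h]
        exact mul_ne_zero hx h₀
      · rw [← h, inv_mul_cancel_left₀ hx]
  | mul x y _ _ hx hy =>
    obtain ⟨a, b, h₀, h⟩ := hx
    obtain ⟨a', b', h₀', h'⟩ := hy
    refine ⟨a * a', b * b', by simpa using ⟨h₀, h₀'⟩, ?_⟩
    push_cast
    rw [← h, ← h']
    ring

theorem exists_closedVal_eq_intCast (m : ℕ) (a : ℤ) : ∃ t : (starRingLang m).Term Empty,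
    ∀ (F : Type u) [Field F] [StarRing F] (c : Fin m → F), closedVal c t = a := by
  induction a using Int.induction_on with
  | zero =>
    exact ⟨.func (StarRingFunc.zero : (starRingLang m).Functions 0) Fin.elim0,
      fun F _ _ c => by simpa using (rfl : closedVal c _ = 0)⟩
  | succ a ih =>
    obtain ⟨t, ht⟩ := ih
    refine ⟨.func (StarRingFunc.add : (starRingLang m).Functions 2) ![t, .func
      (StarRingFunc.one : (starRingLang m).Functions 0) Fin.elim0], fun F _ _ c => ?_⟩
    push_cast at ht ⊢
    rw [← ht F c]
    rfl
  | pred a ih =>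
    obtain ⟨t, ht⟩ := ih
    refine ⟨.func (StarRingFunc.add : (starRingLang m).Functions 2) ![t, .func
      (StarRingFunc.neg : (starRingLang m).Functions 1) fun _ => .func
      (StarRingFunc.one : (starRingLang m).Functions 0) Fin.elim0], fun F _ _ c => ?_⟩
    push_cast at ht ⊢
    rw [← ht F c, sub_eq_add_neg]
    rfl

/-- Closed terms have no division, but a common factor of all `α i` is harmless for orthogonality,
so denominators can be cleared. -/
theorem exists_common_scale {F : Type u} [Field F] [StarRing F] {d : ℕ} {α : Fin d → F}
    (hα : ∀ i, α i ∈ (⊥ : Subfield F)) (c : Fin m → F) :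
    ∃ t : Fin d → (starRingLang m).Term Empty, ∃ b : F, b ≠ 0 ∧
      ∀ i, α i = b * closedVal c (t i) := by
  choose a b h₀ h using fun i => exists_int_div (hα i)
  have hp : ∏ i, (b i : F) ≠ 0 := Finset.prod_ne_zero_iff.2 fun i _ => h₀ i
  -- Multiplying `α i = a i / b i` by the product of all denominators gives this integer.
  choose t ht using fun i => exists_closedVal_eq_intCast.{u} m
    (a i * ∏ j ∈ Finset.univ.erase i, b j)
  refine ⟨t, (∏ i, (b i : F))⁻¹, inv_ne_zero hp, fun i => ?_⟩
  rw [ht]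
  push_cast
  rw [← h, mul_assoc, Finset.mul_prod_erase _ (fun i => (b i : F)) (Finset.mem_univ i), mul_comm,
    mul_inv_cancel_right₀ hp]

end PrimeField

/-! ### Translation from the lattice to the field. -/

section LatticeToField

variable {d n m : ℕ}

theorem exists_translation (dv : Fin n → ℕ) (t : Fin d → (starRingLang m).Term Empty)
    (φ : latticeLang.Formula (Fin n)) :
    ∃ ψ : (starRingLang m).Formula (PluckerVar d dv),
      (φ.IsQF → ψ.IsQF) ∧ (φ.IsExistential → ψ.IsExistential) ∧
      ∀ s : SpaceModel.{u, v} dv t, ψ.Realize s.param ↔ φ.Realize s.subspaces := by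
  have I := SpaceModel.interpretation.{v, u} dv t
  -- One translation must serve all syntactic classes, so it is chosen according to the smallest
  -- class containing `φ`; a quantifier free result is also existential.
  by_cases h : φ.IsQF
  · obtain ⟨ψ, h₁, h₂⟩ := I.exists_qf_formula h
    exact ⟨ψ, fun _ => h₁, fun _ => .of_isQF h₁, h₂⟩
  by_cases h' : φ.IsExistential
  · obtain ⟨β, _, ψ, h₁, h₂⟩ := I.exists_existential_formula h'
    refine ⟨FirstOrder.Language.Formula.iExs β ψ, fun h'' => (h h'').elim, fun _ =>
      BoundedFormula.isExistential_exs (.of_isQF (.relabel h₁ _)), fun s => ?_⟩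
    rw [FirstOrder.Language.Formula.realize_iExs, h₂]
  · obtain ⟨ψ, h₂⟩ := I.exists_formula φ
    exact ⟨ψ, fun h'' => (h h'').elim, fun h'' => (h' h'').elim, h₂⟩

theorem isScalarInvariantFormula_of_isScalarInvariant {F : Type*} [Field F] [StarRing F]
    {dv : Fin n → ℕ} {c : Fin m → F} {χ : (starRingLang m).Formula (PluckerVar d dv)}
    (h : IsScalarInvariant (definedInGrassmannian dv c χ)) :
    IsScalarInvariantFormula dv c χ := by
  intro r hr a ha
  have hr' : (fun k => a k • r k) ∈ grassmannianProd F d dv := by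
    obtain ⟨A, hA, h⟩ := exists_rank_mem_pluckerSet hr
    exact fun k => ⟨A k, hA k, smul_mem_pluckerSet (h k) (ha k)⟩
  constructor
  · intro h₁
    exact (h r ⟨hr, h₁⟩ a ha).2
  · intro h₁
    have := (h _ ⟨hr', h₁⟩ (fun k => (a k)⁻¹) fun k => inv_ne_zero (ha k)).2
    simpa only [smul_smul, inv_mul_cancel₀ (ha _), one_smul] using this

/-- For coordinates in the Grassmannian, membership is tested on one adapted basis and one tuple of
matrices; there the column spans are the subspaces that the translation speaks of. -/
theorem thetaLG_definedInLattice [NeZero d] {F : Type u} [Field F] [StarRing F] {V : Type v}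
    [AddCommGroup V] [Module F V] {B : V →ₗ⋆[F] V →ₗ[F] F} {α : Fin d → F} (hB : IsInnerForm B)
    (hα : Admissible B α) {dv : Fin n → ℕ} {t : Fin d → (starRingLang m).Term Empty}
    {c : Fin m → F} (hc : ∃ b : F, b ≠ 0 ∧ ∀ i, α i = b * closedVal c (t i))
    {φ : latticeLang.Formula (Fin n)} {ψ : (starRingLang m).Formula (PluckerVar d dv)}
    (h : ∀ s : SpaceModel.{u, v} dv t, ψ.Realize s.param ↔ φ.Realize s.subspaces) :
    thetaLG B α dv (definedInLattice B dv φ) = definedInGrassmannian dv c ψ := by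
  obtain ⟨_, _, v, hv⟩ := hα
  obtain ⟨b, hb, hbα⟩ := hc
  ext r
  by_cases hr : r ∈ grassmannianProd F d dv
  swap
  · exact ⟨fun h => (hr (thetaLG_subset h)).elim, fun h => (hr h.1).elim⟩
  obtain ⟨A, hA, hrA⟩ := exists_rank_mem_pluckerSet hr
  rw [mem_thetaLG_iff_of_mem_pluckerSet hB (isInvariantSet_definedInLattice φ) hv hA hrA]
  let s : SpaceModel.{u, v} dv t :=
    { F := F, c := c, V := V, B := B, v := v, r := r
      isInnerForm := hB
      isOrthoBasis := hv.1
      exists_scale := ⟨B (v 0) (v 0) * b, mul_ne_zero (IsOrthoBasis.ne_zero hv.1 hB 0) hb,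
        fun i => by rw [hv.apply_self hB, hbα, mul_assoc]⟩ }
  have hs : s.subspaces = fun k => colSpan v (A k) := by
    funext k
    by_cases hk : dv k = 0
    · rw [SpaceModel.subspaces, if_pos hk,
        colSpan_eq_bot_of_rank_eq_zero v ((hA k).trans hk)]
    · rw [SpaceModel.subspaces, if_neg hk, colSpan_eq_plSpace v hk (hA k) (hrA k)]
  have h₁ := h s
  rw [hs] at h₁
  constructor
  · intro h₂
    exact ⟨hr, h₁.2 h₂.2⟩
  · intro h₂
    exact ⟨fun k => by rw [finrank_colSpan, hA], h₁.1 h₂.2⟩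

theorem isScalarInvariantFormula_of_eq [NeZero d] {F : Type u} [Field F] [StarRing F] {V : Type v}
    [AddCommGroup V] [Module F V] {B : V →ₗ⋆[F] V →ₗ[F] F} {α : Fin d → F} (hB : IsInnerForm B)
    (hα : Admissible B α) {dv : Fin n → ℕ} {c : Fin m → F} {φ : latticeLang.Formula (Fin n)}
    {ψ : (starRingLang m).Formula (PluckerVar d dv)}
    (h : thetaLG B α dv (definedInLattice B dv φ) = definedInGrassmannian dv c ψ) :
    IsScalarInvariantFormula dv c ψ :=
  isScalarInvariantFormula_of_isScalarInvariant
    (h ▸ (isBiInvariant_thetaLG hB hα (isInvariantSet_definedInLattice φ)).2.1)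

end LatticeToField

/-! ### Von Staudt's constructions on a frame. -/

section FrameOperations

variable {F : Type*} [Field F] {V : Type*} [AddCommGroup V] [Module F V] {d : ℕ} [NeZero d]

/-- Every incidence computation on the frame is an instance: `x` is projected to `W` along `y`. As
`f` vanishes on `W` but not at `y`, the line of `y` misses `W`, and the modular law gives the
result. -/
theorem span_sup_span_inf {W : Submodule F V} {x y z : V} {c : F} (f : V →ₗ[F] F)
    (hf : W ≤ LinearMap.ker f) (hy : f y ≠ 0) (hz : z ∈ W) (hx : x = z + c • y) :
    (Submodule.span F {x} ⊔ Submodule.span F {y}) ⊓ W = Submodule.span F {z} := by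
  have h₁ : Submodule.span F {x} ⊔ Submodule.span F {y} =
      Submodule.span F {z} ⊔ Submodule.span F {y} := by
    have hy' : y ∈ Submodule.span F {y} := Submodule.mem_span_singleton_self y
    refine le_antisymm (sup_le ?_ le_sup_right) (sup_le ?_ le_sup_right)
    · rw [Submodule.span_singleton_le_iff_mem, hx]
      exact Submodule.add_mem_sup (Submodule.mem_span_singleton_self z)
        (Submodule.smul_mem _ _ hy')
    · rw [Submodule.span_singleton_le_iff_mem, show z = x + (-c) • y by rw [hx]; simp]
      exact Submodule.add_mem_sup (Submodule.mem_span_singleton_self x)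
        (Submodule.smul_mem _ _ hy')
  rw [h₁, sup_inf_assoc_of_le _ ((Submodule.span_singleton_le_iff_mem _ _).2 hz)]
  convert sup_bot_eq _
  rw [eq_bot_iff]
  rintro a ⟨ha, haW⟩
  obtain ⟨b, rfl⟩ := Submodule.mem_span_singleton.1 ha
  have : b * f y = 0 := by simpa using hf haW
  simp [(mul_eq_zero.1 this).resolve_right hy]

/-- The line of the point `a` on the coordinate axis `i` of the frame of `v`. -/
def framePt (v : Module.Basis (Fin d) F V) (i : Fin d) (a : F) : Submodule F V :=
  Submodule.span F {v 0 + a • v i}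

/-- The coordinate lines of the frame of `v`. -/
def frameE (v : Module.Basis (Fin d) F V) (i : Fin d) : Submodule F V := Submodule.span F {v i}

/-- The unit lines of the frame of `v`. -/
def frameU (v : Module.Basis (Fin d) F V) (i : Fin d) : Submodule F V :=
  Submodule.span F {v 0 - v i}

variable (E U : Fin d → Submodule F V) (i j : Fin d) (X Y : Submodule F V)

/-- The unit line in the plane of `E i` and `E j`. -/
def axisDiff : Submodule F V := (U j ⊔ U i) ⊓ (E i ⊔ E j)

/-- Transfer of a point from the axis `i` to the axis `j`. -/
def axisTransfer : Submodule F V := (X ⊔ axisDiff E U i j) ⊓ (E 0 ⊔ E j)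

/-- Addition of points on the axis `i`, with the auxiliary axis `j`. -/
def axisAdd : Submodule F V :=
  (((X ⊔ E j) ⊓ (axisTransfer E U i j Y ⊔ E i)) ⊔ axisDiff E U i j) ⊓ (E 0 ⊔ E i)

/-- Negation of points on the axis `i`, with the auxiliary axis `j`. -/
def axisNeg : Submodule F V :=
  axisTransfer E U j i ((((X ⊔ E j) ⊓ (E 0 ⊔ axisDiff E U i j)) ⊔ E i) ⊓ (E 0 ⊔ E j))

/-- Multiplication of points on the axis `i`, with the auxiliary axis `j`. -/
def axisMul : Submodule F V :=
  axisNeg E U i j (axisTransfer E U j i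
    ((X ⊔ ((axisTransfer E U i j Y ⊔ U i) ⊓ (E i ⊔ E j))) ⊓ (E 0 ⊔ E j)))

/-- The unit point on the axis `i`. -/
def axisOne : Submodule F V := axisNeg E U i j (U i)

/-- Exchange of the coordinates `0` and `i` for a point on the axis `i`. -/
def axisSwap : Submodule F V :=
  axisTransfer E U j i ((((X ⊔ U j) ⊓ (E i ⊔ E j)) ⊔ U i) ⊓ (E 0 ⊔ E j))

variable {i j} (v : Module.Basis (Fin d) F V)

theorem span_pair_le_ker {x y : V} (f : V →ₗ[F] F) (hx : f x = 0) (hy : f y = 0) :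
    Submodule.span F {x} ⊔ Submodule.span F {y} ≤ LinearMap.ker f := by
  refine sup_le ?_ ?_ <;> rw [Submodule.span_singleton_le_iff_mem] <;> assumption

theorem add_mem_span_pair {x y z : V} (a b : F) (h : z = a • x + b • y) :
    z ∈ Submodule.span F {x} ⊔ Submodule.span F {y} :=
  h ▸ Submodule.add_mem_sup (Submodule.smul_mem _ _ (Submodule.mem_span_singleton_self x))
    (Submodule.smul_mem _ _ (Submodule.mem_span_singleton_self y))

theorem axisDiff_frame (hi : i ≠ 0) (hj : j ≠ 0) :
    axisDiff (frameE v) (frameU v) i j = Submodule.span F {v i - v j} := by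
  refine span_sup_span_inf (c := 1) (v.coord 0) (span_pair_le_ker _ ?_ ?_) ?_
    (add_mem_span_pair 1 (-1) ?_) ?_
  · simp [hi]
  · simp [hj]
  · simp [hi]
  · module
  · module

theorem axisTransfer_frame (hi : i ≠ 0) (hj : j ≠ 0) (hij : i ≠ j) (a : F) :
    axisTransfer (frameE v) (frameU v) i j (framePt v i a) = framePt v j a := by
  rw [axisTransfer, axisDiff_frame v hi hj]
  refine span_sup_span_inf (c := a) (v.coord i) (span_pair_le_ker _ ?_ ?_) ?_
    (add_mem_span_pair 1 a ?_) ?_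
  · simp [hi.symm]
  · simp [hij.symm]
  · simp [hij.symm]
  · module
  · module

theorem axisAdd_frame (hi : i ≠ 0) (hj : j ≠ 0) (hij : i ≠ j) (a b : F) :
    axisAdd (frameE v) (frameU v) i j (framePt v i a) (framePt v i b) = framePt v i (a + b) := by
  have h : (framePt v i a ⊔ frameE v j) ⊓ (framePt v j b ⊔ frameE v i) =
      Submodule.span F {v 0 + a • v i + b • v j} := by
    -- The form vanishes at `v 0 + b • v j` and at `v i`, which span the plane being met.
    refine span_sup_span_inf (c := -b) (v.coord j - b • v.coord 0) (span_pair_le_ker _ ?_ ?_) ?_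
      (add_mem_span_pair 1 a ?_) ?_
    · simp [hj, hj.symm]
    · simp [hi, hij]
    · simp [hj]
    · module
    · module
  rw [axisAdd, axisTransfer_frame v hi hj hij, h, axisDiff_frame v hi hj]
  refine span_sup_span_inf (c := -b) (v.coord j) (span_pair_le_ker _ ?_ ?_) ?_
    (add_mem_span_pair 1 (a + b) ?_) ?_
  · simp [hj.symm]
  · simp [hij]
  · simp [hij]
  · module
  · module

theorem axisNeg_frame (hi : i ≠ 0) (hj : j ≠ 0) (hij : i ≠ j) (a : F) :
    axisNeg (frameE v) (frameU v) i j (framePt v i a) = framePt v i (-a) := by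
  have h : (framePt v i a ⊔ frameE v j) ⊓ (frameE v 0 ⊔ Submodule.span F {v i - v j}) =
      Submodule.span F {v 0 + a • (v i - v j)} := by
    refine span_sup_span_inf (c := a) (v.coord i + v.coord j) (span_pair_le_ker _ ?_ ?_) ?_
      (add_mem_span_pair 1 a ?_) ?_
    · simp [hi.symm, hj.symm]
    · simp [hij, hij.symm]
    · simp [hij.symm]
    · module
    · module
  have h' : (Submodule.span F {v 0 + a • (v i - v j)} ⊔ frameE v i) ⊓
      (frameE v 0 ⊔ frameE v j) = framePt v j (-a) := by
    refine span_sup_span_inf (c := a) (v.coord i) (span_pair_le_ker _ ?_ ?_) ?_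
      (add_mem_span_pair 1 (-a) ?_) ?_
    · simp [hi.symm]
    · simp [hij.symm]
    · simp
    · module
    · module
  rw [axisNeg, axisDiff_frame v hi hj, h, h', axisTransfer_frame v hj hi hij.symm]

theorem axisMul_frame (hi : i ≠ 0) (hj : j ≠ 0) (hij : i ≠ j) (a b : F) :
    axisMul (frameE v) (frameU v) i j (framePt v i a) (framePt v i b) = framePt v i (a * b) := by
  have h : (framePt v j b ⊔ frameU v i) ⊓ (frameE v i ⊔ frameE v j) =
      Submodule.span F {v i + b • v j} := by
    refine span_sup_span_inf (c := 1) (v.coord 0) (span_pair_le_ker _ ?_ ?_) ?_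
      (add_mem_span_pair 1 b ?_) ?_
    · simp [hi]
    · simp [hj]
    · simp [hi]
    · module
    · module
  have h' : (framePt v i a ⊔ Submodule.span F {v i + b • v j}) ⊓
      (frameE v 0 ⊔ frameE v j) = framePt v j (-(a * b)) := by
    refine span_sup_span_inf (c := a) (v.coord i) (span_pair_le_ker _ ?_ ?_) ?_
      (add_mem_span_pair 1 (-(a * b)) ?_) ?_
    · simp [hi.symm]
    · simp [hij.symm]
    · simp [hij.symm]
    · module
    · module
  -- The construction produces the product with the wrong sign, which the final `axisNeg` repairs.
  rw [axisMul, axisTransfer_frame v hi hj hij, h, h', axisTransfer_frame v hj hi hij.symm,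
    axisNeg_frame v hi hj hij, neg_neg]

theorem frameU_eq : frameU v i = framePt v i (-1) := by
  rw [frameU, framePt, neg_one_smul, sub_eq_add_neg]

theorem axisOne_frame (hi : i ≠ 0) (hj : j ≠ 0) (hij : i ≠ j) :
    axisOne (frameE v) (frameU v) i j = framePt v i 1 := by
  rw [axisOne, frameU_eq, axisNeg_frame v hi hj hij, neg_neg]

theorem frameE_zero_eq : frameE v 0 = framePt v i 0 := by
  rw [frameE, framePt, zero_smul, add_zero]

theorem axisSwap_frame (hi : i ≠ 0) (hj : j ≠ 0) (hij : i ≠ j) (a : F) :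
    axisSwap (frameE v) (frameU v) i j (Submodule.span F {v i + a • v 0}) = framePt v i a := by
  have h : (Submodule.span F {v i + a • v 0} ⊔ frameU v j) ⊓ (frameE v i ⊔ frameE v j) =
      Submodule.span F {v i + a • v j} := by
    refine span_sup_span_inf (c := a) (v.coord 0) (span_pair_le_ker _ ?_ ?_) ?_
      (add_mem_span_pair 1 a ?_) ?_
    · simp [hi]
    · simp [hj]
    · simp [hj]
    · module
    · module
  have h' : (Submodule.span F {v i + a • v j} ⊔ frameU v i) ⊓ (frameE v 0 ⊔ frameE v j) =
      framePt v j a := by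
    refine span_sup_span_inf (c := -1) (v.coord i) (span_pair_le_ker _ ?_ ?_) ?_
      (add_mem_span_pair 1 a ?_) ?_
    · simp [hi.symm]
    · simp [hij.symm]
    · simp [hi.symm]
    · module
    · module
  rw [axisSwap, h, h', axisTransfer_frame v hj hi hij.symm]

end FrameOperations

theorem coordVec_mem_iSup_frameE {F : Type*} [Field F] {V : Type*} [AddCommGroup V] [Module F V]
    {d : ℕ} (v : Module.Basis (Fin d) F V) {p : Fin d → Prop} {a : Fin d → F}
    (ha : ∀ l, ¬ p l → a l = 0) : coordVec v a ∈ ⨆ l : {l // p l}, frameE v l := by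
  refine Submodule.sum_mem _ fun l _ => ?_
  by_cases hl : p l
  · exact Submodule.mem_iSup_of_mem (⟨l, hl⟩ : {l // p l})
      (Submodule.smul_mem _ _ (Submodule.mem_span_singleton_self _))
  · rw [ha l hl, zero_smul]
    exact Submodule.zero_mem _

/-! ### Points on the axes and lines with given coordinates. -/

section AxisPoints

variable {F : Type*} [Field F] {V : Type*} [AddCommGroup V] [Module F V] {d : ℕ} [NeZero d]
  {E : Fin d → Submodule F V} {i : Fin d}

/-- `X` is a point of the axis `i` of the frame. -/
def IsAxisPt (E : Fin d → Submodule F V) (i : Fin d) (X : Submodule F V) : Prop :=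
  X ⊔ E i = E 0 ⊔ E i ∧ X ⊓ E i = ⊥

/-- A complement of `E i` in the plane of the axis contains exactly one vector of the form `v 0 + a
• v i`, and is spanned by it. -/
theorem isAxisPt_iff (v : Module.Basis (Fin d) F V) (hi : i ≠ 0) {X : Submodule F V} :
    IsAxisPt (frameE v) i X ↔ ∃ a, X = framePt v i a := by
  constructor
  · rintro ⟨h₁, h₂⟩
    have h₀ : v 0 ∈ X ⊔ frameE v i := by
      rw [h₁]
      exact Submodule.mem_sup_left (Submodule.mem_span_singleton_self _)
    obtain ⟨x, hx, y, hy, hxy⟩ := Submodule.mem_sup.1 h₀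
    obtain ⟨c, rfl⟩ := Submodule.mem_span_singleton.1 hy
    have hx' : x = v 0 + (-c) • v i := by rw [← hxy]; module
    refine ⟨-c, le_antisymm (fun z hz => ?_) ?_⟩
    · have hz' : z ∈ frameE v 0 ⊔ frameE v i := h₁ ▸ Submodule.mem_sup_left hz
      obtain ⟨_, hs, _, ht, rfl⟩ := Submodule.mem_sup.1 hz'
      obtain ⟨s, rfl⟩ := Submodule.mem_span_singleton.1 hs
      obtain ⟨t, rfl⟩ := Submodule.mem_span_singleton.1 ht
      have h₃ : (s • v 0 + t • v i) - s • x ∈ X ⊓ frameE v i := by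
        refine ⟨Submodule.sub_mem _ hz (Submodule.smul_mem _ _ hx), ?_⟩
        refine Submodule.mem_span_singleton.2 ⟨t + s * c, ?_⟩
        rw [hx']
        module
      rw [h₂, Submodule.mem_bot, sub_eq_zero] at h₃
      rw [h₃, hx']
      exact Submodule.smul_mem _ _ (Submodule.mem_span_singleton_self _)
    · rw [framePt, Submodule.span_singleton_le_iff_mem, ← hx']
      exact hx
  · rintro ⟨a, rfl⟩
    constructor
    · refine le_antisymm (sup_le ?_ le_sup_right) (sup_le ?_ le_sup_right)
      · rw [framePt, Submodule.span_singleton_le_iff_mem]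
        exact add_mem_span_pair 1 a (by module)
      · rw [frameE, Submodule.span_singleton_le_iff_mem]
        exact add_mem_span_pair 1 (-a) (by module)
    · rw [eq_bot_iff]
      rintro x ⟨hx, hx'⟩
      obtain ⟨s, rfl⟩ := Submodule.mem_span_singleton.1 hx
      obtain ⟨t, ht⟩ := Submodule.mem_span_singleton.1 hx'
      have := congrArg (v.coord 0) ht
      simp [hi] at this
      simp [← this]

theorem framePt_injective (v : Module.Basis (Fin d) F V) (hi : i ≠ 0) :
    Function.Injective (framePt v i) := by
  intro a b h
  have : v 0 + a • v i ∈ framePt v i b := h ▸ Submodule.mem_span_singleton_self _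
  obtain ⟨c, hc⟩ := Submodule.mem_span_singleton.1 this
  have h₀ := congrArg (v.coord 0) hc
  have h₁ := congrArg (v.coord i) hc
  simp [hi] at h₀
  simp [hi.symm, h₀] at h₁
  exact h₁.symm

/-- The line spanned by the vector with coordinate `1` at `0` and the other coordinates given by
the points `X m` on the axes. -/
def axisVec (E X : Fin d → Submodule F V) : Submodule F V :=
  ⨅ m : {m : Fin d // m ≠ 0}, X m ⊔ ⨆ l : {l : Fin d // l ≠ 0 ∧ l ≠ m}, E l

/-- In the join indexed by `m`, all coordinates other than `0` and `m` are free, so it is the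
hyperplane on which coordinate `m` is `a m` times coordinate `0`. The intersection of these
hyperplanes is the line. -/
theorem axisVec_frame (v : Module.Basis (Fin d) F V) {X : Fin d → Submodule F V} {a : Fin d → F}
    (hX : ∀ m, m ≠ 0 → X m = framePt v m (a m)) (ha : a 0 = 1) :
    axisVec (frameE v) X = Submodule.span F {coordVec v a} := by
  have h (m : {m : Fin d // m ≠ 0}) (x : V) :
      x ∈ X m ⊔ ⨆ l : {l : Fin d // l ≠ 0 ∧ l ≠ m}, frameE v l ↔
        v.repr x m = a m * v.repr x 0 := by
    obtain ⟨m, hm⟩ := m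
    rw [hX m hm]
    constructor
    · intro hx
      have : framePt v m (a m) ⊔ ⨆ l : {l : Fin d // l ≠ 0 ∧ l ≠ m}, frameE v l ≤
          LinearMap.ker (v.coord m - a m • v.coord 0) := by
        refine sup_le ?_ (iSup_le fun l => ?_)
        · rw [framePt, Submodule.span_singleton_le_iff_mem]
          simp [hm, hm.symm]
        · rw [frameE, Submodule.span_singleton_le_iff_mem]
          simp [l.2.1, l.2.2]
      have := this hx
      simpa [sub_eq_zero] using this
    · intro hx
      have e : x = v.repr x 0 • (v 0 + a m • v m) +
          coordVec v fun l => if l ≠ 0 ∧ l ≠ m then v.repr x l else 0 := by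
        refine v.repr.injective (Finsupp.ext fun l => ?_)
        rw [map_add, Finsupp.add_apply, repr_coordVec]
        by_cases h₀ : l = 0
        · subst h₀
          simp [hm]
        by_cases h₁ : l = m
        · subst h₁
          simp [hx, hm.symm, mul_comm]
        · simp [h₀, h₁, Finsupp.single_eq_of_ne h₀, Finsupp.single_eq_of_ne h₁]
      rw [e]
      refine Submodule.add_mem_sup (Submodule.smul_mem _ _ (Submodule.mem_span_singleton_self _))
        (coordVec_mem_iSup_frameE v fun l hl => if_neg hl)
  ext x
  rw [axisVec, Submodule.mem_iInf]
  simp only [h]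
  rw [Submodule.mem_span_singleton]
  constructor
  · intro hx
    refine ⟨v.repr x 0, v.repr.injective (Finsupp.ext fun l => ?_)⟩
    rw [map_smul, Finsupp.smul_apply, repr_coordVec, smul_eq_mul, mul_comm]
    by_cases hl : l = 0
    · rw [hl, ha, one_mul]
    · exact (hx ⟨l, hl⟩).symm
  · rintro ⟨c, rfl⟩ m
    rw [map_smul, Finsupp.smul_apply, Finsupp.smul_apply, repr_coordVec, repr_coordVec, ha]
    simp [mul_comm]

/-- The line spanned by a vector with coordinate `1` or `0` at `0`, according to `ε`, and the
other coordinates given by the points `X m` on the axes. -/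
def axisLine (E X : Fin d → Submodule F V) (ε : Bool) : Submodule F V :=
  bif ε then axisVec E X else (axisVec E X ⊔ E 0) ⊓ ⨆ l : {l : Fin d // l ≠ 0}, E l

theorem axisLine_frame (v : Module.Basis (Fin d) F V) {X : Fin d → Submodule F V} {a : Fin d → F}
    {ε : Bool} (hX : ∀ m, m ≠ 0 → X m = framePt v m (a m)) (ha : a 0 = bif ε then 1 else 0) :
    axisLine (frameE v) X ε = Submodule.span F {coordVec v a} := by
  cases ε with
  | true => exact axisVec_frame v hX ha
  | false =>
    -- The vector is first given coordinate `1` at `0`; projecting along `E 0` to the span of the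
    -- other axes then removes this coordinate.
    have h := axisVec_frame v (X := X) (a := Function.update a 0 1)
      (fun m hm => by rw [hX m hm, Function.update_of_ne hm]) (by simp)
    rw [axisLine, cond_false, h]
    refine span_sup_span_inf (c := 1) (v.coord 0) (iSup_le fun l => ?_) ?_
      (coordVec_mem_iSup_frameE v fun l hl => ?_) ?_
    · rw [frameE, Submodule.span_singleton_le_iff_mem]
      simp [l.2]
    · simp
    · rw [not_not.1 hl, ha, cond_false]
    · refine v.repr.injective (Finsupp.ext fun l => ?_)
      rw [map_add, Finsupp.add_apply, repr_coordVec, repr_coordVec]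
      by_cases hl : l = 0
      · subst hl
        simp [show a 0 = 0 from ha]
      · simp [Function.update_of_ne hl, Finsupp.single_eq_of_ne hl]

end AxisPoints

/-! ### Involution, norm ratios and orthogonal frames. -/

section OrthogonalFrames

variable {F : Type*} [Field F] [StarRing F] {V : Type*} [AddCommGroup V] [Module F V] {d : ℕ}
  [NeZero d] (B : V →ₗ⋆[F] V →ₗ[F] F) (E U : Fin d → Submodule F V) (i j : Fin d)
  (X : Submodule F V)

/-- The orthogonal complement of a point of the axis `i`, within the plane of the axis. -/
def axisPolar : Submodule F V := X.orthogonalBilin B ⊓ (E 0 ⊔ E i)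

/-- The involution on the points of the axis `i`, with the auxiliary axis `j`. -/
def axisStar : Submodule F V :=
  axisMul E U i j (axisNeg E U i j (axisSwap E U i j (axisPolar B E i X))) (axisPolar B E i (U i))

/-- The ratio of the norms of the basis vectors `i` and `0`, as a point of the axis `i`. -/
def axisRatio : Submodule F V := axisSwap E U i j (axisPolar B E i (U i))

variable {B i j} {v : Module.Basis (Fin d) F V}

/-- The vector `s • v 0 + t • v i` is orthogonal to `v 0 + a • v i` exactly if `s` times the norm of
`v 0` cancels `star a * t` times the norm of `v i`. So `a` is conjugated and scaled by the norm
ratio, with the roles of `v 0` and `v i` exchanged. -/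
theorem axisPolar_frame (hB : IsInnerForm B) (hv : IsOrthoBasis B v) (hi : i ≠ 0) (a : F) :
    axisPolar B (frameE v) i (framePt v i a) =
      Submodule.span F {v i + (-((B (v 0) (v 0))⁻¹ * B (v i) (v i) * star a)) • v 0} := by
  have h₀ := hv.ne_zero hB 0
  have h (s t : F) : B (v 0 + a • v i) (s • v 0 + t • v i) =
      s * B (v 0) (v 0) + star a * t * B (v i) (v i) := by
    simp only [map_add, map_smul, LinearMap.map_smulₛₗ, LinearMap.add_apply, LinearMap.smul_apply,
      smul_eq_mul, hv i 0 hi, hv 0 i hi.symm, starRingEnd_apply]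
    ring
  ext x
  rw [Submodule.mem_span_singleton]
  constructor
  · rintro ⟨hx, hx'⟩
    obtain ⟨_, hs, _, ht, rfl⟩ := Submodule.mem_sup.1 hx'
    obtain ⟨s, rfl⟩ := Submodule.mem_span_singleton.1 hs
    obtain ⟨t, rfl⟩ := Submodule.mem_span_singleton.1 ht
    refine ⟨t, ?_⟩
    have := hx _ (Submodule.mem_span_singleton_self _)
    rw [h] at this
    have hs : s = -(t * ((B (v 0) (v 0))⁻¹ * B (v i) (v i) * star a)) := by
      field_simp
      linear_combination this
    rw [hs]
    module
  · rintro ⟨t, rfl⟩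
    refine ⟨fun y hy => ?_, add_mem_span_pair
      (-(t * ((B (v 0) (v 0))⁻¹ * B (v i) (v i) * star a))) t (by module)⟩
    obtain ⟨c, rfl⟩ := Submodule.mem_span_singleton.1 hy
    have h₁ := h (-(t * ((B (v 0) (v 0))⁻¹ * B (v i) (v i) * star a))) t
    rw [show (-(t * ((B (v 0) (v 0))⁻¹ * B (v i) (v i) * star a))) • v 0 + t • v i =
      t • (v i + -((B (v 0) (v 0))⁻¹ * B (v i) (v i) * star a) • v 0) by module] at h₁
    rw [B.map_smulₛₗ c, LinearMap.smul_apply, h₁]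
    field_simp
    simp

theorem axisPolar_frameU (hB : IsInnerForm B) (hv : IsOrthoBasis B v) (hi : i ≠ 0) :
    axisPolar B (frameE v) i (frameU v i) =
      Submodule.span F {v i + ((B (v 0) (v 0))⁻¹ * B (v i) (v i)) • v 0} := by
  rw [frameU_eq, axisPolar_frame hB hv hi, star_neg, star_one, mul_neg_one, neg_neg]

theorem axisPolar_frameU' (hB : IsInnerForm B) (hv : IsOrthoBasis B v) (hi : i ≠ 0) :
    axisPolar B (frameE v) i (frameU v i) =
      framePt v i ((B (v 0) (v 0))⁻¹ * B (v i) (v i))⁻¹ := by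
  have hc : (B (v 0) (v 0))⁻¹ * B (v i) (v i) ≠ 0 :=
    mul_ne_zero (inv_ne_zero (hv.ne_zero hB 0)) (hv.ne_zero hB i)
  rw [axisPolar_frameU hB hv hi, framePt, ← Submodule.span_singleton_smul_eq hc.isUnit
    (v 0 + _), smul_add, smul_smul, mul_inv_cancel₀ hc, one_smul, add_comm]

/-- After the swap and the negation, the polar gives `star a` times the norm ratio; the polar of the
unit line is the point of the inverse ratio, and multiplication by it leaves `star a`. -/
theorem axisStar_frame (hB : IsInnerForm B) (hv : IsOrthoBasis B v) (hi : i ≠ 0) (hj : j ≠ 0)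
    (hij : i ≠ j) (a : F) :
    axisStar B (frameE v) (frameU v) i j (framePt v i a) = framePt v i (star a) := by
  have hc : (B (v 0) (v 0))⁻¹ * B (v i) (v i) ≠ 0 :=
    mul_ne_zero (inv_ne_zero (hv.ne_zero hB 0)) (hv.ne_zero hB i)
  rw [axisStar, axisPolar_frame hB hv hi, axisSwap_frame v hi hj hij, axisNeg_frame v hi hj hij,
    axisPolar_frameU' hB hv hi, axisMul_frame v hi hj hij, neg_neg, mul_comm,
    inv_mul_cancel_left₀ hc]

theorem axisRatio_frame (hB : IsInnerForm B) (hv : IsOrthoBasis B v) (hi : i ≠ 0) (hj : j ≠ 0)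
    (hij : i ≠ j) : axisRatio B (frameE v) (frameU v) i j =
      framePt v i ((B (v 0) (v 0))⁻¹ * B (v i) (v i)) := by
  rw [axisRatio, axisPolar_frameU hB hv hi, axisSwap_frame v hi hj hij]

variable (B) in
/-- `E` and `U` are the coordinate lines and unit lines of an orthogonal basis. -/
def IsOrthoFrame : Prop :=
  (∀ i, E i ≠ ⊥) ∧ (∀ i j, i ≠ j → E i ⊔ (E j).orthogonalBilin B = (E j).orthogonalBilin B) ∧
    ⨆ i, E i = ⊤ ∧ U 0 = ⊥ ∧ ∀ i, i ≠ 0 → IsAxisPt E i (U i) ∧ U i ⊓ E 0 = ⊥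

theorem isOrthoFrame_frame (hv : IsOrthoBasis B v) : IsOrthoFrame B (frameE v) (frameU v) := by
  refine ⟨fun i => ?_, fun i j hij => sup_eq_right.2 ?_, ?_, ?_, fun i hi => ⟨?_, ?_⟩⟩
  · rw [frameE, Ne, Submodule.span_singleton_eq_bot]
    exact v.ne_zero i
  · rw [frameE, Submodule.span_singleton_le_iff_mem]
    intro x hx
    obtain ⟨c, rfl⟩ := Submodule.mem_span_singleton.1 hx
    rw [LinearMap.map_smulₛₗ, LinearMap.smul_apply, hv j i hij.symm, smul_zero]
  · rw [← v.span_eq, Submodule.span_range_eq_iSup]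
    rfl
  · rw [frameU, sub_self, Submodule.span_zero_singleton]
  · exact (isAxisPt_iff v hi).2 ⟨-1, frameU_eq v⟩
  · rw [eq_bot_iff]
    rintro x ⟨hx, hx'⟩
    obtain ⟨s, rfl⟩ := Submodule.mem_span_singleton.1 hx
    obtain ⟨t, ht⟩ := Submodule.mem_span_singleton.1 hx'
    have := congrArg (v.coord i) ht
    simp [hi.symm] at this
    simp [this]

theorem IsOrthoFrame.exists_basis {E U : Fin d → Submodule F V} (h : IsOrthoFrame B E U)
    (hB : IsInnerForm B) (hd : Module.finrank F V = d) :
    ∃ v : Module.Basis (Fin d) F V, IsOrthoBasis B v ∧ E = frameE v ∧ U = frameU v := by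
  obtain ⟨h₁, h₂, h₃, h₄, h₅⟩ := h
  have hE {i j} (hij : i ≠ j) {x y : V} (hx : x ∈ E i) (hy : y ∈ E j) : B y x = 0 :=
    sup_eq_right.1 (h₂ i j hij) hx y hy
  -- A vector in `E i` and in the sum of the other lines is orthogonal to every `E j`, these span
  -- the space, and the form is non-degenerate.
  have hE' (i : Fin d) : Disjoint (E i) (⨆ j, ⨆ (_ : j ≠ i), E j) := by
    rw [Submodule.disjoint_def]
    intro x hx hx'
    refine hB.nondeg x fun w => ?_
    have hw : w ∈ ⨆ i, E i := h₃ ▸ Submodule.mem_top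
    induction hw using Submodule.iSup_induction' with
    | zero => simp
    | add _ _ _ _ ha hb => rw [map_add, LinearMap.add_apply, ha, hb, add_zero]
    | mem j y hy =>
      by_cases hij : i = j
      · subst hij
        have : ⨆ j, ⨆ (_ : j ≠ i), E j ≤ (E i).orthogonalBilin B :=
          iSup_le fun j => iSup_le fun hj => sup_eq_right.1 (h₂ j i hj)
        exact this hx' y hy
      · exact hE hij hx hy
  choose e he he' using fun i => Submodule.exists_mem_ne_zero_of_ne_bot (h₁ i)
  have hl : LinearIndependent F e := iSupIndep.linearIndependent E (fun i => hE' i) he he'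
  let b : Module.Basis (Fin d) F V :=
    basisOfLinearIndependentOfCardEqFinrank hl (by rw [Fintype.card_fin, hd])
  have hb (i) : b i = e i := by simp [b]
  have hEb : E = frameE b := by
    funext i
    refine le_antisymm (fun x hx => ?_) ?_
    · have h₆ : x - b.repr x i • b i ∈ E i ⊓ ⨆ j, ⨆ (_ : j ≠ i), E j := by
        refine ⟨Submodule.sub_mem _ hx (Submodule.smul_mem _ _ (hb i ▸ he i)), ?_⟩
        rw [show x - b.repr x i • b i = ∑ j ∈ Finset.univ.erase i, b.repr x j • b j by
          rw [sub_eq_iff_eq_add', Finset.add_sum_erase _ (fun j => b.repr x j • b j)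
            (Finset.mem_univ i), b.sum_repr]]
        refine Submodule.sum_mem _ fun j hj => Submodule.smul_mem _ _ ?_
        refine Submodule.mem_iSup_of_mem j (Submodule.mem_iSup_of_mem (Finset.ne_of_mem_erase hj) ?_)
        exact hb j ▸ he j
      rw [(hE' i).eq_bot, Submodule.mem_bot, sub_eq_zero] at h₆
      rw [h₆]
      exact Submodule.smul_mem _ _ (Submodule.mem_span_singleton_self _)
    · rw [frameE, Submodule.span_singleton_le_iff_mem]
      exact hb i ▸ he i
  -- The unit line is that of `b 0 + a • b i`, with `a ≠ 0` because it misses `E 0`. Replacing `b i`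
  -- by `-a • b i` keeps the coordinate lines and makes it the difference of two basis vectors. The
  -- index `0` needs scale `1`, since `b 0` enters all the unit lines.
  have hU (i : Fin d) : ∃ c : F, c ≠ 0 ∧ (i = 0 → c = 1) ∧
      U i = Submodule.span F {b 0 - c • b i} := by
    by_cases hi : i = 0
    · subst hi
      exact ⟨1, one_ne_zero, fun _ => rfl, by rw [h₄, one_smul, sub_self,
        Submodule.span_zero_singleton]⟩
    · obtain ⟨h₆, h₇⟩ := h₅ i hi
      rw [hEb, isAxisPt_iff b hi] at h₆
      obtain ⟨a, ha⟩ := h₆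
      refine ⟨-a, neg_ne_zero.2 ?_, fun h => (hi h).elim, by
        rw [ha, framePt, neg_smul, sub_neg_eq_add]⟩
      rintro rfl
      rw [ha, framePt, zero_smul, add_zero, hEb, frameE, inf_idem,
        Submodule.span_singleton_eq_bot] at h₇
      exact b.ne_zero 0 h₇
  choose c hc hc₀ hUc using hU
  have hw (i) : b.isUnitSMul (fun i => (hc i).isUnit) i = c i • b i :=
    Module.Basis.isUnitSMul_apply _ i
  refine ⟨b.isUnitSMul (fun i => (hc i).isUnit), fun i j hij => ?_, ?_, ?_⟩
  · rw [hw, hw, map_smul, LinearMap.map_smulₛₗ, LinearMap.smul_apply, hb, hb,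
      hE hij.symm (he j) (he i), smul_zero, smul_zero]
  · funext i
    rw [hEb, frameE, frameE, hw, Submodule.span_singleton_smul_eq (hc i).isUnit]
  · funext i
    rw [hUc, frameU, hw, hw, hc₀ 0 rfl, one_smul]

end OrthogonalFrames

theorem QFDef.const {L : FirstOrder.Language.{0, 0}} {S : Type*} {M : S → Type*}
    [∀ s, L.Structure (M s)] {κ ι : Type} {p : ∀ s, κ → M s} (q : Prop) :
    QFDef L p (ι := ι) fun _ _ => q := by
  by_cases h : q
  · simpa only [h] using QFDef.true
  · simpa only [h] using QFDef.false

/-! ### Lattice terms for the frame constructions. -/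

section LatticeModels

variable {F : Type u} [Field F] [StarRing F] {d : ℕ}

/-- An inner product space over `F` with an orthogonal basis of `d` vectors. -/
structure InnerSpace (F : Type u) [Field F] [StarRing F] (d : ℕ) where
  V : Type v
  [addCommGroup : AddCommGroup V]
  [module : Module F V]
  B : V →ₗ⋆[F] V →ₗ[F] F
  isInnerForm : IsInnerForm B
  exists_basis : ∃ v : Module.Basis (Fin d) F V, IsOrthoBasis B v

attribute [instance] InnerSpace.addCommGroup InnerSpace.module

instance (A : InnerSpace.{u, v} F d) : latticeLang.Structure (Submodule F A.V) :=
  latticeStructure A.B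

variable {S : Type*} {A : S → InnerSpace.{u, v} F d} {κ ι : Type}
  {p : ∀ s, κ → Submodule F (A s).V} {f g X Y : ∀ s, (ι → Submodule F (A s).V) → Submodule F (A s).V}

theorem TermDef.sup (hf : TermDef latticeLang p f) (hg : TermDef latticeLang p g) :
    TermDef latticeLang p fun s x => f s x ⊔ g s x :=
  TermDef.func (L := latticeLang) InvLatticeFunc.join (g := ![f, g])
    fun b => by fin_cases b <;> assumption

theorem TermDef.orthogonal (hf : TermDef latticeLang p f) :
    TermDef latticeLang p fun s x => (f s x).orthogonalBilin (A s).B :=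
  TermDef.func (L := latticeLang) InvLatticeFunc.perp (g := fun _ => f) fun _ => hf

theorem TermDef.bot :
    TermDef latticeLang p fun s (_ : ι → Submodule F (A s).V) => ⊥ :=
  TermDef.func (L := latticeLang) InvLatticeFunc.zero (g := Fin.elim0) fun b => b.elim0

theorem TermDef.top :
    TermDef latticeLang p fun s (_ : ι → Submodule F (A s).V) => ⊤ := by
  have h (s : S) : (⊥ : Submodule F (A s).V).orthogonalBilin (A s).B = ⊤ := by
    refine eq_top_iff.2 fun x _ y hy => ?_
    rw [(Submodule.mem_bot F).1 hy]
    change (A s).B 0 x = 0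
    rw [map_zero, LinearMap.zero_apply]
  simpa only [h] using TermDef.bot.orthogonal (p := p) (ι := ι)

theorem TermDef.inf (hf : TermDef latticeLang p f) (hg : TermDef latticeLang p g) :
    TermDef latticeLang p fun s x => f s x ⊓ g s x := by
  have h (s : S) (U W : Submodule F (A s).V) : U ⊓ W =
      (U.orthogonalBilin (A s).B ⊔ W.orthogonalBilin (A s).B).orthogonalBilin (A s).B := by
    obtain ⟨v, hv⟩ := (A s).exists_basis
    exact hv.inf_eq (A s).isInnerForm U W
  simpa only [h] using (hf.orthogonal.sup hg.orthogonal).orthogonal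

theorem TermDef.iSup {I : Type*} [Finite I]
    {h : I → ∀ s, (ι → Submodule F (A s).V) → Submodule F (A s).V}
    (hh : ∀ i, TermDef latticeLang p (h i)) :
    TermDef latticeLang p fun s x => ⨆ i, h i s x := by
  classical
  cases nonempty_fintype I
  have H (T : Finset I) : TermDef latticeLang p fun s x => ⨆ i ∈ T, h i s x := by
    induction T using Finset.induction_on with
    | empty => simpa only [Finset.notMem_empty, iSup_false, iSup_bot] using TermDef.bot
    | insert i T _ ih => simpa only [Finset.iSup_insert] using (hh i).sup ih
  simpa only [Finset.mem_univ, iSup_true] using H Finset.univ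

theorem TermDef.iInf {I : Type*} [Finite I]
    {h : I → ∀ s, (ι → Submodule F (A s).V) → Submodule F (A s).V}
    (hh : ∀ i, TermDef latticeLang p (h i)) :
    TermDef latticeLang p fun s x => ⨅ i, h i s x := by
  classical
  cases nonempty_fintype I
  have H (T : Finset I) : TermDef latticeLang p fun s x => ⨅ i ∈ T, h i s x := by
    induction T using Finset.induction_on with
    | empty => simpa only [Finset.notMem_empty, iInf_false, iInf_top] using TermDef.top
    | insert i T _ ih => simpa only [Finset.iInf_insert] using (hh i).inf ih
  simpa only [Finset.mem_univ, iInf_true] using H Finset.univ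

variable {E U : Fin d → ∀ s, (ι → Submodule F (A s).V) → Submodule F (A s).V}

theorem TermDef.axisDiff (hE : ∀ i, TermDef latticeLang p (E i))
    (hU : ∀ i, TermDef latticeLang p (U i)) (i j : Fin d) : TermDef latticeLang p fun s x =>
      axisDiff (fun i => E i s x) (fun i => U i s x) i j :=
  ((hU j).sup (hU i)).inf ((hE i).sup (hE j))

variable [NeZero d]

theorem TermDef.axisTransfer (hE : ∀ i, TermDef latticeLang p (E i))
    (hU : ∀ i, TermDef latticeLang p (U i)) (i j : Fin d) (hX : TermDef latticeLang p X) :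
    TermDef latticeLang p fun s x =>
      axisTransfer (fun i => E i s x) (fun i => U i s x) i j (X s x) :=
  (hX.sup (.axisDiff hE hU i j)).inf ((hE 0).sup (hE j))

theorem TermDef.axisAdd (hE : ∀ i, TermDef latticeLang p (E i))
    (hU : ∀ i, TermDef latticeLang p (U i)) (i j : Fin d) (hX : TermDef latticeLang p X)
    (hY : TermDef latticeLang p Y) : TermDef latticeLang p fun s x =>
      axisAdd (fun i => E i s x) (fun i => U i s x) i j (X s x) (Y s x) :=
  (((hX.sup (hE j)).inf ((TermDef.axisTransfer hE hU i j hY).sup (hE i))).sup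
    (.axisDiff hE hU i j)).inf ((hE 0).sup (hE i))

theorem TermDef.axisNeg (hE : ∀ i, TermDef latticeLang p (E i))
    (hU : ∀ i, TermDef latticeLang p (U i)) (i j : Fin d) (hX : TermDef latticeLang p X) :
    TermDef latticeLang p fun s x =>
      axisNeg (fun i => E i s x) (fun i => U i s x) i j (X s x) :=
  .axisTransfer hE hU j i ((((hX.sup (hE j)).inf ((hE 0).sup (.axisDiff hE hU i j))).sup
    (hE i)).inf ((hE 0).sup (hE j)))

theorem TermDef.axisMul (hE : ∀ i, TermDef latticeLang p (E i))
    (hU : ∀ i, TermDef latticeLang p (U i)) (i j : Fin d) (hX : TermDef latticeLang p X)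
    (hY : TermDef latticeLang p Y) : TermDef latticeLang p fun s x =>
      axisMul (fun i => E i s x) (fun i => U i s x) i j (X s x) (Y s x) :=
  .axisNeg hE hU i j (.axisTransfer hE hU j i ((hX.sup (((TermDef.axisTransfer hE hU i j hY).sup
    (hU i)).inf ((hE i).sup (hE j)))).inf ((hE 0).sup (hE j))))

theorem TermDef.axisOne (hE : ∀ i, TermDef latticeLang p (E i))
    (hU : ∀ i, TermDef latticeLang p (U i)) (i j : Fin d) : TermDef latticeLang p fun s x =>
      axisOne (fun i => E i s x) (fun i => U i s x) i j :=
  .axisNeg hE hU i j (hU i)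

theorem TermDef.axisSwap (hE : ∀ i, TermDef latticeLang p (E i))
    (hU : ∀ i, TermDef latticeLang p (U i)) (i j : Fin d) (hX : TermDef latticeLang p X) :
    TermDef latticeLang p fun s x =>
      axisSwap (fun i => E i s x) (fun i => U i s x) i j (X s x) :=
  .axisTransfer hE hU j i ((((hX.sup (hU j)).inf ((hE i).sup (hE j))).sup
    (hU i)).inf ((hE 0).sup (hE j)))

theorem TermDef.axisPolar (hE : ∀ i, TermDef latticeLang p (E i)) (i : Fin d)
    (hX : TermDef latticeLang p X) : TermDef latticeLang p fun s x =>
      axisPolar (A s).B (fun i => E i s x) i (X s x) :=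
  hX.orthogonal.inf ((hE 0).sup (hE i))

theorem TermDef.axisStar (hE : ∀ i, TermDef latticeLang p (E i))
    (hU : ∀ i, TermDef latticeLang p (U i)) (i j : Fin d) (hX : TermDef latticeLang p X) :
    TermDef latticeLang p fun s x =>
      axisStar (A s).B (fun i => E i s x) (fun i => U i s x) i j (X s x) :=
  .axisMul hE hU i j (.axisNeg hE hU i j (.axisSwap hE hU i j (.axisPolar hE i hX)))
    (.axisPolar hE i (hU i))

theorem TermDef.axisRatio (hE : ∀ i, TermDef latticeLang p (E i))
    (hU : ∀ i, TermDef latticeLang p (U i)) (i j : Fin d) : TermDef latticeLang p fun s x =>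
      axisRatio (A s).B (fun i => E i s x) (fun i => U i s x) i j :=
  .axisSwap hE hU i j (.axisPolar hE i (hU i))

theorem TermDef.axisVec (hE : ∀ i, TermDef latticeLang p (E i)) (hU : ∀ i, TermDef latticeLang p (U i)) :
    TermDef latticeLang p fun s x => axisVec (fun i => E i s x) (fun i => U i s x) :=
  .iInf fun m => (hU m).sup (.iSup fun l => hE l)

theorem TermDef.axisLine (hE : ∀ i, TermDef latticeLang p (E i))
    (hU : ∀ i, TermDef latticeLang p (U i)) (ε : Bool) : TermDef latticeLang p fun s x =>
      axisLine (fun i => E i s x) (fun i => U i s x) ε := by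
  cases ε with
  | true => exact .axisVec hE hU
  | false => exact ((TermDef.axisVec hE hU).sup (hE 0)).inf (.iSup fun l => hE l)

theorem QFDef.isAxisPt (hE : ∀ i, TermDef latticeLang p (E i)) (i : Fin d)
    (hX : TermDef latticeLang p X) : QFDef latticeLang p fun s x =>
      IsAxisPt (fun i => E i s x) i (X s x) :=
  (QFDef.eq (hX.sup (hE i)) ((hE 0).sup (hE i))).and (.eq (hX.inf (hE i)) .bot)

theorem QFDef.isOrthoFrame (hE : ∀ i, TermDef latticeLang p (E i))
    (hU : ∀ i, TermDef latticeLang p (U i)) : QFDef latticeLang p fun s x =>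
      IsOrthoFrame (A s).B (fun i => E i s x) (fun i => U i s x) :=
  (QFDef.forall fun i => (QFDef.eq (hE i) .bot).not).and
    ((QFDef.forall fun i => .forall fun j => (QFDef.const (i ≠ j)).imp
      (.eq ((hE i).sup (hE j).orthogonal) (hE j).orthogonal)).and
    ((QFDef.eq (.iSup hE) .top).and ((QFDef.eq (hU 0) .bot).and
      (.forall fun i => (QFDef.const (i ≠ 0)).imp
        ((QFDef.isAxisPt hE i (hU i)).and (.eq ((hU i).inf (hE 0)) .bot))))))

end LatticeModels

/-! ### Interpreting the field in the lattice. -/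

section FieldCoding

/-- An inner product space with a selected orthogonal basis `v` and scalars `z`. -/
structure CodedSpace (F : Type u) [Field F] [StarRing F] (d : ℕ) (Z : Type) extends
    InnerSpace.{u, v} F d where
  v : Module.Basis (Fin d) F V
  z : Z → F
  isOrthoBasis : IsOrthoBasis B v

namespace CodedSpace

variable {F : Type u} [Field F] [StarRing F] {d : ℕ} [NeZero d] {Z : Type}

/-- The scalars, with the ratios of the norms of the basis vectors as constants. -/
noncomputable def fieldModel (s : CodedSpace.{u, v} F d Z) : StarFieldModel.{u} d where
  F := F
  c i := (s.B (s.v 0) (s.v 0))⁻¹ * s.B (s.v i) (s.v i)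

/-- The value of a term in the field with these constants. -/
noncomputable def termVal (s : CodedSpace.{u, v} F d Z) {α : Type} (T : (starRingLang d).Term α)
    (y : α → F) : F := T.realize (M := s.fieldModel.F) y

/-- The frame of the basis and the scalars, as points on the axis `i`. -/
noncomputable def param (i : Fin d) (s : CodedSpace.{u, v} F d Z) : (Fin d ⊕ Fin d) ⊕ Z → Submodule F s.V :=
  Sum.elim (Sum.elim (frameE s.v) (frameU s.v)) fun q => framePt s.v i (s.z q)

variable {i j : Fin d}

theorem exists_termDef_realize (hi : i ≠ 0) (hj : j ≠ 0) (hij : i ≠ j) {ι α : Type}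
    (T : (starRingLang d).Term α)
    {X : α → ∀ s : CodedSpace.{u, v} F d Z, (ι → Submodule F s.V) → Submodule F s.V}
    (hX : ∀ a, TermDef latticeLang (param i) (X a)) :
    ∃ f : ∀ s : CodedSpace.{u, v} F d Z, (ι → Submodule F s.V) → Submodule F s.V,
      TermDef latticeLang (param i) f ∧ ∀ s x (y : α → F),
        (∀ a, X a s x = framePt s.v i (y a)) → f s x = framePt s.v i (s.termVal T y) := by
  have hE (m : Fin d) : TermDef latticeLang (ι := ι) (param i) fun (s : CodedSpace.{u, v} F d Z) _ =>
      frameE s.v m := .param (p := param (F := F) (Z := Z) i) (Sum.inl (Sum.inl m))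
  have hU (m : Fin d) : TermDef latticeLang (ι := ι) (param i) fun (s : CodedSpace.{u, v} F d Z) _ =>
      frameU s.v m := .param (p := param (F := F) (Z := Z) i) (Sum.inl (Sum.inr m))
  induction T with
  | var a => exact ⟨X a, hX a, fun s x y h => h a⟩
  | func f ts ih =>
    choose g hg h using ih
    cases f with
    | add =>
      refine ⟨_, .axisAdd (A := CodedSpace.toInnerSpace) hE hU i j (hg 0) (hg 1), fun s x y hx => ?_⟩
      rw [h 0 s x y hx, h 1 s x y hx]
      exact axisAdd_frame s.v hi hj hij _ _
    | mul =>
      refine ⟨_, .axisMul (A := CodedSpace.toInnerSpace) hE hU i j (hg 0) (hg 1), fun s x y hx => ?_⟩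
      rw [h 0 s x y hx, h 1 s x y hx]
      exact axisMul_frame s.v hi hj hij _ _
    | neg =>
      refine ⟨_, .axisNeg (A := CodedSpace.toInnerSpace) hE hU i j (hg 0), fun s x y hx => ?_⟩
      rw [h 0 s x y hx]
      exact axisNeg_frame s.v hi hj hij _
    | star =>
      refine ⟨_, .axisStar (A := CodedSpace.toInnerSpace) hE hU i j (hg 0), fun s x y hx => ?_⟩
      rw [h 0 s x y hx]
      exact axisStar_frame s.isInnerForm s.isOrthoBasis hi hj hij _
    | zero => exact ⟨_, hE 0, fun s x y hx => frameE_zero_eq s.v⟩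
    | one =>
      exact ⟨_, .axisOne (A := CodedSpace.toInnerSpace) hE hU i j,
        fun s x y hx => axisOne_frame s.v hi hj hij⟩
    | const m =>
      -- The constants are the norm ratios. For `m = 0` the ratio is `1`; for `m = i` it is
      -- constructed on the axis `i`; otherwise it is constructed on its own axis `m`, with
      -- auxiliary axis `i`, and transferred.
      by_cases hm : m = 0
      · refine ⟨_, .axisOne (A := CodedSpace.toInnerSpace) hE hU i j, fun s x y hx => ?_⟩
        refine (axisOne_frame s.v hi hj hij).trans (congrArg _ ?_)
        rw [← inv_mul_cancel₀ (s.isOrthoBasis.ne_zero s.isInnerForm 0), hm]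
        rfl
      by_cases hmi : m = i
      · refine ⟨_, .axisRatio (A := CodedSpace.toInnerSpace) hE hU i j, fun s x y hx => ?_⟩
        refine (axisRatio_frame s.isInnerForm s.isOrthoBasis hi hj hij).trans (congrArg _ ?_)
        rw [← hmi]
        rfl
      · refine ⟨_, .axisTransfer (A := CodedSpace.toInnerSpace) hE hU m i
          (.axisRatio (A := CodedSpace.toInnerSpace) hE hU m i), fun s x y hx => ?_⟩
        rw [axisRatio_frame s.isInnerForm s.isOrthoBasis hm hi hmi]
        exact axisTransfer_frame s.v hm hi hmi _

/-- Scalars are coded by the points of the axis `i`. The decoding `Function.invFun` has arbitrary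
values off the axis, which the code condition excludes. -/
theorem interpretation (hi : i ≠ 0) (hj : j ≠ 0) (hij : i ≠ j) {α : Type} (g : α → Z) :
    Interpretation (J := Unit) latticeLang (starRingLang d) (N := fun s => s.fieldModel.F)
      (param (F := F) i) (fun s a => s.z (g a))
      (fun s X => IsAxisPt (frameE s.v) i (X ()))
      (fun s X => Function.invFun (α := F) (framePt s.v i) (X ())) where
  finite := inferInstance
  isEmpty _ := inferInstanceAs (IsEmpty Empty)
  code := .isAxisPt (A := CodedSpace.toInnerSpace)
    (fun m => .param (p := param (F := F) (Z := Z) i) (Sum.inl (Sum.inl m))) i (.var ())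
  surj s n := ⟨fun _ => framePt s.v i n, (isAxisPt_iff s.v hi).2 ⟨n, rfl⟩,
    Function.leftInverse_invFun (framePt_injective s.v hi) n⟩
  eq k t₁ t₂ := by
    have hX (a : α ⊕ Fin k) : TermDef (ι := Fin k × Unit) latticeLang (param (F := F) (Z := Z) i)
        ((Sum.elim (fun a s _ => framePt s.v i (s.z (g a))) fun l _ x => x (l, ())) a) := by
      cases a with
      | inl a => exact .param (p := param (F := F) (Z := Z) i) (Sum.inr (g a))
      | inr l => exact .var (l, ())
    obtain ⟨f₁, hf₁, h₁⟩ := exists_termDef_realize hi hj hij t₁ hX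
    obtain ⟨f₂, hf₂, h₂⟩ := exists_termDef_realize hi hj hij t₂ hX
    refine ⟨_, QFDef.eq hf₁ hf₂, fun s x hx => ?_⟩
    rw [h₁ s x (Sum.elim (fun a => s.z (g a)) fun l => Function.invFun (α := F) (framePt s.v i) (x (l, ()))),
      h₂ s x (Sum.elim (fun a => s.z (g a)) fun l => Function.invFun (α := F) (framePt s.v i) (x (l, ())))]
    · exact (framePt_injective (F := F) s.v hi).eq_iff
    all_goals
      intro a
      cases a with
      | inl a => rfl
      | inr l =>
        obtain ⟨a, ha⟩ := (isAxisPt_iff s.v hi).1 (hx l)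
        exact (Function.invFun_eq ⟨a, ha.symm⟩).symm

end CodedSpace

end FieldCoding

/-! ### Field formulas as conditions on frames. -/

section FormulaTranslation

variable {F : Type u} [Field F] [StarRing F] {d : ℕ} [NeZero d] {Z : Type} {i j : Fin d}

/-- `Q` is a condition on a single space, not tied to a family: it is obtained from spaces with a
chosen frame and reused where the frame is a quantified variable. Its meaning is known only at
genuine frames and axis points. -/
theorem exists_qfDef_translation (hi : i ≠ 0) (hj : j ≠ 0) (hij : i ≠ j) {α : Type} (g : α → Z)
    {χ : (starRingLang d).Formula α} (hχ : χ.IsQF) :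
    ∃ Q : ∀ A : InnerSpace.{u, v} F d, ((Fin d ⊕ Fin d) ⊕ Z → Submodule F A.V) → Prop,
      (∀ {S : Type (max u (v + 1))} {A : S → InnerSpace.{u, v} F d} {κ : Type}
        {p : ∀ s, κ → Submodule F (A s).V}, QFDef latticeLang p fun s => Q (A s)) ∧
      ∀ s : CodedSpace.{u, v} F d Z, Q s.toInnerSpace (s.param i) ↔
        χ.Realize (M := s.fieldModel.F) fun a => s.z (g a) := by
  obtain ⟨ψ, h₁, h₂⟩ := (CodedSpace.interpretation.{u, v} (F := F) hi hj hij g).exists_qf_formula hχ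
  exact ⟨fun A x => ψ.Realize x, ⟨FirstOrder.Language.Formula.relabel Sum.inr ψ, h₁.relabel _,
    fun s x => FirstOrder.Language.Formula.realize_relabel⟩, h₂⟩

theorem exists_translation_of_field (hi : i ≠ 0) (hj : j ≠ 0) (hij : i ≠ j) {α : Type}
    (g : α → Z) (χ : (starRingLang d).Formula α) :
    ∃ Q : ∀ A : InnerSpace.{u, v} F d, ((Fin d ⊕ Fin d) ⊕ Z → Submodule F A.V) → Prop,
      (∀ {S : Type (max u (v + 1))} {A : S → InnerSpace.{u, v} F d} {κ : Type}
        {p : ∀ s, κ → Submodule F (A s).V}, FODef latticeLang p (fun s => Q (A s)) ∧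
          (χ.IsExistential → ExDef latticeLang p fun s => Q (A s))) ∧
      ∀ s : CodedSpace.{u, v} F d Z, Q s.toInnerSpace (s.param i) ↔
        χ.Realize (M := s.fieldModel.F) fun a => s.z (g a) := by
  have I := CodedSpace.interpretation.{u, v} (F := F) hi hj hij g
  by_cases h : χ.IsExistential
  · obtain ⟨β, _, ψ, h₁, h₂⟩ := I.exists_existential_formula h
    refine ⟨fun A x => ∃ y, ψ.Realize (Sum.elim x y), fun {S A κ p} => ?_, h₂⟩
    have : ExDef latticeLang p fun s x => ∃ y : β → Submodule F (A s).V,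
        ψ.Realize (Sum.elim x y) :=
      (QFDef.exDef ⟨FirstOrder.Language.Formula.relabel Sum.inr ψ, h₁.relabel _,
        fun s x => FirstOrder.Language.Formula.realize_relabel⟩ :
          ExDef latticeLang p fun s x => ψ.Realize x).exists
    exact ⟨this.foDef, fun _ => this⟩
  · obtain ⟨ψ, h₂⟩ := I.exists_formula χ
    exact ⟨fun A x => ψ.Realize x, fun {S A κ p} => ⟨⟨FirstOrder.Language.Formula.relabel Sum.inr ψ,
      fun s x => FirstOrder.Language.Formula.realize_relabel⟩, fun h' => (h h').elim⟩, h₂⟩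

end FormulaTranslation

/-! ### Witnesses for Plücker coordinates. -/

section PluckerWitness

/-- Variables for a tuple of coordinate vectors, a tuple of matrices, and coefficients. -/
abbrev WitnessVar (d : ℕ) {n : ℕ} (dv : Fin n → ℕ) : Type :=
  PluckerVar d dv ⊕ (Fin n × Fin d × Fin d) ⊕ PluckerVar d dv

variable {d n : ℕ} {dv : Fin n → ℕ}

/-- The matrices of a witness. -/
def witnessMatrix {M : Type*} (z : WitnessVar d dv → M) (k : Fin n) : Matrix (Fin d) (Fin d) M :=
  Matrix.of fun a b => z (Sum.inr (Sum.inl (k, a, b)))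

noncomputable instance (k : ℕ) : Fintype (Fin k ↪o Fin d) := Fintype.ofFinite _

/-- The constants `c` are the fractions `p i / q i`, and the coordinate vectors are
combinations of the vectors of minors of the matrices. -/
def IsPluckerWitness {F : Type*} [Field F] (p q : Fin d → ℤ) (c : Fin d → F)
    (z : WitnessVar d dv → F) : Prop :=
  (∀ i, c i * q i = p i) ∧ ∀ k, bif dv k = 0 then ∀ i, z (Sum.inl ⟨k, i⟩) = 0 else
    (∀ i, z (Sum.inl ⟨k, i⟩) = ∑ j, z (Sum.inr (Sum.inr ⟨k, j⟩)) *
      (Matrix.of fun a b => z (Sum.inr (Sum.inl (k, i a, j b)))).det) ∧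
      ∃ i, z (Sum.inl ⟨k, i⟩) ≠ 0

theorem exists_formula_isPluckerWitness (dv : Fin n → ℕ) (p q : Fin d → ℤ) :
    ∃ χ : (starRingLang d).Formula (WitnessVar d dv), χ.IsQF ∧
      ∀ (A : StarFieldModel.{u} d) (z : WitnessVar d dv → A.F),
        χ.Realize z ↔ IsPluckerWitness p q A.c z := by
  have hZ (a : ℤ) : TermDef (starRingLang d) (M := fun A : StarFieldModel.{u} d => A.F)
      (κ := Empty) (ι := WitnessVar d dv) (fun _ => Empty.elim) fun A _ => (a : A.F) := by
    obtain ⟨t, ht⟩ := exists_closedVal_eq_intCast.{u} d a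
    have := TermDef.closed (A := fun A : StarFieldModel.{u} d => A) (ι := WitnessVar d dv)
      (p := fun _ => Empty.elim) t
    simpa only [ht] using this
  have key : QFDef (starRingLang d) (M := fun A : StarFieldModel.{u} d => A.F)
      (κ := Empty) (ι := WitnessVar d dv) (fun _ => Empty.elim)
      fun A z => IsPluckerWitness p q A.c z := by
    refine .and (.forall fun i => .eq (.mul (.const i) (hZ _)) (hZ _)) (.forall fun k => ?_)
    by_cases hk : dv k = 0
    · simp only [hk, decide_true, cond_true]
      exact .forall fun i => .eq (.var _) .zero
    · simp only [hk, decide_false, cond_false]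
      refine .and (.forall fun i => .eq (.var _) (.sum _ fun j => .mul (.var _)
        (.det fun a b => .var _))) (.exists fun i => .not (.eq (.var _) .zero))
  obtain ⟨φ, h₁, h₂⟩ := key
  refine ⟨FirstOrder.Language.Formula.relabel (Sum.elim Empty.elim id) φ, h₁.relabel _, fun A z => ?_⟩
  refine Iff.trans ?_ (h₂ A z)
  rw [FirstOrder.Language.Formula.realize_relabel]
  refine iff_of_eq (congrArg _ ?_)
  funext i
  rcases i with i | i
  · exact i.elim
  · rfl

variable {F : Type*} [Field F]

theorem mem_pluckerSet_of_isPluckerWitness {p q : Fin d → ℤ} {c : Fin d → F}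
    {z : WitnessVar d dv → F} (h : IsPluckerWitness p q c z) (k : Fin n) :
    (fun i => z (Sum.inl ⟨k, i⟩)) ∈ pluckerSet (dv k) (witnessMatrix z k) := by
  have h := h.2 k
  by_cases hk : dv k = 0
  · rw [decide_eq_true hk, cond_true] at h
    rw [pluckerSet, if_pos hk]
    exact funext h
  · rw [decide_eq_false hk, cond_false] at h
    rw [mem_pluckerSet_iff hk, Submodule.mem_span_range_iff_exists_fun]
    refine ⟨⟨fun j => z (Sum.inr (Sum.inr ⟨k, j⟩)), ?_⟩, fun h' => ?_⟩
    · funext i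
      rw [Finset.sum_apply]
      exact (h.1 i).symm
    · obtain ⟨i, hi⟩ := h.2
      exact hi (congrFun h' i)

theorem exists_isPluckerWitness {p q : Fin d → ℤ} {c : Fin d → F} (hc : ∀ i, c i * q i = p i)
    {r : (k : Fin n) → PluckerVec F d (dv k)} {A : Fin n → Matrix (Fin d) (Fin d) F}
    (h : ∀ k, r k ∈ pluckerSet (dv k) (A k)) :
    ∃ z : WitnessVar d dv → F, IsPluckerWitness p q c z ∧ (∀ k i, z (Sum.inl ⟨k, i⟩) = r k i) ∧
      ∀ k, witnessMatrix z k = A k := by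
  have h' (k : Fin n) : ∃ b : (Fin (dv k) ↪o Fin d) → F, dv k ≠ 0 →
      ∑ j, b j • minorVec (A k) j = r k := by
    by_cases hk : dv k = 0
    · exact ⟨0, fun h => (h hk).elim⟩
    · obtain ⟨b, hb⟩ := (Submodule.mem_span_range_iff_exists_fun F).1
        ((mem_pluckerSet_iff hk).1 (h k)).1
      exact ⟨b, fun _ => hb⟩
  choose b hb using h'
  refine ⟨Sum.elim (fun a => r a.1 a.2) (Sum.elim (fun a => A a.1 a.2.1 a.2.2)
    fun a => b a.1 a.2), ⟨hc, fun k => ?_⟩, fun k i => rfl, fun k => rfl⟩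
  by_cases hk : dv k = 0
  · rw [decide_eq_true hk, cond_true]
    have := h k
    rw [pluckerSet, if_pos hk] at this
    exact congrFun this
  · rw [decide_eq_false hk, cond_false]
    refine ⟨fun i => ?_, ?_⟩
    · have := congrFun (hb k hk) i
      rw [Finset.sum_apply] at this
      exact this.symm
    · exact Function.ne_iff.1 ((mem_pluckerSet_iff hk).1 (h k)).2

/-- `axisLine` reaches only vectors whose coordinate at its base index is `0` or `1`; rescaling
columns normalises one row without changing the span. -/
theorem exists_colSpan_eq_zero_or_one {V : Type*} [AddCommGroup V] [Module F V]
    (v : Module.Basis (Fin d) F V) (A : Matrix (Fin d) (Fin d) F) (i : Fin d) :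
    ∃ A', colSpan v A' = colSpan v A ∧ ∀ l, A' i l = 0 ∨ A' i l = 1 := by
  classical
  have h (l : Fin d) : ∃ c : F, c ≠ 0 ∧ (c * A i l = 0 ∨ c * A i l = 1) := by
    by_cases h : A i l = 0
    · exact ⟨1, one_ne_zero, by simp [h]⟩
    · exact ⟨_, inv_ne_zero h, Or.inr (inv_mul_cancel₀ h)⟩
  choose c hc h using h
  refine ⟨Matrix.of fun a l => c l * A a l, ?_, h⟩
  rw [colSpan_eq_span, colSpan_eq_span, Submodule.span_range_eq_iSup, Submodule.span_range_eq_iSup]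
  refine iSup_congr fun l => ?_
  rw [← Submodule.span_singleton_smul_eq (hc l).isUnit (coordVec v fun a => A a l)]
  congr 2
  simp only [coordVec, Matrix.of_apply, Finset.smul_sum, smul_smul]

end PluckerWitness

/-! ### Quantifying out the remaining variables. -/

section ClosedFormulas

variable {L : FirstOrder.Language.{0, 0}} {S : Type*} {M : S → Type*} [∀ s, L.Structure (M s)]
  {κ β : Type} {p : ∀ s, κ → M s}

theorem ExDef.exists_formula_exists [Finite β] {P : ∀ s, (β → M s) → Prop} (h : ExDef L p P) :
    ∃ φ : L.Formula κ, φ.IsExistential ∧ ∀ s, φ.Realize (p s) ↔ ∃ x, P s x := by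
  obtain ⟨γ, hγ, Q, ⟨φ, hφ, h₁⟩, h₂⟩ := h
  refine ⟨FirstOrder.Language.Formula.iExs (β ⊕ γ) φ,
    BoundedFormula.isExistential_exs (.of_isQF (.relabel hφ _)), fun s => ?_⟩
  rw [FirstOrder.Language.Formula.realize_iExs]
  simp only [h₁, h₂]
  exact ⟨fun ⟨z, hz⟩ => ⟨z ∘ Sum.inl, z ∘ Sum.inr, by rwa [Sum.elim_comp_inl_inr]⟩,
    fun ⟨x, y, h⟩ => ⟨_, h⟩⟩

theorem FODef.exists_formula_exists [Finite β] {P : ∀ s, (β → M s) → Prop} (h : FODef L p P) :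
    ∃ φ : L.Formula κ, ∀ s, φ.Realize (p s) ↔ ∃ x, P s x := by
  obtain ⟨φ, h₁⟩ := h
  refine ⟨FirstOrder.Language.Formula.iExs β φ, fun s => ?_⟩
  rw [FirstOrder.Language.Formula.realize_iExs]
  simp only [h₁]

end ClosedFormulas

/-! ### Coordinatizing tuples of subspaces inside the lattice. -/

section Coordinatization

variable {F : Type u} [Field F] [StarRing F] {d n : ℕ} [NeZero d] {dv : Fin n → ℕ}

/-- `x` consists of an orthogonal frame and of scalars on its axis `i`, such that `u` is the tuple
of column spans of the matrices in `x`. The entries in the first rows are `0` or `1`. -/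
def IsCoordinatization {V : Type v} [AddCommGroup V] [Module F V] (B : V →ₗ⋆[F] V →ₗ[F] F)
    (i j : Fin d) (u : Fin n → Submodule F V)
    (x : (Fin d ⊕ Fin d) ⊕ WitnessVar d dv → Submodule F V) : Prop :=
  IsOrthoFrame B (fun m => x (Sum.inl (Sum.inl m))) (fun m => x (Sum.inl (Sum.inr m))) ∧
    (∀ q, IsAxisPt (fun m => x (Sum.inl (Sum.inl m))) i (x (Sum.inr q))) ∧
    ∀ k, ∃ ε : Fin d → Bool, (∀ l, x (Sum.inr (Sum.inr (Sum.inl (k, 0, l)))) =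
        bif ε l then axisOne (fun m => x (Sum.inl (Sum.inl m))) (fun m => x (Sum.inl (Sum.inr m))) i j
        else x (Sum.inl (Sum.inl 0))) ∧
      u k = ⨆ l, axisLine (fun m => x (Sum.inl (Sum.inl m))) (fun m =>
        bif decide (m = i) then x (Sum.inr (Sum.inr (Sum.inl (k, m, l)))) else
          axisTransfer (fun m => x (Sum.inl (Sum.inl m))) (fun m => x (Sum.inl (Sum.inr m))) i m
            (x (Sum.inr (Sum.inr (Sum.inl (k, m, l)))))) (ε l)

/-- An inner product space with a tuple of subspaces. -/
structure TupleSpace (F : Type u) [Field F] [StarRing F] (d n : ℕ) extends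
    InnerSpace.{u, v} F d where
  u : Fin n → Submodule F V

theorem qfDef_isCoordinatization (i j : Fin d) : QFDef latticeLang (TupleSpace.u (F := F) (d := d))
    fun (s : TupleSpace.{u, v} F d n) (x : (Fin d ⊕ Fin d) ⊕ WitnessVar d dv → Submodule F s.V) =>
      IsCoordinatization.{u, v} s.B i j s.u x := by
  refine .and (.isOrthoFrame (A := TupleSpace.toInnerSpace) (fun m => .var _) fun m => .var _)
    (.and (.forall fun q => .isAxisPt (A := TupleSpace.toInnerSpace) (fun m => .var _) i (.var _))
    (.forall fun k => .exists fun ε => .and (.forall fun l => .eq (.var _) ?_)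
      (.eq (.param (p := TupleSpace.u (F := F)) k) (.iSup (A := TupleSpace.toInnerSpace) fun l =>
        .axisLine (A := TupleSpace.toInnerSpace) (fun m => .var _) (fun m => ?_) _))))
  · cases ε l with
    | true => exact .axisOne (A := TupleSpace.toInnerSpace) (fun m => .var _) (fun m => .var _) i j
    | false => exact .var _
  · cases decide (m = i) with
    | true => exact .var _
    | false =>
      exact .axisTransfer (A := TupleSpace.toInnerSpace) (fun m => .var _) (fun m => .var _) i m
        (.var _)

theorem isCoordinatization_param {i j : Fin d} (hi : i ≠ 0) (hj : j ≠ 0) (hij : i ≠ j)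
    (s : CodedSpace.{u, v} F d (WitnessVar d dv)) (u : Fin n → Submodule F s.V) :
    IsCoordinatization s.B i j u (s.param i) ↔
      ∀ k, (∀ l, witnessMatrix s.z k 0 l = 0 ∨ witnessMatrix s.z k 0 l = 1) ∧
        u k = colSpan s.v (witnessMatrix s.z k) := by
  have h₁ (k : Fin n) (l : Fin d) (b : Bool) : (framePt s.v i (witnessMatrix s.z k 0 l) =
      bif b then axisOne (frameE s.v) (frameU s.v) i j else frameE s.v 0) ↔
      witnessMatrix s.z k 0 l = bif b then 1 else 0 := by
    cases b with
    | true =>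
      rw [cond_true, cond_true, axisOne_frame s.v hi hj hij, (framePt_injective s.v hi).eq_iff]
    | false =>
      rw [cond_false, cond_false, frameE_zero_eq (i := i), (framePt_injective s.v hi).eq_iff]
  have h₂ (k : Fin n) (ε : Fin d → Bool)
      (hε : ∀ l, witnessMatrix s.z k 0 l = bif ε l then 1 else 0) :
      (⨆ l, axisLine (frameE s.v) (fun m =>
        bif decide (m = i) then framePt s.v i (witnessMatrix s.z k m l) else
          axisTransfer (frameE s.v) (frameU s.v) i m
            (framePt s.v i (witnessMatrix s.z k m l))) (ε l)) =
        colSpan s.v (witnessMatrix s.z k) := by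
    rw [colSpan_eq_span, Submodule.span_range_eq_iSup]
    refine iSup_congr fun l => axisLine_frame s.v (fun m hm => ?_) (hε l)
    by_cases h : m = i
    · subst h
      rw [decide_eq_true rfl, cond_true]
    · rw [decide_eq_false h, cond_false, axisTransfer_frame s.v hi hm (Ne.symm h)]
  constructor
  · rintro ⟨-, -, h⟩ k
    obtain ⟨ε, hε, hu⟩ := h k
    have hε' l := (h₁ k l (ε l)).1 (hε l)
    refine ⟨fun l => ?_, hu.trans (h₂ k ε hε')⟩
    rw [hε']
    cases ε l <;> simp
  · intro h
    refine ⟨isOrthoFrame_frame s.isOrthoBasis, fun q => (isAxisPt_iff s.v hi).2 ⟨_, rfl⟩, fun k => ?_⟩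
    classical
    obtain ⟨h₃, h₄⟩ := h k
    have hε (l : Fin d) : witnessMatrix s.z k 0 l =
        bif decide (witnessMatrix s.z k 0 l = 1) then 1 else 0 := by
      rcases h₃ l with h | h <;> simp [h]
    exact ⟨fun l => decide (witnessMatrix s.z k 0 l = 1), fun l => (h₁ k l _).2 (hε l),
      h₄.trans (h₂ k _ hε).symm⟩

/-- Any solution of the lattice conditions comes from an actual orthogonal basis and actual scalars,
so the translations of field formulas may be evaluated at it. -/
theorem IsCoordinatization.exists_eq_param {i j : Fin d} (hi : i ≠ 0) {A : InnerSpace.{u, v} F d}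
    (hA : Module.finrank F A.V = d) {u : Fin n → Submodule F A.V}
    {x : (Fin d ⊕ Fin d) ⊕ WitnessVar d dv → Submodule F A.V}
    (h : IsCoordinatization A.B i j u x) :
    ∃ (v : Module.Basis (Fin d) F A.V) (z : WitnessVar d dv → F) (hv : IsOrthoBasis A.B v),
      x = CodedSpace.param i { A with v := v, z := z, isOrthoBasis := hv } := by
  obtain ⟨h₁, h₂, -⟩ := h
  obtain ⟨v, hv, hE, hU⟩ := h₁.exists_basis A.isInnerForm hA
  rw [hE] at h₂
  choose z hz using fun q => (isAxisPt_iff v hi).1 (h₂ q)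
  refine ⟨v, z, hv, ?_⟩
  funext a
  rcases a with (a | a) | a
  · exact congrFun hE a
  · exact congrFun hU a
  · exact hz a

end Coordinatization

/-! ### Translation from the field to the lattice. -/

section FieldToLattice

variable {F : Type u} [Field F] [StarRing F] {d n : ℕ} [NeZero d]

theorem exists_lattice_formula (hd : 3 ≤ d) (dv : Fin n → ℕ) {α : Fin d → F}
    (hα : ∀ i, α i ∈ (⊥ : Subfield F)) (χ : (starRingLang d).Formula (PluckerVar d dv)) :
    ∃ φ : latticeLang.Formula (Fin n), (χ.IsExistential → φ.IsExistential) ∧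
      ∀ (V : Type v) [AddCommGroup V] [Module F V] (B : V →ₗ⋆[F] V →ₗ[F] F),
        Module.finrank F V = d → IsInnerForm B → Admissible B α →
          thetaGL B α dv (definedInGrassmannian dv α χ) = definedInLattice B dv φ := by
  obtain ⟨i, j, hi, hj, hij⟩ : ∃ i j : Fin d, i ≠ 0 ∧ j ≠ 0 ∧ i ≠ j :=
    ⟨⟨1, by omega⟩, ⟨2, by omega⟩, by simp [Fin.ext_iff], by simp [Fin.ext_iff],
      by simp [Fin.ext_iff]⟩
  -- Writing `α i` as `p i / q i` lets the lattice formula state, by integer equations, that the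
  -- quantified frame has the norm ratios `α`.
  choose p q hq hpq using fun i => exists_int_div (hα i)
  obtain ⟨ξ, hξ, hξ'⟩ := exists_formula_isPluckerWitness.{u} dv p q
  obtain ⟨Q, hQ, hQ'⟩ := exists_qfDef_translation.{u, v} (F := F) hi hj hij id hξ
  obtain ⟨R, hR, hR'⟩ := exists_translation_of_field.{u, v} (F := F) hi hj hij
    (Sum.inl : PluckerVar d dv → WitnessVar d dv) χ
  have hG := (qfDef_isCoordinatization.{u, v} (F := F) (n := n) (dv := dv) i j).and
    (hQ (A := TupleSpace.toInnerSpace) (p := TupleSpace.u))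
  obtain ⟨φ, hφ, hφ'⟩ : ∃ φ : latticeLang.Formula (Fin n),
      (χ.IsExistential → φ.IsExistential) ∧ ∀ s : TupleSpace.{u, v} F d n, φ.Realize s.u ↔
        ∃ x, R s.toInnerSpace x ∧ IsCoordinatization (dv := dv) s.B i j s.u x ∧
          Q s.toInnerSpace x := by
    have hR := hR (A := TupleSpace.toInnerSpace) (p := TupleSpace.u (n := n))
    by_cases h : χ.IsExistential
    · obtain ⟨φ, h₁, h₂⟩ := ((hR.2 h).and_qfDef hG).exists_formula_exists
      exact ⟨φ, fun _ => h₁, h₂⟩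
    · obtain ⟨φ, h₂⟩ := (hR.1.and hG.foDef).exists_formula_exists
      exact ⟨φ, fun h' => (h h').elim, h₂⟩
  refine ⟨φ, hφ, fun V _ _ B hV hB hadm => Set.ext fun u => ?_⟩
  obtain ⟨_, _, v₀, hv₀⟩ := hadm
  let A : InnerSpace.{u, v} F d :=
    { V := V, B := B, isInnerForm := hB, exists_basis := ⟨v₀, hv₀.1⟩ }
  have hs := hφ' { A with u := u }
  rw [mem_thetaGL_iff]
  constructor
  · rintro ⟨v, C, r, hv, hC, hr, hrC, rfl⟩
    refine ⟨fun k => by rw [finrank_colSpan, hC], hs.2 ?_⟩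
    -- The matrices are normalised in row `0` so that their columns can be built from axis points;
    -- their Plücker sets are unchanged.
    choose C' hC' h₀ using fun k => exists_colSpan_eq_zero_or_one v (C k) 0
    obtain ⟨z, hz, hzr, hzC⟩ := exists_isPluckerWitness hpq (A := C')
      fun k => pluckerSet_subset v (hC' k).ge (hrC k)
    let s : CodedSpace.{u, v} F d (WitnessVar d dv) :=
      { A with v := v, z := z, isOrthoBasis := hv.1 }
    have hc : s.fieldModel.c = α := (funext hv.2).symm
    refine ⟨s.param i, (hR' s).2 ?_, (isCoordinatization_param hi hj hij s _).2 fun k => ?_,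
      (hQ' s).2 ((hξ' s.fieldModel z).2 ?_)⟩
    · have := hr.2
      rw [← hc, show (fun a : PluckerVar d dv => r a.1 a.2) = fun a => z (Sum.inl a) from
        funext fun a => (hzr _ _).symm] at this
      exact this
    · change (∀ l, witnessMatrix z k 0 l = 0 ∨ witnessMatrix z k 0 l = 1) ∧
        colSpan v (C k) = colSpan v (witnessMatrix z k)
      rw [hzC, hC']
      exact ⟨h₀ k, rfl⟩
    · rw [hc]
      exact hz
  · rintro ⟨hu, h⟩
    obtain ⟨x, h₁, h₂, h₃⟩ := hs.1 h
    obtain ⟨v, z, hv, rfl⟩ := IsCoordinatization.exists_eq_param (A := A) hi hV h₂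
    let s : CodedSpace.{u, v} F d (WitnessVar d dv) :=
      { A with v := v, z := z, isOrthoBasis := hv }
    replace h₁ := (hR' s).1 h₁
    replace h₂ := (isCoordinatization_param hi hj hij s _).1 h₂
    replace h₃ := (hξ' s.fieldModel z).1 ((hQ' s).1 h₃)
    -- The integer equations of the witness pin the norm ratios of the frame to `α`, so the
    -- recovered basis is an `α`-basis.
    have hc : s.fieldModel.c = α := by
      funext m
      exact mul_right_cancel₀ (M₀ := F) (hq m) ((h₃.1 m).trans (hpq m).symm)
    have hu' (k : Fin n) : u k = colSpan v (witnessMatrix z k) := (h₂ k).2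
    have hrk (k : Fin n) : (witnessMatrix z k).rank = dv k := by
      rw [← finrank_colSpan v, ← hu', hu k]
    refine ⟨v, witnessMatrix z, fun k i => z (Sum.inl ⟨k, i⟩), ⟨hv, congrFun hc.symm⟩, hrk,
      ⟨fun k => ⟨_, hrk k, mem_pluckerSet_of_isPluckerWitness h₃ k⟩, ?_⟩,
      mem_pluckerSet_of_isPluckerWitness h₃, funext hu'⟩
    rw [← hc]
    exact h₁

end FieldToLattice

theorem theorem14 (d : ℕ) [NeZero d] (hd : 3 ≤ d) (n : ℕ) (dv : Fin n → ℕ)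
    (hdv : ∀ k, dv k ≤ d) :
    -- the bijection
    (∀ (F : Type u) [Field F] [StarRing F] (V : Type v) [AddCommGroup V] [Module F V]
        (B : V →ₗ⋆[F] V →ₗ[F] F) (α : Fin d → F),
        Module.finrank F V = d → IsInnerForm B → Admissible B α →
        Set.BijOn (thetaLG B α dv)
          {M : Set (Fin n → Submodule F V) | M ⊆ dimTuples F V dv ∧ IsInvariantSet B M}
          {Δ | IsBiInvariant α dv Δ} ∧
        Set.InvOn (thetaGL B α dv) (thetaLG B α dv)
          {M : Set (Fin n → Submodule F V) | M ⊆ dimTuples F V dv ∧ IsInvariantSet B M}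
          {Δ | IsBiInvariant α dv Δ}) ∧
    -- (i): translation into formulas with constants for `α`, uniform in `F`, `α` and `V`
    (∃ τ : latticeLang.Formula (Fin n) → (starRingLang d).Formula (PluckerVar d dv),
      (∀ φ, φ.IsQF → (τ φ).IsQF) ∧
      (∀ φ, φ.IsExistential → (τ φ).IsExistential) ∧
      ∀ (F : Type u) [Field F] [StarRing F] (V : Type v) [AddCommGroup V] [Module F V]
        (B : V →ₗ⋆[F] V →ₗ[F] F) (α : Fin d → F),
        Module.finrank F V = d → IsInnerForm B → Admissible B α →
        ∀ φ,
          IsBiInvariant α dv (thetaLG B α dv (definedInLattice B dv φ)) ∧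
          thetaLG B α dv (definedInLattice B dv φ) = definedInGrassmannian dv α (τ φ) ∧
          IsScalarInvariantFormula dv α (τ φ)) ∧
    -- (i): translation into formulas without these constants, for `α` in the prime subfield
    (∀ (F : Type u) [Field F] [StarRing F] (α : Fin d → F), (∀ i, α i ∈ (⊥ : Subfield F)) →
      ∃ τ : latticeLang.Formula (Fin n) → (starRingLang 0).Formula (PluckerVar d dv),
        (∀ φ, φ.IsQF → (τ φ).IsQF) ∧
        (∀ φ, φ.IsExistential → (τ φ).IsExistential) ∧
        ∀ (V : Type v) [AddCommGroup V] [Module F V] (B : V →ₗ⋆[F] V →ₗ[F] F),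
          Module.finrank F V = d → IsInnerForm B → Admissible B α →
          ∀ φ,
            thetaLG B α dv (definedInLattice B dv φ) =
              definedInGrassmannian dv (Fin.elim0 : Fin 0 → F) (τ φ) ∧
            IsScalarInvariantFormula dv (Fin.elim0 : Fin 0 → F) (τ φ)) ∧
    -- (ii): translation back into the lattice language, for `α` in the prime subfield
    (∀ (F : Type u) [Field F] [StarRing F] (α : Fin d → F), (∀ i, α i ∈ (⊥ : Subfield F)) →
      ∃ σ : (starRingLang d).Formula (PluckerVar d dv) → latticeLang.Formula (Fin n),
        (∀ χ, χ.IsExistential → (σ χ).IsExistential) ∧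
        ∀ (V : Type v) [AddCommGroup V] [Module F V] (B : V →ₗ⋆[F] V →ₗ[F] F),
          Module.finrank F V = d → IsInnerForm B → Admissible B α →
          ∀ χ, IsBiInvariant α dv (definedInGrassmannian dv α χ) →
            thetaGL B α dv (definedInGrassmannian dv α χ) = definedInLattice B dv (σ χ)) := by

  refine ⟨fun F _ _ V _ _ B α _ hB hα => thetaLG_bijOn_invOn hB hα, ?_, fun F _ _ α hα => ?_,
    fun F _ _ α hα => ?_⟩
  -- The ratios are named by the constant symbols themselves, with scale `1`; hence the translation
  -- does not depend on `F` or `α`.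
  · choose τ h₁ h₂ h₃ using exists_translation.{u, v} dv
      fun i : Fin d => (.func (StarRingFunc.const i) Fin.elim0 : (starRingLang d).Term Empty)
    refine ⟨τ, h₁, h₂, fun F _ _ V _ _ B α _ hB hα φ => ?_⟩
    have h := thetaLG_definedInLattice hB hα (c := α)
      ⟨1, one_ne_zero, fun i => (one_mul _).symm⟩ (h₃ φ)
    exact ⟨isBiInvariant_thetaLG hB hα (isInvariantSet_definedInLattice φ), h,
      isScalarInvariantFormula_of_eq hB hα h⟩
  -- Here integer terms without constants describe `α` up to a common factor; these terms depend on
  -- `α` and `F`, and so does the translation.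
  · obtain ⟨t, ht⟩ := exists_common_scale hα (Fin.elim0 : Fin 0 → F)
    choose τ h₁ h₂ h₃ using exists_translation.{u, v} dv t
    refine ⟨τ, h₁, h₂, fun V _ _ B _ hB hα φ => ?_⟩
    have h := thetaLG_definedInLattice hB hα ht (h₃ φ)
    exact ⟨h, isScalarInvariantFormula_of_eq hB hα h⟩
  · choose σ h₁ h₂ using exists_lattice_formula.{u, v} hd dv hα
    exact ⟨σ, h₁, fun V _ _ B hV hB hadm χ _ => h₂ χ V B hV hB hadm⟩
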